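/- Work on a coordinate patch, i.e. an open set $U\subseteq\mathbb R^4$ with coordinates $x^1,\dots,x^4$, with a smooth metric $g$ of signature $(+,-,-,-)$ and a smooth null tetrad $l,n,m,\overline m$ ($l\cdot n=1$, $m\cdot\overline m=-1$, all other inner products zero) which is in the canonical form for Petrov type II, i.e. its Weyl components satisfy $\Psi_4=1$, $\Psi_2\neq0$, $\Psi_0=\Psi_1=\Psi_3=0$ on $U$. Write $D,\Delta,\delta,\overline\delta$ for the derivatives along $l,n,m,\overline m$, and $\pounds_\xi$ for the Lie derivative. A smooth real vector field $\xi$ is a (conformal) Killing vector ((C)KV) with conformal factor $\varphi$ (a smooth real function) if $\pounds_\xi g=\varphi g$; it is a homothetic vector (HV) if $\varphi$ is constant and a Killing vector (KV) if $\varphi=0$. A scalar $\eta$ is Lie recurrent with weight $w$ relative to $\xi$ if $\pounds_\xi\eta=w\frac{\varphi}{2}\eta$, and Lie derived if $\pounds_\xi\eta=0$. A combination of the NP scalars of a tetrad is a scalar obtained from the twelve Newman–Penrose spin coefficients and the Riemann tensor components $\Psi_k,\Phi_{ij},\Lambda$ by repeatedly forming smooth functions of finitely many such scalars (sums, products, complex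 conjugates, quotients by non-vanishing scalars, etc.) and applying the NP derivatives of the tetrad. It is properly conformally weighted with weight $w$ if replacing $g$ by $\Omega^2g$ and each contravariant tetrad vector by $\Omega^{-1}$ times itself multiplies it by $\Omega^w$, locally and for all smooth $\Omega>0$ for which it remains defined; it is homogeneous of weight $w$ if this holds for constant $\Omega$. Near each point of $U$ there is a gauge factor with smooth $A\exp(\frac i2\alpha_0)=(\Psi_4/\Psi_2)^{1/4}$. Suppose real functions $A,\alpha_0$ on $U$ are such that $A\exp(\frac i2\alpha_0)$ is smooth and $\bigl(A\exp(\frac i2\alpha_0)\bigr)^4=\Psi_4/\Psi_2$, and put $\widehat l=A^2l$, $\widehat n=A^{-2}n$, $\widehat m=\exp(i\alpha_0)m$. Then $\widehat l,\widehat n,\widehat m,\overline{\widehat m}$ is again a smooth normalized null tetrad, $\widehat\Psi_4=\widehat\Psi_2$, and a smooth vector field $\xi$ is a (C)KV with conformal factor $\varphi$ (smooth) if and only if $$[\widehat D,\pounds_\xi]x^i=\tfrac12\varphi\,\widehat Dx^i\qquad(i=1,2,3,4)$$ and the corresponding equations with $\widehat\Delta,\widehat\delta,\overline{\widehat\delta}$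 in place of $\widehat D$ hold on $U$. Furthermore, in the transformed tetrad, (a) every combination of the NP scalars which is properly conformally weighted with weight $w$ is Lie recurrent with weight $w$ relative to each (C)KV; (b) every combination of the NP scalars which is homogeneous of weight $w$ is Lie recurrent with weight $w$ relative to each HV, and every combination of the NP scalars whatsoever is Lie derived relative to each KV. For KVs only, the original canonical tetrad suffices: a smooth vector field $\xi$ is a KV if and only if $[D,\pounds_\xi]x^i=0$ $(i=1,2,3,4)$ and the corresponding equations with $\Delta,\delta,\overline\delta$ hold on $U$; and all combinations of the NP scalars of the original tetrad are Lie derived relative to each KV. -/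

import Mathlib

open scoped ContDiff Topology

noncomputable section

namespace NewmanPenrose

/-- Points of a coordinate patch, i.e. quadruples of coordinates `x^i`. -/
abbrev Pt : Type := Fin 4 → ℝ

/-- The partial derivative `∂_i f` with respect to the `i`-th coordinate. -/
def pd {F : Type*} [NormedAddCommGroup F] [NormedSpace ℝ F] (i : Fin 4) (f : Pt → F) (x : Pt) : F :=
  fderiv ℝ f x (Pi.single i 1)

/-! ### Metric, connection, curvature (signature `+ - - -`) -/

/-- The covariant components `g_{ab}` of a (candidate) metric. -/
abbrev MetricField : Type := Pt → Matrix (Fin 4) (Fin 4) ℝ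

/-- `g` is a smooth metric of signature `(+,-,-,-)` on `U`. -/
structure IsLorentzMetricOn (g : MetricField) (U : Set Pt) : Prop where
  smooth : ∀ a b, ContDiffOn ℝ ∞ (fun x => g x a b) U
  symm : ∀ x ∈ U, ∀ a b, g x a b = g x b a
  signature : ∀ x ∈ U, ∃ P : Matrix (Fin 4) (Fin 4) ℝ,
    IsUnit P.det ∧ P.transpose * g x * P = Matrix.diagonal ![1, -1, -1, -1]

/-- The contravariant components `g^{ab}`. -/
def gInv (g : MetricField) (x : Pt) (a b : Fin 4) : ℝ := (g x)⁻¹ a b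

/-- The Christoffel symbols `Γ^a_{bc}`. -/
def christoffel (g : MetricField) (a b c : Fin 4) (x : Pt) : ℝ :=
  (1 / 2) * ∑ d, gInv g x a d *
    (pd b (fun y => g y d c) x + pd c (fun y => g y d b) x - pd d (fun y => g y b c) x)

/-- The curvature tensor `R^a_{bcd} = ∂_c Γ^a_{db} - ∂_d Γ^a_{cb} + Γ^a_{ce} Γ^e_{db} - Γ^a_{de} Γ^e_{cb}`. -/
def riemannUp (g : MetricField) (a b c d : Fin 4) (x : Pt) : ℝ :=
  pd c (christoffel g a d b) x - pd d (christoffel g a c b) x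
    + ∑ e, (christoffel g a c e x * christoffel g e d b x
      - christoffel g a d e x * christoffel g e c b x)

/-- `R_{abcd}`. -/
def riemann (g : MetricField) (a b c d : Fin 4) (x : Pt) : ℝ :=
  ∑ e, g x a e * riemannUp g e b c d x

/-- The Ricci tensor `R_{bd} = R^a_{bad}`. -/
def ricci (g : MetricField) (b d : Fin 4) (x : Pt) : ℝ := ∑ a, riemannUp g a b a d x

/-- The scalar curvature `g^{ab} R_{ab}`. -/
def scalarCurv (g : MetricField) (x : Pt) : ℝ := ∑ a, ∑ b, gInv g x a b * ricci g a b x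

/-- The Weyl tensor `C_{abcd}`. -/
def weyl (g : MetricField) (a b c d : Fin 4) (x : Pt) : ℝ :=
  riemann g a b c d x
    - (1 / 2) * (g x a c * ricci g b d x - g x a d * ricci g b c x
      - g x b c * ricci g a d x + g x b d * ricci g a c x)
    + (1 / 6) * scalarCurv g x * (g x a c * g x b d - g x a d * g x b c)

/-- `g(v, w)`, extended complex bilinearly. -/
def gDot (g : MetricField) (x : Pt) (v w : Fin 4 → ℂ) : ℂ :=
  ∑ a, ∑ b, (g x a b : ℂ) * v a * w b

/-- `C(v, w, y, z)`, extended complex multilinearly. -/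
def weylC (g : MetricField) (x : Pt) (v w y z : Fin 4 → ℂ) : ℂ :=
  ∑ a, ∑ b, ∑ c, ∑ d, (weyl g a b c d x : ℂ) * v a * w b * y c * z d

/-- `Ric(v, w)`, extended complex bilinearly. -/
def ricciC (g : MetricField) (x : Pt) (v w : Fin 4 → ℂ) : ℂ :=
  ∑ a, ∑ b, (ricci g a b x : ℂ) * v a * w b

/-- The derivative `v(η) = v^i ∂_i η` of a complex scalar along a complex vector field. -/
def dirDeriv (v : Pt → Fin 4 → ℂ) (η : Pt → ℂ) (x : Pt) : ℂ := ∑ i, v x i * pd i η x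

/-- The covariant derivative `∇_u v` of complex vector fields. -/
def covDeriv (g : MetricField) (u v : Pt → Fin 4 → ℂ) (x : Pt) (a : Fin 4) : ℂ :=
  dirDeriv u (fun y => v y a) x + ∑ b, ∑ c, (christoffel g a b c x : ℂ) * u x b * v x c

/-! ### Null tetrads -/

/-- The contravariant components of a tetrad `l, n, m, m̄` (`l`, `n` real, `m` complex). -/
structure Tetrad where
  l : Pt → Fin 4 → ℝ
  n : Pt → Fin 4 → ℝ
  m : Pt → Fin 4 → ℂ

/-- Names for the four tetrad vectors. -/
inductive Leg
  | l
  | n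
  | m
  | mbar

/-- The tetrad vectors as complex vector fields. -/
def Tetrad.vec (T : Tetrad) : Leg → Pt → Fin 4 → ℂ
  | .l => fun x i => (T.l x i : ℂ)
  | .n => fun x i => (T.n x i : ℂ)
  | .m => T.m
  | .mbar => fun x i => (starRingEnd ℂ) (T.m x i)

/-- `T` is a smooth null tetrad of `g` on `U`, normalized by `l·n = 1`, `m·m̄ = -1`. -/
structure Tetrad.IsNullOn (T : Tetrad) (g : MetricField) (U : Set Pt) : Prop where
  smooth_l : ContDiffOn ℝ ∞ T.l U
  smooth_n : ContDiffOn ℝ ∞ T.n U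
  smooth_m : ContDiffOn ℝ ∞ T.m U
  ll : ∀ x ∈ U, gDot g x (T.vec .l x) (T.vec .l x) = 0
  nn : ∀ x ∈ U, gDot g x (T.vec .n x) (T.vec .n x) = 0
  mm : ∀ x ∈ U, gDot g x (T.vec .m x) (T.vec .m x) = 0
  ln : ∀ x ∈ U, gDot g x (T.vec .l x) (T.vec .n x) = 1
  m_mbar : ∀ x ∈ U, gDot g x (T.vec .m x) (T.vec .mbar x) = -1
  lm : ∀ x ∈ U, gDot g x (T.vec .l x) (T.vec .m x) = 0
  nm : ∀ x ∈ U, gDot g x (T.vec .n x) (T.vec .m x) = 0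

/-- The NP derivative operators `D = l^i ∂_i`, `Δ = n^i ∂_i`, `δ = m^i ∂_i`, `δ̄ = m̄^i ∂_i`. -/
def Tetrad.D (T : Tetrad) (a : Leg) (η : Pt → ℂ) (x : Pt) : ℂ := dirDeriv (T.vec a) η x

/-- The spin-boost gauge transformation
`l ↦ A² l`, `n ↦ A⁻² n`, `m ↦ exp(i α₀) m`. -/
def Tetrad.gauge (T : Tetrad) (A α₀ : Pt → ℝ) : Tetrad where
  l := fun x i => A x ^ 2 * T.l x i
  n := fun x i => (A x ^ 2)⁻¹ * T.n x i
  m := fun x i => Complex.exp (Complex.I * α₀ x) * T.m x i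

/-- The gauge factor `A exp(i α₀ / 2)`. -/
def gaugeFactor (A α₀ : Pt → ℝ) (x : Pt) : ℂ := (A x : ℂ) * Complex.exp (Complex.I * α₀ x / 2)

/-! ### NP scalars -/

/-- The twelve NP spin coefficients. -/
inductive SpinCoeff
  | kappa | sigma | rho | tau | nu | lambda | mu | pi | epsilon | gamma | beta | alpha

/-- `rot a b c = g(e_a, ∇_{e_c} e_b) = (e_b)_{μ;ν} (e_a)^μ (e_c)^ν`. -/
def rot (g : MetricField) (T : Tetrad) (a b c : Leg) (x : Pt) : ℂ :=
  gDot g x (T.vec a x) (covDeriv g (T.vec c) (T.vec b) x)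

/-- The NP spin coefficients of a null tetrad. -/
def spinCoeff (g : MetricField) (T : Tetrad) : SpinCoeff → Pt → ℂ
  | .kappa => rot g T .m .l .l
  | .sigma => rot g T .m .l .m
  | .rho => rot g T .m .l .mbar
  | .tau => rot g T .m .l .n
  | .nu => fun x => -rot g T .mbar .n .n x
  | .lambda => fun x => -rot g T .mbar .n .mbar x
  | .mu => fun x => -rot g T .mbar .n .m x
  | .pi => fun x => -rot g T .mbar .n .l x
  | .epsilon => fun x => (1 / 2) * (rot g T .n .l .l x - rot g T .mbar .m .l x)
  | .gamma => fun x => (1 / 2) * (rot g T .n .l .n x - rot g T .mbar .m .n x)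
  | .beta => fun x => (1 / 2) * (rot g T .n .l .m x - rot g T .mbar .m .m x)
  | .alpha => fun x => (1 / 2) * (rot g T .n .l .mbar x - rot g T .mbar .m .mbar x)

/-- The Weyl components `Ψ₀, …, Ψ₄`. -/
def psi (g : MetricField) (T : Tetrad) (k : Fin 5) (x : Pt) : ℂ :=
  match k with
  | 0 => -weylC g x (T.vec .l x) (T.vec .m x) (T.vec .l x) (T.vec .m x)
  | 1 => -weylC g x (T.vec .l x) (T.vec .n x) (T.vec .l x) (T.vec .m x)
  | 2 => -weylC g x (T.vec .l x) (T.vec .m x) (T.vec .mbar x) (T.vec .n x)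
  | 3 => -weylC g x (T.vec .l x) (T.vec .n x) (T.vec .mbar x) (T.vec .n x)
  | 4 => -weylC g x (T.vec .n x) (T.vec .mbar x) (T.vec .n x) (T.vec .mbar x)

/-- The trace-free Ricci components `Φ_{ij}`. -/
def phi (g : MetricField) (T : Tetrad) (i j : Fin 3) (x : Pt) : ℂ :=
  match i, j with
  | 0, 0 => (1 / 2) * ricciC g x (T.vec .l x) (T.vec .l x)
  | 0, 1 => (1 / 2) * ricciC g x (T.vec .l x) (T.vec .m x)
  | 0, 2 => (1 / 2) * ricciC g x (T.vec .m x) (T.vec .m x)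
  | 1, 0 => (1 / 2) * ricciC g x (T.vec .l x) (T.vec .mbar x)
  | 1, 1 => (1 / 4) * (ricciC g x (T.vec .l x) (T.vec .n x)
      + ricciC g x (T.vec .m x) (T.vec .mbar x))
  | 1, 2 => (1 / 2) * ricciC g x (T.vec .n x) (T.vec .m x)
  | 2, 0 => (1 / 2) * ricciC g x (T.vec .mbar x) (T.vec .mbar x)
  | 2, 1 => (1 / 2) * ricciC g x (T.vec .n x) (T.vec .mbar x)
  | 2, 2 => (1 / 2) * ricciC g x (T.vec .n x) (T.vec .n x)

/-- The curvature scalar `Λ` (equal to `R/24` when `R` is formed with the opposite sign convention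
for the Ricci tensor, as is customary in the signature `+ - - -`). -/
def bigLambda (g : MetricField) (x : Pt) : ℂ := ((-(1 / 24) * scalarCurv g x : ℝ) : ℂ)

/-- Formal combinations of the NP scalars: everything obtained from the spin coefficients and the
tetrad components of the Riemann tensor by forming functions of finitely many
combinations (sums, products, constants, complex conjugates, quotients, powers, ...) and by applying
the NP derivatives. -/
inductive NPComb
  | spin (s : SpinCoeff)
  | psi (k : Fin 5)
  | phi (i j : Fin 3)
  | bigLambda
  | fn {k : ℕ} (F : (Fin k → ℂ) → ℂ) (e : Fin k → NPComb)
  | deriv (a : Leg) (e : NPComb)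

/-- The scalar field that a formal combination denotes for a given metric and tetrad. -/
def NPComb.eval (g : MetricField) (T : Tetrad) : NPComb → Pt → ℂ
  | .spin s => spinCoeff g T s
  | .psi k => NewmanPenrose.psi g T k
  | .phi i j => NewmanPenrose.phi g T i j
  | .bigLambda => NewmanPenrose.bigLambda g
  | .fn F e => fun x => F (fun j => (e j).eval g T x)
  | .deriv a e => T.D a (e.eval g T)

/-- The combination is well defined on `U`: every function occurring in it is applied only inside
an open domain on which it is smooth (e.g. no division by zero). -/
def NPComb.DefinedOn (g : MetricField) (T : Tetrad) (U : Set Pt) : NPComb → Prop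
  | .spin _ => True
  | .psi _ => True
  | .phi _ _ => True
  | .bigLambda => True
  | .fn (k := k) F e => (∀ j, (e j).DefinedOn g T U) ∧
      ∃ O : Set (Fin k → ℂ), IsOpen O ∧ ContDiffOn ℝ ∞ F O ∧
        ∀ x ∈ U, (fun j => (e j).eval g T x) ∈ O
  | .deriv _ e => e.DefinedOn g T U

/-! ### Conformal rescaling and conformal weights -/

/-- The rescaled metric `Ω² g`. -/
def rescaleMetric (Ω : Pt → ℝ) (g : MetricField) : MetricField := fun x => (Ω x) ^ 2 • g x

/-- The rescaled tetrad `Ω⁻¹ l, Ω⁻¹ n, Ω⁻¹ m`, a null tetrad of `Ω² g`. -/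
def Tetrad.rescale (Ω : Pt → ℝ) (T : Tetrad) : Tetrad where
  l := fun x i => (Ω x)⁻¹ * T.l x i
  n := fun x i => (Ω x)⁻¹ * T.n x i
  m := fun x i => ((Ω x)⁻¹ : ℝ) * T.m x i

/-- The combination `e` is multiplied by `Ω ^ w` when `(g, T)` is replaced by
`(Ω² g, Ω⁻¹ T)`, on every open subset of `U`, for a given class of positive smooth factors `Ω`. -/
def HasWeight (admissible : (Pt → ℝ) → Set Pt → Prop)
    (U : Set Pt) (g : MetricField) (T : Tetrad) (e : NPComb) (w : ℝ) : Prop :=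
  ∀ V : Set Pt, IsOpen V → V ⊆ U → ∀ Ω : Pt → ℝ,
    ContDiffOn ℝ ∞ Ω V → (∀ x ∈ V, 0 < Ω x) → admissible Ω V →
    e.DefinedOn (rescaleMetric Ω g) (T.rescale Ω) V →
    ∀ x ∈ V, e.eval (rescaleMetric Ω g) (T.rescale Ω) x = ((Ω x ^ w : ℝ) : ℂ) * e.eval g T x

/-- `e` is properly conformally weighted with conformal weight `w`: all conformal factors. -/
def IsConformallyWeighted (U : Set Pt) (g : MetricField) (T : Tetrad) (e : NPComb) (w : ℝ) :
    Prop :=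
  HasWeight (fun _ _ => True) U g T e w

/-- `e` is weighted with weight `w` under constant conformal rescalings. -/
def IsHomotheticallyWeighted (U : Set Pt) (g : MetricField) (T : Tetrad) (e : NPComb) (w : ℝ) :
    Prop :=
  HasWeight (fun Ω V => ∃ c : ℝ, ∀ x ∈ V, Ω x = c) U g T e w

/-! ### Symmetries and commutator equations -/

/-- The Lie derivative `£_ξ η = ξ^i ∂_i η` of a scalar along a real vector field. -/
def lieScalar (ξ : Pt → Fin 4 → ℝ) (η : Pt → ℂ) (x : Pt) : ℂ :=
  dirDeriv (fun y i => (ξ y i : ℂ)) η x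

/-- The components `(£_ξ g)_{ab}`. -/
def lieMetric (ξ : Pt → Fin 4 → ℝ) (g : MetricField) (x : Pt) (a b : Fin 4) : ℝ :=
  ∑ c, (ξ x c * pd c (fun y => g y a b) x + g x c b * pd a (fun y => ξ y c) x
    + g x a c * pd b (fun y => ξ y c) x)

/-- `ξ` is a (conformal) Killing vector on `U` with conformal factor `φ`: `£_ξ g = φ g`. It is
homothetic if `φ` is constant. -/
def IsConformalKilling (U : Set Pt) (g : MetricField) (ξ : Pt → Fin 4 → ℝ) (φ : Pt → ℝ) : Prop :=
  ∀ x ∈ U, ∀ a b, lieMetric ξ g x a b = φ x * g x a b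

/-- `ξ` is a Killing vector on `U`: `£_ξ g = 0`. -/
def IsKilling (U : Set Pt) (g : MetricField) (ξ : Pt → Fin 4 → ℝ) : Prop :=
  ∀ x ∈ U, ∀ a b, lieMetric ξ g x a b = 0

/-- The `i`-th coordinate as a (complex valued) scalar field. -/
def coord (i : Fin 4) (x : Pt) : ℂ := (x i : ℂ)

/-- The NP-Lie commutator equations `[D, £_ξ] η = ½ φ D η` for `D, Δ, δ, δ̄`, on `U`. -/
def NPLieCommutator (U : Set Pt) (T : Tetrad) (ξ : Pt → Fin 4 → ℝ) (φ : Pt → ℝ) (η : Pt → ℂ) :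
    Prop :=
  ∀ x ∈ U, ∀ a : Leg,
    T.D a (lieScalar ξ η) x - lieScalar ξ (T.D a η) x = (φ x : ℂ) / 2 * T.D a η x

/-- `η` is Lie recurrent on `U` relative to `ξ`, with associated factor `φ` and weight `w`:
`£_ξ η = w (φ/2) η`. -/
def IsLieRecurrent (U : Set Pt) (ξ : Pt → Fin 4 → ℝ) (φ : Pt → ℝ) (w : ℝ) (η : Pt → ℂ) : Prop :=
  ∀ x ∈ U, lieScalar ξ η x = (w : ℂ) * ((φ x : ℂ) / 2) * η x

/-- `η` is Lie derived (annihilated by `£_ξ`) on `U`. -/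
def IsLieDerived (U : Set Pt) (ξ : Pt → Fin 4 → ℝ) (η : Pt → ℂ) : Prop :=
  ∀ x ∈ U, lieScalar ξ η x = 0

/-! ### Petrov type II -/

/-- The canonical form of a null tetrad for Petrov type II: `Ψ₄ = 1`, `Ψ₂ ≠ 0`, all other `Ψ`
zero. -/
structure IsCanonicalTypeII (U : Set Pt) (g : MetricField) (T : Tetrad) : Prop where
  psi0 : ∀ x ∈ U, psi g T 0 x = 0
  psi1 : ∀ x ∈ U, psi g T 1 x = 0
  psi2 : ∀ x ∈ U, psi g T 2 x ≠ 0
  psi3 : ∀ x ∈ U, psi g T 3 x = 0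
  psi4 : ∀ x ∈ U, psi g T 4 x = 1

/-- `A exp(i α₀ / 2)` is a smooth branch of `(Ψ₄ / Ψ₂)^{1/4}` on `U`. -/
structure IsTypeIIGauge (U : Set Pt) (g : MetricField) (T : Tetrad) (A α₀ : Pt → ℝ) : Prop where
  smooth : ContDiffOn ℝ ∞ (gaugeFactor A α₀) U
  fourth_root : ∀ x ∈ U, gaugeFactor A α₀ x ^ 4 = psi g T 4 x / psi g T 2 x

end NewmanPenrose

end

open NewmanPenrose

/-!
The operator `∂_t - ξ` at `t = 0`, applied to one-parameter families `f (t, x)` of fields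
(`flowDefect`), compares the variation of a family with its drag along the vector field `ξ`. It is
a derivation, and its commutator with `∂_i` is `(∂_i ξ^j) ∂_j` (`flowDefect_pdx`). So every object
built from the metric by differentiation and algebra obeys a transformation law under it which
follows from the law for the metric, and no flow of `ξ` has to be constructed. For a family with
`∂_t g = £_ξ g + ψ g` the laws for the connection, the curvature and finally the Weyl tensor are
computed once (`IsConformalVariation.weyl_variation`), and then used in two ways.

* For the constant family and a conformal Killing vector one has `ψ = -φ`, and the result is
  `£_ξ C = φ C`. Write `£_ξ e = -½ φ e + M e` with `M` an infinitesimal Lorentz transformation.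
  Since `Ψ₁ = Ψ₃ = 0` and `Ψ₂ ≠ 0`, the derivatives of `Ψ₁` and `Ψ₃` show that `M` contains no null
  rotation (`exists_spinBoost`); since `Ψ₄` scales like `Ψ₂` (because `Ψ₄ = Ψ₂` in the gauged
  tetrad, or because `Ψ₄ = 1` and `φ = 0`), it contains no spin-boost either (`dragVec_eq`). Thus
  `£_ξ e = -½ φ e`, which is what the commutator equations for the coordinates say
  (`npLieCommutator_coord_iff`). Conversely, this equation gives `£_ξ g = φ g` because the tetrad
  components of `g` are constant (`isConformalKilling_of_dragVec`).

* For the conformal rescalings by `Ω_t = exp (t φ / 2)` of metric and tetrad one has `ψ = 0`, and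
  the tetrad is dragged along `ξ` as well (`isDragged_rescale`). By induction, so is every
  combination of the NP scalars (`IsDragged.isInvariant_eval`): its `t`-derivative at `t = 0` is its
  derivative along `ξ`. A combination with weight `w` is multiplied by `Ω_t ^ w`, whose
  `t`-derivative is `½ w φ`; this is Lie recurrence (`isLieRecurrent_of_hasWeight`).
-/

noncomputable section

namespace NewmanPenrose

/-! ### Calculus of one-parameter families of fields -/

section Calculus

variable {F : Type*} [NormedAddCommGroup F] [NormedSpace ℝ F]
variable {𝔸 : Type*} [NormedCommRing 𝔸] [NormedAlgebra ℝ 𝔸]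

/-- The partial derivative `∂_i` of a one-parameter family `f (t, x)` of fields, at fixed `t`. -/
def pdx (i : Fin 4) (f : ℝ × Pt → F) (q : ℝ × Pt) : F := pd i (fun y => f (q.1, y)) q.2

/-- `∂_t f - ξ(f)` at `t = 0`, for a one-parameter family `f (t, x)` of fields: the amount by
which the variation of the family differs from the drag of `f (0, ·)` along `ξ`. -/
def flowDefect (ξ : Pt → Fin 4 → ℝ) (f : ℝ × Pt → F) (x : Pt) : F :=
  fderiv ℝ f (0, x) (1, -ξ x)

/-- The family `f` is smooth at all points `(0, x)` with `x ∈ U`. -/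
def SmoothSlice (U : Set Pt) (f : ℝ × Pt → F) : Prop := ∀ x ∈ U, ContDiffAt ℝ ∞ f (0, x)

variable {U : Set Pt} {ξ : Pt → Fin 4 → ℝ} {x : Pt}

lemma two_le_smooth : (2 : WithTop ℕ∞) ≤ ∞ := WithTop.coe_le_coe.2 (le_top : (2 : ℕ∞) ≤ ⊤)

lemma differentiableAt_of_contDiffOn (hU : IsOpen U) {f : Pt → F} (hf : ContDiffOn ℝ ∞ f U)
    (hx : x ∈ U) : DifferentiableAt ℝ f x :=
  (hf.contDiffAt (hU.mem_nhds hx)).differentiableAt (by simp)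

lemma SmoothSlice.differentiableAt {f : ℝ × Pt → F} (hf : SmoothSlice U f) (hx : x ∈ U) :
    DifferentiableAt ℝ f (0, x) := (hf x hx).differentiableAt (by simp)

lemma SmoothSlice.restrict {f : ℝ × Pt → F} (hf : SmoothSlice U f) :
    ContDiffOn ℝ ∞ (fun y => f (0, y)) U := fun x hx =>
  ((hf x hx).comp x (f := fun y : Pt => ((0 : ℝ), y)) (by fun_prop)).contDiffWithinAt

lemma SmoothSlice.of_static (hU : IsOpen U) {f : Pt → F} (hf : ContDiffOn ℝ ∞ f U) :
    SmoothSlice U (fun q : ℝ × Pt => f q.2) := fun x hx =>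
  (hf.contDiffAt (hU.mem_nhds hx)).comp (f := Prod.snd) ((0 : ℝ), x) (by fun_prop)

lemma SmoothSlice.eventually_differentiableAt {f : ℝ × Pt → F} (hf : SmoothSlice U f)
    (hx : x ∈ U) : ∀ᶠ q in 𝓝 ((0 : ℝ), x), DifferentiableAt ℝ f q :=
  (((hf x hx).of_le (m := 1) (by simp)).eventually (by simp)).mono
    fun _ h => h.differentiableAt (by simp)

lemma pdx_eq_fderiv {f : ℝ × Pt → F} {q : ℝ × Pt} (hf : DifferentiableAt ℝ f q) (i : Fin 4) :
    pdx i f q = fderiv ℝ f q (0, Pi.single i 1) := by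
  have h1 : HasFDerivAt (fun y : Pt => (q.1, y)) (ContinuousLinearMap.inr ℝ ℝ Pt) q.2 :=
    hasFDerivAt_prodMk_right q.1 q.2
  have h2 : HasFDerivAt (fun y : Pt => f (q.1, y)) _ q.2 :=
    HasFDerivAt.comp q.2 (g := f) (f := fun y : Pt => (q.1, y)) hf.hasFDerivAt h1
  simp [pdx, pd, h2.fderiv]

lemma SmoothSlice.pdx_eventuallyEq {f : ℝ × Pt → F} (hf : SmoothSlice U f) (hx : x ∈ U)
    (i : Fin 4) :
    pdx i f =ᶠ[𝓝 ((0 : ℝ), x)] fun q => fderiv ℝ f q (0, Pi.single i 1) :=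
  (hf.eventually_differentiableAt hx).mono fun _ h => pdx_eq_fderiv h i

lemma SmoothSlice.pdx {f : ℝ × Pt → F} (hf : SmoothSlice U f) (i : Fin 4) :
    SmoothSlice U (pdx i f) := fun x hx =>
  (((hf x hx).fderiv_right (m := ∞) (by simp)).clm_apply contDiffAt_const).congr_of_eventuallyEq
    (hf.pdx_eventuallyEq hx i)

lemma contDiffOn_pd (hU : IsOpen U) {f : Pt → F} (hf : ContDiffOn ℝ ∞ f U) (i : Fin 4) :
    ContDiffOn ℝ ∞ (pd i f) U := fun _ hx =>
  (((hf.contDiffAt (hU.mem_nhds hx)).fderiv_right (m := ∞) (by simp)).clm_apply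
    contDiffAt_const).contDiffWithinAt

lemma pd_congr (hU : IsOpen U) {f g : Pt → F} (h : ∀ y ∈ U, f y = g y) (hx : x ∈ U) (i : Fin 4) :
    pd i f x = pd i g x := by
  have : f =ᶠ[𝓝 x] g := Filter.eventuallyEq_of_mem (hU.mem_nhds hx) h
  simp [pd, this.fderiv_eq]

lemma pd_comm (hU : IsOpen U) {f : Pt → F} (hf : ContDiffOn ℝ ∞ f U) (hx : x ∈ U) (i j : Fin 4) :
    pd i (pd j f) x = pd j (pd i f) x := by
  have hs := (hf.contDiffAt (hU.mem_nhds hx)).isSymmSndFDerivAt (by simpa using two_le_smooth)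
  have hd : DifferentiableAt ℝ (fderiv ℝ f) x :=
    ((hf.contDiffAt (hU.mem_nhds hx)).fderiv_right (m := ∞) (by simp)).differentiableAt (by simp)
  have key : ∀ a b : Fin 4, pd a (pd b f) x =
      fderiv ℝ (fderiv ℝ f) x (Pi.single a 1) (Pi.single b 1) := fun a b => by
    unfold pd
    rw [fderiv_clm_apply hd (by fun_prop)]
    simp
  rw [key, key]; exact hs _ _

lemma pd_add {f g : Pt → F} (hf : DifferentiableAt ℝ f x) (hg : DifferentiableAt ℝ g x)
    (i : Fin 4) : pd i (fun y => f y + g y) x = pd i f x + pd i g x := by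
  simp [pd, fderiv_fun_add hf hg]

lemma pd_sub {f g : Pt → F} (hf : DifferentiableAt ℝ f x) (hg : DifferentiableAt ℝ g x)
    (i : Fin 4) : pd i (fun y => f y - g y) x = pd i f x - pd i g x := by
  simp [pd, fderiv_fun_sub hf hg]

lemma pd_mul {f g : Pt → 𝔸} (hf : DifferentiableAt ℝ f x) (hg : DifferentiableAt ℝ g x)
    (i : Fin 4) : pd i (fun y => f y * g y) x = pd i f x * g x + f x * pd i g x := by
  simp [pd, fderiv_fun_mul hf hg]; ring

lemma pd_sum {ι : Type*} (s : Finset ι) {f : ι → Pt → F}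
    (hf : ∀ j, DifferentiableAt ℝ (f j) x) (i : Fin 4) :
    pd i (fun y => ∑ j ∈ s, f j y) x = ∑ j ∈ s, pd i (f j) x := by
  simp [pd, fderiv_fun_sum (fun j _ => hf j)]

lemma pd_const (i : Fin 4) (c : F) : pd i (fun _ => c) x = 0 := by simp [pd]

lemma pd_ofReal {f : Pt → ℝ} (hf : DifferentiableAt ℝ f x) (i : Fin 4) :
    pd i (fun y => (f y : ℂ)) x = ((pd i f x : ℝ) : ℂ) := by
  have := HasFDerivAt.comp x (Complex.ofRealCLM.hasFDerivAt (x := f x)) hf.hasFDerivAt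
  have h2 : fderiv ℝ (fun y => (f y : ℂ)) x = Complex.ofRealCLM.comp (fderiv ℝ f x) := this.fderiv
  simp [pd, h2]

lemma flowDefect_congr {f g : ℝ × Pt → F} (h : f =ᶠ[𝓝 ((0 : ℝ), x)] g) :
    flowDefect ξ f x = flowDefect ξ g x := by
  simp [flowDefect, h.fderiv_eq]

lemma flowDefect_add {f g : ℝ × Pt → F} (hf : SmoothSlice U f) (hg : SmoothSlice U g)
    (hx : x ∈ U) :
    flowDefect ξ (fun q => f q + g q) x = flowDefect ξ f x + flowDefect ξ g x := by
  simp [flowDefect, fderiv_fun_add (hf.differentiableAt hx) (hg.differentiableAt hx)]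

lemma flowDefect_sub {f g : ℝ × Pt → F} (hf : SmoothSlice U f) (hg : SmoothSlice U g)
    (hx : x ∈ U) :
    flowDefect ξ (fun q => f q - g q) x = flowDefect ξ f x - flowDefect ξ g x := by
  simp [flowDefect, fderiv_fun_sub (hf.differentiableAt hx) (hg.differentiableAt hx)]

lemma flowDefect_neg {f : ℝ × Pt → F} :
    flowDefect ξ (fun q => - f q) x = - flowDefect ξ f x := by
  simp [flowDefect, fderiv_fun_neg]

lemma flowDefect_mul {f g : ℝ × Pt → 𝔸} (hf : SmoothSlice U f) (hg : SmoothSlice U g)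
    (hx : x ∈ U) :
    flowDefect ξ (fun q => f q * g q) x
      = flowDefect ξ f x * g (0, x) + f (0, x) * flowDefect ξ g x := by
  simp [flowDefect, fderiv_fun_mul (hf.differentiableAt hx) (hg.differentiableAt hx)]
  ring

lemma flowDefect_sum {ι : Type*} {s : Finset ι} {f : ι → ℝ × Pt → F}
    (hf : ∀ j, SmoothSlice U (f j)) (hx : x ∈ U) :
    flowDefect ξ (fun q => ∑ j ∈ s, f j q) x = ∑ j ∈ s, flowDefect ξ (f j) x := by
  simp [flowDefect, fderiv_fun_sum (fun j _ => (hf j).differentiableAt hx)]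

lemma flowDefect_const (c : F) : flowDefect ξ (fun _ => c) x = 0 := by simp [flowDefect]

lemma flowDefect_ofReal {f : ℝ × Pt → ℝ} (hf : SmoothSlice U f) (hx : x ∈ U) :
    flowDefect ξ (fun q => (f q : ℂ)) x = ((flowDefect ξ f x : ℝ) : ℂ) := by
  have := HasFDerivAt.comp (0, x) (Complex.ofRealCLM.hasFDerivAt (x := f (0, x)))
    (hf.differentiableAt hx).hasFDerivAt
  have h2 : fderiv ℝ (fun q => (f q : ℂ)) (0, x) = Complex.ofRealCLM.comp (fderiv ℝ f (0, x)) :=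
    this.fderiv
  simp [flowDefect, h2]

lemma pi_eq_sum_single (v : Fin 4 → ℝ) : v = ∑ j, v j • (Pi.single j (1 : ℝ) : Fin 4 → ℝ) := by
  ext i; simp [Pi.single_apply]

lemma fderiv_apply_eq_sum_pd (f : Pt → F) (v : Fin 4 → ℝ) :
    fderiv ℝ f x v = ∑ j, v j • pd j f x := by
  conv_lhs => rw [pi_eq_sum_single v]
  simp [pd]

lemma pd_apply {v : Pt → Fin 4 → F} (hv : DifferentiableAt ℝ v x) (i j : Fin 4) :
    fderiv ℝ v x (Pi.single i 1) j = pd i (fun y => v y j) x := by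
  rw [pd, fderiv_apply hv]; rfl

/-- For a family that does not depend on `t`, the defect is `-ξ(f)`. -/
lemma flowDefect_static {f : Pt → F} (hf : DifferentiableAt ℝ f x) :
    flowDefect ξ (fun q => f q.2) x = - ∑ j, ξ x j • pd j f x := by
  have h : HasFDerivAt (fun q : ℝ × Pt => f q.2) _ ((0 : ℝ), x) :=
    HasFDerivAt.comp (g := f) (f := Prod.snd) ((0 : ℝ), x) hf.hasFDerivAt hasFDerivAt_snd
  rw [flowDefect, h.fderiv, ← fderiv_apply_eq_sum_pd]
  simp

/-- The defect is the `t`-derivative minus the derivative along `ξ`. -/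
lemma flowDefect_eq_deriv_sub {f : ℝ × Pt → F} (hf : SmoothSlice U f) (hx : x ∈ U) :
    flowDefect ξ f x
      = deriv (fun t => f (t, x)) 0 - ∑ j, ξ x j • pd j (fun y => f (0, y)) x := by
  have hd := hf.differentiableAt hx
  have h1 : HasDerivAt (fun t : ℝ => f (t, x)) (fderiv ℝ f (0, x) (1, 0)) 0 :=
    HasFDerivAt.comp_hasDerivAt (f := fun t : ℝ => (t, x)) (0 : ℝ) hd.hasFDerivAt
      ((hasDerivAt_id (0 : ℝ)).prodMk (hasDerivAt_const (0 : ℝ) x))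
  have h2 : ∀ j, pd j (fun y => f (0, y)) x = fderiv ℝ f (0, x) (0, Pi.single j 1) := fun j =>
    pdx_eq_fderiv (q := (0, x)) hd j
  have h3 : (((1 : ℝ), -ξ x) : ℝ × Pt)
      = ((1 : ℝ), (0 : Pt)) - ∑ j, ξ x j • ((0 : ℝ), (Pi.single j 1 : Pt)) := by
    refine Prod.ext (by simp [Prod.fst_sum]) ?_
    simpa [Prod.snd_sum] using congrArg Neg.neg (pi_eq_sum_single (ξ x))
  rw [h1.deriv, flowDefect, h3, map_sub, map_sum]
  simp only [map_smul, h2]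

/-- The commutator of the operator `∂_t - ξ` with `∂_i`. -/
lemma flowDefect_pdx (hU : IsOpen U) (hξ : ContDiffOn ℝ ∞ ξ U) {f : ℝ × Pt → F}
    (hf : SmoothSlice U f) (hx : x ∈ U) (i : Fin 4) :
    flowDefect ξ (pdx i f) x = pd i (flowDefect ξ f) x
      + ∑ j, pd i (fun y => ξ y j) x • pdx j f (0, x) := by
  have hd : DifferentiableAt ℝ (fderiv ℝ f) (0, x) :=
    ((hf x hx).fderiv_right (m := ∞) (by simp)).differentiableAt (by simp)
  have hs := (hf x hx).isSymmSndFDerivAt (by simpa using two_le_smooth)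
  have hξd : DifferentiableAt ℝ ξ x := differentiableAt_of_contDiffOn hU hξ hx
  have e1 : flowDefect ξ (pdx i f) x
      = fderiv ℝ (fderiv ℝ f) (0, x) (1, -ξ x) (0, Pi.single i 1) := by
    rw [flowDefect_congr (hf.pdx_eventuallyEq hx i), flowDefect,
      fderiv_clm_apply hd (by fun_prop)]
    simp
  have hι : HasFDerivAt (fun y : Pt => ((0 : ℝ), y)) (ContinuousLinearMap.inr ℝ ℝ Pt) x :=
    hasFDerivAt_prodMk_right 0 x
  have hc : HasFDerivAt (fun y : Pt => fderiv ℝ f (0, y)) _ x :=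
    HasFDerivAt.comp x (g := fderiv ℝ f) (f := fun y : Pt => ((0 : ℝ), y)) hd.hasFDerivAt hι
  have hv : HasFDerivAt (fun y : Pt => ((1 : ℝ), -ξ y)) _ x :=
    (hasFDerivAt_const (1 : ℝ) x).prodMk hξd.hasFDerivAt.neg
  have e2 : pd i (flowDefect ξ f) x
      = fderiv ℝ (fderiv ℝ f) (0, x) (0, Pi.single i 1) (1, -ξ x)
        + fderiv ℝ f (0, x) (0, -fderiv ℝ ξ x (Pi.single i 1)) := by
    have : fderiv ℝ (flowDefect ξ f) x = _ := (hc.clm_apply hv).fderiv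
    rw [pd, this]
    simp [add_comm]
  have e3 : fderiv ℝ f (0, x) (0, -fderiv ℝ ξ x (Pi.single i 1))
      = - ∑ j, pd i (fun y => ξ y j) x • pdx j f (0, x) := by
    have : ((0 : ℝ), -fderiv ℝ ξ x (Pi.single i 1))
        = - ∑ j, pd i (fun y => ξ y j) x • ((0 : ℝ), (Pi.single j 1 : Pt)) := by
      refine Prod.ext (by simp [Prod.fst_sum]) ?_
      have := pi_eq_sum_single (fderiv ℝ ξ x (Pi.single i 1))
      simpa [Prod.snd_sum, pd_apply hξd] using this
    rw [this, map_neg, map_sum]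
    simp only [map_smul, pdx_eq_fderiv (hf.differentiableAt hx)]
  rw [e1, e2, e3, hs.eq]
  abel

end Calculus

section SmoothSliceAlgebra

variable {F : Type*} [NormedAddCommGroup F] [NormedSpace ℝ F]
variable {𝔸 : Type*} [NormedCommRing 𝔸] [NormedAlgebra ℝ 𝔸] {U : Set Pt}

lemma SmoothSlice.const (c : F) : SmoothSlice U (fun _ => c) := fun _ _ => contDiffAt_const
lemma SmoothSlice.add {f g : ℝ × Pt → F} (hf : SmoothSlice U f) (hg : SmoothSlice U g) :
    SmoothSlice U (fun q => f q + g q) := fun x hx => (hf x hx).add (hg x hx)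
lemma SmoothSlice.sub {f g : ℝ × Pt → F} (hf : SmoothSlice U f) (hg : SmoothSlice U g) :
    SmoothSlice U (fun q => f q - g q) := fun x hx => (hf x hx).sub (hg x hx)
lemma SmoothSlice.neg {f : ℝ × Pt → F} (hf : SmoothSlice U f) :
    SmoothSlice U (fun q => - f q) := fun x hx => (hf x hx).neg
lemma SmoothSlice.mul {f g : ℝ × Pt → 𝔸} (hf : SmoothSlice U f) (hg : SmoothSlice U g) :
    SmoothSlice U (fun q => f q * g q) := fun x hx => (hf x hx).mul (hg x hx)
lemma SmoothSlice.sum {ι : Type*} {s : Finset ι} {f : ι → ℝ × Pt → F}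
    (hf : ∀ j, SmoothSlice U (f j)) : SmoothSlice U (fun q => ∑ j ∈ s, f j q) :=
  fun x hx => ContDiffAt.sum fun j _ => hf j x hx
lemma SmoothSlice.ofReal {f : ℝ × Pt → ℝ} (hf : SmoothSlice U f) :
    SmoothSlice U (fun q => (f q : ℂ)) := fun x hx =>
  Complex.ofRealCLM.contDiff.contDiffAt.comp (0, x) (hf x hx)

end SmoothSliceAlgebra

/-! ### Index algebra of the variation of the connection and the curvature -/

section IndexAlgebra

/-- Lowering the index of the claimed variation of `Γ^a_{bc}` gives the variation of the
Christoffel symbols of the first kind, minus the contribution of `g_{ae}`. In the three lemmas of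
this part `J` is the Jacobian of `ξ`, a prime denotes a further derivative, `dg c a b` stands for
`∂_c g_{ab}`, `dΓ c a d b` for `∂_c Γ^a_{db}`, and `u` is the gradient of `ψ`. -/
lemma christoffel_variation_algebra {g : Fin 4 → Fin 4 → ℝ} {dg Γ J' : Fin 4 → Fin 4 → Fin 4 → ℝ}
    {J : Fin 4 → Fin 4 → ℝ} {ψ : ℝ} {dψ u : Fin 4 → ℝ}
    (hs : ∀ a b, g a b = g b a) (hJ' : ∀ e b c, J' e b c = J' e c b)
    (hΓ : ∀ a b c, ∑ e, g a e * Γ e b c = (1 / 2) * (dg b a c + dg c a b - dg a b c))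
    (hu : ∀ a, ∑ e, g a e * u e = dψ a) (a b c : Fin 4) :
    (1 / 2) * (
        (dψ b * g a c + ψ * dg b a c + ∑ e, (J' e b a * g e c + J e a * dg b e c
          + (J' e b c * g a e + J e c * dg b a e)) + ∑ e, J e b * dg e a c)
      + (dψ c * g a b + ψ * dg c a b + ∑ e, (J' e c a * g e b + J e a * dg c e b
          + (J' e c b * g a e + J e b * dg c a e)) + ∑ e, J e c * dg e a b)
      - (dψ a * g b c + ψ * dg a b c + ∑ e, (J' e a b * g e c + J e b * dg a e c
          + (J' e a c * g b e + J e c * dg a b e)) + ∑ e, J e a * dg e b c))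
      - ∑ e, (ψ * g a e + ∑ f, (J f a * g f e + J f e * g a f)) * Γ e b c
    = ∑ e, g a e * ((∑ f, (-J e f * Γ f b c + J f b * Γ e f c + J f c * Γ e b f)) + J' e b c
        + (1 / 2) * ((if e = c then 1 else 0) * dψ b + (if e = b then 1 else 0) * dψ c
          - g b c * u e)) := by
  have h1 : ∀ (v : Fin 4 → ℝ) (p : ℝ) (c : Fin 4),
      ∑ e, v e * ((if e = c then 1 else 0) * p) = v c * p := fun v p c => by
    simp
  have e1 := h1 (g a) (dψ b) c
  have e2 := h1 (g a) (dψ c) b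
  have i1 := hΓ a b c
  have i2 := fun f => hΓ f b c
  have i3 := fun f => hΓ a f c
  have i4 := fun f => hΓ a b f
  have i5 := hu a
  simp only [Fin.sum_univ_four, fun e => hJ' e b a, fun e => hJ' e c a, fun e => hJ' e c b,
    hs 0 b, hs 1 b, hs 2 b, hs 3 b] at *
  linear_combination (-1 / 2) * e1 - (1 / 2) * e2 - ψ * i1 - J 0 a * i2 0 - J 1 a * i2 1
    - J 2 a * i2 2 - J 3 a * i2 3 - J 0 b * i3 0 - J 1 b * i3 1 - J 2 b * i3 2 - J 3 b * i3 3
    - J 0 c * i4 0 - J 1 c * i4 1 - J 2 c * i4 2 - J 3 c * i4 3 + (1 / 2) * g b c * i5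

/-- The part of the variation `E` of the connection that comes from `ξ` changes the curvature by
the Lie derivative of a tensor: second and third derivatives of `ξ` cancel. -/
lemma curvature_drag_algebra {Γ J' : Fin 4 → Fin 4 → Fin 4 → ℝ}
    {dΓ J'' : Fin 4 → Fin 4 → Fin 4 → Fin 4 → ℝ} {J : Fin 4 → Fin 4 → ℝ}
    (hJ' : ∀ e b c, J' e b c = J' e c b) (hJ'' : ∀ a c d b, J'' a c d b = J'' a d c b)
    (a b c d : Fin 4)
    {E : Fin 4 → Fin 4 → Fin 4 → ℝ} {dE : Fin 4 → Fin 4 → Fin 4 → Fin 4 → ℝ}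
    {R : Fin 4 → Fin 4 → Fin 4 → Fin 4 → ℝ}
    (hE : ∀ a b c, E a b c
      = ∑ f, (-J a f * Γ f b c + J f b * Γ a f c + J f c * Γ a b f) + J' a b c)
    (hdE : ∀ c a d b, dE c a d b
      = ∑ f, (-(J' a c f * Γ f d b + J a f * dΓ c f d b) + (J' f c d * Γ a f b + J f d * dΓ c a f b)
        + (J' f c b * Γ a d f + J f b * dΓ c a d f)) + J'' a c d b)
    (hR : ∀ a b c d, R a b c d = dΓ c a d b - dΓ d a c b
      + ∑ e, (Γ a c e * Γ e d b - Γ a d e * Γ e c b)) :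
    (dE c a d b + ∑ f, J f c * dΓ f a d b) - (dE d a c b + ∑ f, J f d * dΓ f a c b)
      + ∑ e, ((E a c e * Γ e d b + Γ a c e * E e d b) - (E a d e * Γ e c b + Γ a d e * E e c b))
    = ∑ f, (-J a f * R f b c d + J f b * R a f c d + J f c * R a b f d + J f d * R a b c f) := by
  simp only [hdE, hE, hR, hJ'' a d c b, fun f => hJ' f d c, Fin.sum_univ_four]
  ring

/-- The part `S` of the variation of the connection that comes from the conformal factor changes
the curvature by terms in the covariant Hessian `P` only. -/
lemma curvature_conformal_algebra {g : Fin 4 → Fin 4 → ℝ} {dg Γ : Fin 4 → Fin 4 → Fin 4 → ℝ}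
    {dψ u : Fin 4 → ℝ} {ddψ du : Fin 4 → Fin 4 → ℝ}
    (hΓ : ∀ a b c, Γ a b c = Γ a c b) (hψ : ∀ b c, ddψ b c = ddψ c b)
    (hc : ∀ a b c, dg c a b = ∑ e, (Γ e c a * g e b + Γ e c b * g a e))
    (a b c d : Fin 4)
    {S : Fin 4 → Fin 4 → Fin 4 → ℝ} {dS : Fin 4 → Fin 4 → Fin 4 → Fin 4 → ℝ}
    {P Q : Fin 4 → Fin 4 → ℝ}
    (hS : ∀ a b c, S a b c = (1 / 2) * ((if a = c then 1 else 0) * dψ b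
      + (if a = b then 1 else 0) * dψ c - g b c * u a))
    (hdS : ∀ c a d b, dS c a d b = (1 / 2) * ((if a = b then 1 else 0) * ddψ c d
      + (if a = d then 1 else 0) * ddψ c b - (dg c d b * u a + g d b * du c a)))
    (hP : ∀ c b, P c b = ddψ c b - ∑ e, Γ e c b * dψ e)
    (hQ : ∀ c a, Q c a = du c a + ∑ e, Γ a c e * u e) :
    dS c a d b - dS d a c b
      + ∑ e, ((S a c e * Γ e d b + Γ a c e * S e d b) - (S a d e * Γ e c b + Γ a d e * S e c b))
    = (1 / 2) * ((if a = d then 1 else 0) * P c b - (if a = c then 1 else 0) * P d b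
        - g d b * Q c a + g c b * Q d a) := by
  have h1 : ∀ (v : Fin 4 → ℝ) (p : ℝ) (c : Fin 4),
      ∑ e, v e * ((if e = c then 1 else 0) * p) = v c * p := fun v p c => by
    simp
  have h2 : ∀ (v : Fin 4 → ℝ) (p : ℝ) (c : Fin 4),
      ∑ e, v e * ((if c = e then 1 else 0) * p) = v c * p := fun v p c => by
    simp
  have e1 := h1 (Γ a c) (dψ d) b
  have e2 := h1 (Γ a c) (dψ b) d
  have e3 := h1 (Γ a d) (dψ c) b
  have e4 := h1 (Γ a d) (dψ b) c
  have e5 := h2 (fun e => Γ e d b) (dψ c) a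
  have e6 := h2 (fun e => Γ e c b) (dψ d) a
  simp only [hdS, hS, hP, hQ, hψ d c, hc, Fin.sum_univ_four, hΓ _ d c] at *
  linear_combination (1 / 2) * (e1 + e2 - e3 - e4 + e5 - e6)

end IndexAlgebra

/-! ### Smooth families of metrics -/

section MetricFamilies

/-- A one-parameter family `G (t, x)` of smooth nondegenerate symmetric metrics over `U`. -/
structure IsMetricFamily (U : Set Pt) (G : ℝ × Pt → Matrix (Fin 4) (Fin 4) ℝ) : Prop where
  isOpen : IsOpen U
  smooth : ∀ a b, SmoothSlice U (fun q => G q a b)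
  symm : ∀ t, ∀ x ∈ U, ∀ a b, G (t, x) a b = G (t, x) b a
  det : ∀ t, ∀ x ∈ U, (G (t, x)).det ≠ 0

/-- The member of a family of metrics with parameter `t`. -/
abbrev member (G : ℝ × Pt → Matrix (Fin 4) (Fin 4) ℝ) (t : ℝ) : MetricField := fun y => G (t, y)

variable {U : Set Pt} {G : ℝ × Pt → Matrix (Fin 4) (Fin 4) ℝ} {x : Pt} {t : ℝ}

lemma SmoothSlice.det {M : ℝ × Pt → Matrix (Fin 4) (Fin 4) ℝ}
    (hM : ∀ a b, SmoothSlice U (fun q => M q a b)) : SmoothSlice U (fun q => (M q).det) := by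
  intro x hx
  simp only [Matrix.det_apply']
  exact ContDiffAt.sum fun σ _ => contDiffAt_const.mul
    (contDiffAt_prod fun i _ => hM (σ i) i x hx)

namespace IsMetricFamily

lemma eventually_mem (hG : IsMetricFamily U G) (hx : x ∈ U) :
    ∀ᶠ q in 𝓝 ((0 : ℝ), x), q.2 ∈ U :=
  continuousAt_snd.eventually (hG.isOpen.mem_nhds hx)

lemma smooth_gInv (hG : IsMetricFamily U G) (a b : Fin 4) :
    SmoothSlice U (fun q => gInv (member G q.1) q.2 a b) := by
  intro x hx
  have h1 : SmoothSlice U (fun q => (G q).adjugate a b) := by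
    simp only [Matrix.adjugate_apply]
    refine SmoothSlice.det fun c d => ?_
    by_cases h : c = b
    · subst h; simpa using SmoothSlice.const _
    · simpa [Matrix.updateRow_ne h] using hG.smooth c d
  have h2 := (SmoothSlice.det hG.smooth x hx).inv (hG.det 0 x hx)
  have : (fun q : ℝ × Pt => gInv (member G q.1) q.2 a b)
      = fun q => (G q).det⁻¹ * (G q).adjugate a b := by
    funext q
    simp [gInv, member, Matrix.inv_def, Ring.inverse_eq_inv']
  rw [this]
  exact h2.mul (h1 x hx)

lemma gInv_mul (hG : IsMetricFamily U G) (hx : x ∈ U) (a b : Fin 4) :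
    ∑ e, gInv (member G t) x a e * G (t, x) e b = if a = b then 1 else 0 := by
  have := congrFun (congrFun (Matrix.nonsing_inv_mul (G (t, x)) (hG.det t x hx).isUnit) a) b
  simpa [gInv, member, Matrix.mul_apply, Matrix.one_apply] using this

lemma gInv_symm (hG : IsMetricFamily U G) (hx : x ∈ U) (a b : Fin 4) :
    gInv (member G t) x a b = gInv (member G t) x b a := by
  have h : (G (t, x)).transpose = G (t, x) := by ext i j; exact (hG.symm t x hx j i)
  have := Matrix.transpose_nonsing_inv (G (t, x))
  rw [h] at this
  exact congrFun (congrFun this b) a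

lemma raise_lower (hG : IsMetricFamily U G) (hx : x ∈ U) (v : Fin 4 → ℝ) (a : Fin 4) :
    ∑ e, gInv (member G t) x a e * ∑ f, G (t, x) e f * v f = v a := by
  have : ((G (t, x))⁻¹).mulVec ((G (t, x)).mulVec v) = v := by
    rw [Matrix.mulVec_mulVec, Matrix.nonsing_inv_mul _ (hG.det t x hx).isUnit, Matrix.one_mulVec]
  exact congrFun this a

lemma lower_raise (hG : IsMetricFamily U G) (hx : x ∈ U) (v : Fin 4 → ℝ) (a : Fin 4) :
    ∑ e, G (t, x) a e * ∑ f, gInv (member G t) x e f * v f = v a := by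
  have : (G (t, x)).mulVec (((G (t, x))⁻¹).mulVec v) = v := by
    rw [Matrix.mulVec_mulVec, Matrix.mul_nonsing_inv _ (hG.det t x hx).isUnit, Matrix.one_mulVec]
  exact congrFun this a

lemma lower_injective (hG : IsMetricFamily U G) (hx : x ∈ U) {v w : Fin 4 → ℝ}
    (h : ∀ a, ∑ e, G (t, x) a e * v e = ∑ e, G (t, x) a e * w e) (a : Fin 4) : v a = w a := by
  rw [← hG.raise_lower (t := t) hx v a, ← hG.raise_lower (t := t) hx w a]
  simp only [h]

lemma pd_metric_symm (hG : IsMetricFamily U G) (hx : x ∈ U) (a b c : Fin 4) :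
    pd c (fun y => G (t, y) a b) x = pd c (fun y => G (t, y) b a) x :=
  pd_congr hG.isOpen (fun y hy => hG.symm t y hy a b) hx c

lemma christoffel_symm (hG : IsMetricFamily U G) (hx : x ∈ U) (a b c : Fin 4) :
    christoffel (member G t) a b c x = christoffel (member G t) a c b x := by
  unfold christoffel
  congr 1
  refine Finset.sum_congr rfl fun d _ => ?_
  have := hG.pd_metric_symm (t := t) hx b c d
  simp only [member, this]
  ring

lemma lower_christoffel (hG : IsMetricFamily U G) (hx : x ∈ U) (a b c : Fin 4) :
    ∑ e, G (t, x) a e * christoffel (member G t) e b c x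
      = (1 / 2) * (pd b (fun y => G (t, y) a c) x + pd c (fun y => G (t, y) a b) x
        - pd a (fun y => G (t, y) b c) x) := by
  have := hG.lower_raise (t := t) hx (fun a => (1 / 2) * (pd b (fun y => G (t, y) a c) x
    + pd c (fun y => G (t, y) a b) x - pd a (fun y => G (t, y) b c) x)) a
  rw [← this]
  refine Finset.sum_congr rfl fun e _ => ?_
  congr 1
  simp only [christoffel, Finset.mul_sum]
  exact Finset.sum_congr rfl fun f _ => by ring

/-- The Levi-Civita connection is metric. -/
lemma pd_metric (hG : IsMetricFamily U G) (hx : x ∈ U) (a b c : Fin 4) :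
    pd c (fun y => G (t, y) a b) x = ∑ e, (christoffel (member G t) e c a x * G (t, x) e b
      + christoffel (member G t) e c b x * G (t, x) a e) := by
  have h1 := hG.lower_christoffel (t := t) hx b c a
  have h2 := hG.lower_christoffel (t := t) hx a c b
  have h3 : ∑ e, christoffel (member G t) e c a x * G (t, x) e b
      = ∑ e, G (t, x) b e * christoffel (member G t) e c a x :=
    Finset.sum_congr rfl fun e _ => by rw [hG.symm t x hx e b]; ring
  have h4 : ∑ e, christoffel (member G t) e c b x * G (t, x) a e
      = ∑ e, G (t, x) a e * christoffel (member G t) e c b x :=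
    Finset.sum_congr rfl fun e _ => by ring
  have s1 := hG.pd_metric_symm (t := t) hx b a c
  have s2 := hG.pd_metric_symm (t := t) hx c a b
  have s3 := hG.pd_metric_symm (t := t) hx c b a
  rw [Finset.sum_add_distrib, h3, h4, h1, h2]
  linarith

lemma smooth_christoffel (hG : IsMetricFamily U G) (a b c : Fin 4) :
    SmoothSlice U (fun q => christoffel (member G q.1) a b c q.2) :=
  (SmoothSlice.const (1 / 2)).mul <| SmoothSlice.sum fun d => (hG.smooth_gInv a d).mul
    ((((hG.smooth d c).pdx b).add ((hG.smooth d b).pdx c)).sub ((hG.smooth b c).pdx d))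

lemma smooth_riemannUp (hG : IsMetricFamily U G) (a b c d : Fin 4) :
    SmoothSlice U (fun q => riemannUp (member G q.1) a b c d q.2) :=
  (((hG.smooth_christoffel a d b).pdx c).sub ((hG.smooth_christoffel a c b).pdx d)).add
    (SmoothSlice.sum fun e => ((hG.smooth_christoffel a c e).mul (hG.smooth_christoffel e d b)).sub
      ((hG.smooth_christoffel a d e).mul (hG.smooth_christoffel e c b)))

lemma smooth_riemann (hG : IsMetricFamily U G) (a b c d : Fin 4) :
    SmoothSlice U (fun q => riemann (member G q.1) a b c d q.2) :=
  SmoothSlice.sum fun e => (hG.smooth a e).mul (hG.smooth_riemannUp e b c d)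

lemma smooth_ricci (hG : IsMetricFamily U G) (b d : Fin 4) :
    SmoothSlice U (fun q => ricci (member G q.1) b d q.2) :=
  SmoothSlice.sum fun a => hG.smooth_riemannUp a b a d

lemma smooth_scalarCurv (hG : IsMetricFamily U G) :
    SmoothSlice U (fun q => scalarCurv (member G q.1) q.2) :=
  SmoothSlice.sum fun a => SmoothSlice.sum fun b => (hG.smooth_gInv a b).mul (hG.smooth_ricci a b)

lemma smooth_weyl (hG : IsMetricFamily U G) (a b c d : Fin 4) :
    SmoothSlice U (fun q => weyl (member G q.1) a b c d q.2) := by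
  have g := hG.smooth
  have r := hG.smooth_ricci
  exact ((hG.smooth_riemann a b c d).sub ((SmoothSlice.const (1 / 2)).mul
    (((((g a c).mul (r b d)).sub ((g a d).mul (r b c))).sub ((g b c).mul (r a d))).add
      ((g b d).mul (r a c))))).add (((SmoothSlice.const (1 / 6)).mul hG.smooth_scalarCurv).mul
        (((g a c).mul (g b d)).sub ((g a d).mul (g b c))))

end IsMetricFamily

end MetricFamilies

/-! ### Symmetries of the curvature -/

section CurvatureSymmetries

variable {U : Set Pt} {G : ℝ × Pt → Matrix (Fin 4) (Fin 4) ℝ} {x : Pt}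

lemma riemannUp_antisymm (g : MetricField) (a b c d : Fin 4) (x : Pt) :
    riemannUp g a b c d x = - riemannUp g a b d c x := by
  simp only [riemannUp, Fin.sum_univ_four]; ring

lemma riemann_antisymm_right (g : MetricField) (a b c d : Fin 4) (x : Pt) :
    riemann g a b c d x = - riemann g a b d c x := by
  simp only [riemann, riemannUp_antisymm g _ b c d x, Fin.sum_univ_four]; ring

lemma weyl_antisymm_right (g : MetricField) (a b c d : Fin 4) (x : Pt) :
    weyl g a b c d x = - weyl g a b d c x := by
  rw [weyl, weyl, riemann_antisymm_right]; ring

namespace IsMetricFamily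

lemma riemann_bianchi (hG : IsMetricFamily U G) (hx : x ∈ U) (a b c d : Fin 4) :
    riemann (member G 0) a b c d x + riemann (member G 0) a c d b x
      + riemann (member G 0) a d b c x = 0 := by
  have hs : ∀ e b c, christoffel (member G 0) e b c x = christoffel (member G 0) e c b x :=
    fun e b c => hG.christoffel_symm hx e b c
  have hp : ∀ i e b c, pd i (christoffel (member G 0) e b c) x
      = pd i (christoffel (member G 0) e c b) x := fun i e b c =>
    pd_congr hG.isOpen (fun y hy => hG.christoffel_symm hy e b c) hx i
  have key : ∀ e, riemannUp (member G 0) e b c d x + riemannUp (member G 0) e c d b x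
      + riemannUp (member G 0) e d b c x = 0 := fun e => by
    simp only [riemannUp, Fin.sum_univ_four, hs _ d b, hs _ c b, hs _ d c, hp _ _ d b, hp _ _ c b,
      hp _ _ d c]
    ring
  simp only [riemann, ← Finset.sum_add_distrib, ← mul_add, key]
  simp

/-- Antisymmetry in the first pair, from the symmetry of the second derivatives of the metric. -/
lemma riemann_antisymm_left (hG : IsMetricFamily U G) (hx : x ∈ U) (a b c d : Fin 4) :
    riemann (member G 0) a b c d x = - riemann (member G 0) b a c d x := by
  have hg : ∀ a b, DifferentiableAt ℝ (fun y => G (0, y) a b) x := fun a b =>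
    differentiableAt_of_contDiffOn hG.isOpen (hG.smooth a b).restrict hx
  have hΓ : ∀ a b c, DifferentiableAt ℝ (christoffel (member G 0) a b c) x := fun a b c =>
    differentiableAt_of_contDiffOn hG.isOpen (hG.smooth_christoffel a b c).restrict hx
  have hc := fun a b c => hG.pd_metric (t := 0) hx a b c
  have h2 : ∀ c d, pd c (pd d (fun y => G (0, y) a b)) x
      = ∑ e, (pd c (christoffel (member G 0) e d a) x * G (0, x) e b
        + christoffel (member G 0) e d a x * pd c (fun y => G (0, y) e b) x
        + (pd c (christoffel (member G 0) e d b) x * G (0, x) a e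
        + christoffel (member G 0) e d b x * pd c (fun y => G (0, y) a e) x)) := fun c d => by
    rw [pd_congr hG.isOpen (fun y hy => hG.pd_metric (t := 0) hy a b d) hx c,
      pd_sum _ (fun e => ((hΓ e d a).fun_mul (hg e b)).fun_add ((hΓ e d b).fun_mul (hg a e)))]
    refine Finset.sum_congr rfl fun e _ => ?_
    rw [pd_add ((hΓ e d a).fun_mul (hg e b)) ((hΓ e d b).fun_mul (hg a e)), pd_mul (hΓ e d a) (hg e b),
      pd_mul (hΓ e d b) (hg a e)]
  have h3 := pd_comm hG.isOpen (hG.smooth a b).restrict hx c d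
  rw [h2, h2] at h3
  simp only [hc] at h3
  have hs := fun e => hG.symm 0 x hx e b
  simp only [riemann, riemannUp, Fin.sum_univ_four, hs 0, hs 1, hs 2, hs 3] at h3 ⊢
  linear_combination h3

lemma riemann_pair (hG : IsMetricFamily U G) (hx : x ∈ U) (a b c d : Fin 4) :
    riemann (member G 0) a b c d x = riemann (member G 0) c d a b x := by
  have l := fun a b c d => hG.riemann_antisymm_left hx a b c d
  have r := fun a b c d => riemann_antisymm_right (member G 0) a b c d x
  have z := fun a b c d => hG.riemann_bianchi hx a b c d
  linarith [z a b c d, z b c d a, z c d a b, z d a b c, l a b c d, l b c d a, l c d a b, l d a b c,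
    r a b c d, r b c d a, r c d a b, r d a b c, l a c d b, l b d a c, l c a b d, l d b c a,
    r a c d b, r b d a c, r c a b d, r d b c a, l a d b c, r a d b c, l b a c d, r b a c d,
    l c b d a, r c b d a, l d c a b, r d c a b]

lemma gInv_riemann (hG : IsMetricFamily U G) (hx : x ∈ U) (a b c d : Fin 4) :
    riemannUp (member G 0) a b c d x
      = ∑ e, gInv (member G 0) x a e * riemann (member G 0) e b c d x :=
  (hG.raise_lower (t := 0) hx (fun e => riemannUp (member G 0) e b c d x) a).symm

lemma ricci_symm (hG : IsMetricFamily U G) (hx : x ∈ U) (b d : Fin 4) :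
    ricci (member G 0) b d x = ricci (member G 0) d b x := by
  simp only [ricci, hG.gInv_riemann hx]
  rw [Finset.sum_comm]
  refine Finset.sum_congr rfl fun a _ => Finset.sum_congr rfl fun e _ => ?_
  rw [hG.riemann_pair hx a b e d, hG.gInv_symm hx]

lemma weyl_antisymm_left (hG : IsMetricFamily U G) (hx : x ∈ U) (a b c d : Fin 4) :
    weyl (member G 0) a b c d x = - weyl (member G 0) b a c d x := by
  rw [weyl, weyl, hG.riemann_antisymm_left hx]; ring

lemma weyl_bianchi (hG : IsMetricFamily U G) (hx : x ∈ U) (a b c d : Fin 4) :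
    weyl (member G 0) a b c d x + weyl (member G 0) a c d b x
      + weyl (member G 0) a d b c x = 0 := by
  have s := fun a b => hG.symm 0 x hx a b
  have r := fun a b => hG.ricci_symm hx a b
  have z := hG.riemann_bianchi hx a b c d
  simp only [weyl, member, r d b, r c b, r d c, s d b, s c b, s d c] at z ⊢
  linear_combination z

/-- The Weyl tensor is trace free. -/
lemma weyl_trace (hG : IsMetricFamily U G) (hx : x ∈ U) (b d : Fin 4) :
    ∑ a, ∑ c, gInv (member G 0) x a c * weyl (member G 0) a b c d x = 0 := by
  have h1 : ∑ a, ∑ c, gInv (member G 0) x a c * riemann (member G 0) a b c d x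
      = ricci (member G 0) b d x := by
    simp only [ricci, hG.gInv_riemann hx]
    rw [Finset.sum_comm]
    exact Finset.sum_congr rfl fun a _ => Finset.sum_congr rfl fun e _ => by
      rw [hG.gInv_symm hx]
  have h2 : ∑ a, ∑ c, gInv (member G 0) x a c * G (0, x) a c = 4 := by
    have : ∀ a, ∑ c, gInv (member G 0) x a c * G (0, x) a c = 1 := fun a => by
      have := hG.gInv_mul (t := 0) hx a a
      simp only [if_true] at this
      rw [← this]
      exact Finset.sum_congr rfl fun c _ => by rw [hG.symm 0 x hx a c]
    simp [this]
  have h3 : ∀ (v : Fin 4 → ℝ) (d : Fin 4),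
      ∑ a, ∑ c, gInv (member G 0) x a c * (G (0, x) a d * v c) = v d := fun v d => by
    have h := fun c => hG.gInv_mul (t := 0) hx c d
    rw [Finset.sum_comm]
    calc ∑ c, ∑ a, gInv (member G 0) x a c * (G (0, x) a d * v c)
        = ∑ c, (∑ a, gInv (member G 0) x c a * G (0, x) a d) * v c := by
          refine Finset.sum_congr rfl fun c _ => ?_
          rw [Finset.sum_mul]
          exact Finset.sum_congr rfl fun a _ => by rw [hG.gInv_symm hx a c]; ring
      _ = v d := by simp [h]
  have h4 : ∀ (v : Fin 4 → ℝ) (d : Fin 4),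
      ∑ a, ∑ c, gInv (member G 0) x a c * (G (0, x) c d * v a) = v d := fun v d => by
    rw [← h3 v d, Finset.sum_comm]
    exact Finset.sum_congr rfl fun a _ => Finset.sum_congr rfl fun c _ => by
      rw [hG.gInv_symm hx]
  have h5 : ∑ a, ∑ c, gInv (member G 0) x a c * ricci (member G 0) a c x
      = scalarCurv (member G 0) x := rfl
  have e1 := h3 (fun c => ricci (member G 0) b c x) d
  have e2 := h4 (fun a => ricci (member G 0) a d x) b
  have e3 := h3 (fun c => G (0, x) c b) d
  have s := fun c => hG.symm 0 x hx b c
  have : ∀ a c, gInv (member G 0) x a c * weyl (member G 0) a b c d x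
      = gInv (member G 0) x a c * riemann (member G 0) a b c d x
        - (1 / 2) * (ricci (member G 0) b d x * (gInv (member G 0) x a c * G (0, x) a c)
          - gInv (member G 0) x a c * (G (0, x) a d * ricci (member G 0) b c x)
          - gInv (member G 0) x a c * (G (0, x) c b * ricci (member G 0) a d x)
          + G (0, x) b d * (gInv (member G 0) x a c * ricci (member G 0) a c x))
        + (1 / 6) * scalarCurv (member G 0) x * (G (0, x) b d
            * (gInv (member G 0) x a c * G (0, x) a c)
          - gInv (member G 0) x a c * (G (0, x) a d * G (0, x) c b)) := fun a c => by
    rw [weyl]; simp only [member]; rw [s c]; ring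
  simp only [this, Finset.sum_add_distrib, Finset.sum_sub_distrib, ← Finset.mul_sum, h1, h2, h5,
    e1, e2, e3, s d]
  ring

end IsMetricFamily

end CurvatureSymmetries

/-! ### Variation of the connection and the curvature -/

section Variation

/-- The Jacobian `∂_a ξ^e` of a vector field. -/
def jac (ξ : Pt → Fin 4 → ℝ) (e a : Fin 4) (x : Pt) : ℝ := pd a (fun y => ξ y e) x

/-- The gradient `g^{ae} ∂_e ψ`. -/
def gradUp (g : MetricField) (ψ : Pt → ℝ) (a : Fin 4) (x : Pt) : ℝ :=
  ∑ e, gInv g x a e * pd e ψ x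

/-- The covariant Hessian `∇_c ∂_b ψ`. -/
def hess (g : MetricField) (ψ : Pt → ℝ) (c b : Fin 4) (x : Pt) : ℝ :=
  pd c (pd b ψ) x - ∑ e, christoffel g e c b x * pd e ψ x

/-- The covariant derivative `∇_c (g^{ae} ∂_e ψ)` of the gradient. -/
def hessUp (g : MetricField) (ψ : Pt → ℝ) (c a : Fin 4) (x : Pt) : ℝ :=
  pd c (gradUp g ψ a) x + ∑ e, christoffel g a c e x * gradUp g ψ e x

lemma hess_zero (g : MetricField) (c b : Fin 4) (x : Pt) : hess g (fun _ => 0) c b x = 0 := by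
  have : pd b (fun _ : Pt => (0 : ℝ)) = fun _ => 0 := by funext y; exact pd_const _ _
  simp [hess, this, pd_const]

lemma hessUp_zero (g : MetricField) (c a : Fin 4) (x : Pt) :
    hessUp g (fun _ => 0) c a x = 0 := by
  have : ∀ b, gradUp g (fun _ => 0) b = fun _ => 0 := fun b => by
    funext y; simp [gradUp, pd_const]
  simp [hessUp, this, pd_const]

/-- A family of metrics with `∂_t g - £_ξ g = ψ g` (covariant components) at `t = 0`; the
Lie derivative is written out, so that the left-hand side of `variation` is `(∂_t - ξ) g_{ab}`. -/
structure IsConformalVariation (U : Set Pt) (G : ℝ × Pt → Matrix (Fin 4) (Fin 4) ℝ)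
    (ξ : Pt → Fin 4 → ℝ) (ψ : Pt → ℝ) : Prop extends IsMetricFamily U G where
  smooth_field : ContDiffOn ℝ ∞ ξ U
  smooth_factor : ContDiffOn ℝ ∞ ψ U
  variation : ∀ x ∈ U, ∀ a b, flowDefect ξ (fun q => G q a b) x
    = ψ x * G (0, x) a b + ∑ e, (jac ξ e a x * G (0, x) e b + jac ξ e b x * G (0, x) a e)

variable {U : Set Pt} {G : ℝ × Pt → Matrix (Fin 4) (Fin 4) ℝ} {ξ : Pt → Fin 4 → ℝ} {ψ : Pt → ℝ}
  {x : Pt}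

namespace IsConformalVariation

lemma smooth_jac (h : IsConformalVariation U G ξ ψ) (e a : Fin 4) :
    ContDiffOn ℝ ∞ (jac ξ e a) U :=
  contDiffOn_pd h.isOpen (contDiffOn_pi.1 h.smooth_field e) a

lemma diff_jac (h : IsConformalVariation U G ξ ψ) (hx : x ∈ U) (e a : Fin 4) :
    DifferentiableAt ℝ (jac ξ e a) x := differentiableAt_of_contDiffOn h.isOpen (h.smooth_jac e a) hx

lemma diff_metric (h : IsConformalVariation U G ξ ψ) (hx : x ∈ U) (a b : Fin 4) :
    DifferentiableAt ℝ (fun y => G (0, y) a b) x :=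
  differentiableAt_of_contDiffOn h.isOpen (h.smooth a b).restrict hx

lemma diff_factor (h : IsConformalVariation U G ξ ψ) (hx : x ∈ U) : DifferentiableAt ℝ ψ x :=
  differentiableAt_of_contDiffOn h.isOpen h.smooth_factor hx

lemma diff_pd_factor (h : IsConformalVariation U G ξ ψ) (hx : x ∈ U) (a : Fin 4) :
    DifferentiableAt ℝ (pd a ψ) x :=
  differentiableAt_of_contDiffOn h.isOpen (contDiffOn_pd h.isOpen h.smooth_factor a) hx

lemma diff_christoffel (h : IsConformalVariation U G ξ ψ) (hx : x ∈ U) (a b c : Fin 4) :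
    DifferentiableAt ℝ (christoffel (member G 0) a b c) x :=
  differentiableAt_of_contDiffOn h.isOpen (h.smooth_christoffel a b c).restrict hx

lemma diff_gradUp (h : IsConformalVariation U G ξ ψ) (hx : x ∈ U) (a : Fin 4) :
    DifferentiableAt ℝ (gradUp (member G 0) ψ a) x := by
  refine DifferentiableAt.fun_sum fun e _ => DifferentiableAt.fun_mul ?_ (h.diff_pd_factor hx e)
  exact differentiableAt_of_contDiffOn h.isOpen (h.smooth_gInv a e).restrict hx

lemma lower_gradUp (h : IsConformalVariation U G ξ ψ) (hx : x ∈ U) (a : Fin 4) :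
    ∑ e, G (0, x) a e * gradUp (member G 0) ψ e x = pd a ψ x :=
  h.lower_raise hx (fun e => pd e ψ x) a

lemma jac_comm (h : IsConformalVariation U G ξ ψ) (hx : x ∈ U) (e b c : Fin 4) :
    pd b (jac ξ e c) x = pd c (jac ξ e b) x :=
  pd_comm h.isOpen (contDiffOn_pi.1 h.smooth_field e) hx b c

/-- The transformation law of `∂_i g_{ab}`, from that of the metric and the commutator of
`∂_t - ξ` with `∂_i`. -/
lemma pd_variation (h : IsConformalVariation U G ξ ψ) (hx : x ∈ U) (a b i : Fin 4) :
    flowDefect ξ (pdx i fun q => G q a b) x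
      = pd i ψ x * G (0, x) a b + ψ x * pd i (fun y => G (0, y) a b) x
        + ∑ e, (pd i (jac ξ e a) x * G (0, x) e b + jac ξ e a x * pd i (fun y => G (0, y) e b) x
          + (pd i (jac ξ e b) x * G (0, x) a e + jac ξ e b x * pd i (fun y => G (0, y) a e) x))
        + ∑ e, jac ξ e i x * pd e (fun y => G (0, y) a b) x := by
  have dJ := fun e a => h.diff_jac hx e a
  have dg := fun a b => h.diff_metric hx a b
  have dψ := h.diff_factor hx
  have ds := fun e => ((dJ e a).fun_mul (dg e b)).fun_add ((dJ e b).fun_mul (dg a e))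
  rw [flowDefect_pdx h.isOpen h.smooth_field (h.smooth a b) hx,
    pd_congr h.isOpen (fun y hy => h.variation y hy a b) hx,
    pd_add (dψ.fun_mul (dg a b)) (DifferentiableAt.fun_sum fun e _ => ds e),
    pd_mul dψ (dg a b), pd_sum _ ds]
  congr 2
  refine Finset.sum_congr rfl fun e _ => ?_
  rw [pd_add ((dJ e a).fun_mul (dg e b)) ((dJ e b).fun_mul (dg a e)), pd_mul (dJ e a) (dg e b),
    pd_mul (dJ e b) (dg a e)]

/-- The variation of the Christoffel symbols. The three terms with `ψ` are the usual change of the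
connection under an infinitesimal conformal rescaling, the others are the Lie derivative of a
connection. -/
lemma christoffel_variation (h : IsConformalVariation U G ξ ψ) (hx : x ∈ U) (a b c : Fin 4) :
    flowDefect ξ (fun q => christoffel (member G q.1) a b c q.2) x
      = (∑ f, (-jac ξ a f x * christoffel (member G 0) f b c x
          + jac ξ f b x * christoffel (member G 0) a f c x
          + jac ξ f c x * christoffel (member G 0) a b f x)) + pd b (jac ξ a c) x
        + (1 / 2) * ((if a = c then 1 else 0) * pd b ψ x + (if a = b then 1 else 0) * pd c ψ x
          - G (0, x) b c * gradUp (member G 0) ψ a x) := by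
  refine h.lower_injective (t := 0) hx
    (v := fun a => flowDefect ξ (fun q => christoffel (member G q.1) a b c q.2) x)
    (w := fun a => (∑ f, (-jac ξ a f x * christoffel (member G 0) f b c x
          + jac ξ f b x * christoffel (member G 0) a f c x
          + jac ξ f c x * christoffel (member G 0) a b f x)) + pd b (jac ξ a c) x
        + (1 / 2) * ((if a = c then 1 else 0) * pd b ψ x + (if a = b then 1 else 0) * pd c ψ x
          - G (0, x) b c * gradUp (member G 0) ψ a x)) (fun a => ?_) a
  rw [← christoffel_variation_algebra (g := fun a b => G (0, x) a b)
    (dg := fun c a b => pd c (fun y => G (0, y) a b) x)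
    (Γ := fun a b c => christoffel (member G 0) a b c x)
    (J' := fun e b c => pd b (jac ξ e c) x) (J := fun e a => jac ξ e a x) (ψ := ψ x)
    (dψ := fun a => pd a ψ x) (u := fun a => gradUp (member G 0) ψ a x)
    (fun a b => h.symm 0 x hx a b) (fun e b c => h.jac_comm hx e b c)
    (fun a b c => h.lower_christoffel hx a b c) (fun a => h.lower_gradUp hx a) a b c]
  have e1 : flowDefect ξ (fun q => ∑ e, G q a e * christoffel (member G q.1) e b c q.2) x
      = flowDefect ξ (fun q => (1 / 2) * (pdx b (fun q => G q a c) q + pdx c (fun q => G q a b) q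
        - pdx a (fun q => G q b c) q)) x :=
    flowDefect_congr ((h.eventually_mem hx).mono fun q hq =>
      h.lower_christoffel (t := q.1) (x := q.2) hq a b c)
  rw [flowDefect_sum (fun e => (h.smooth a e).mul (h.smooth_christoffel e b c)) hx] at e1
  simp only [flowDefect_mul (h.smooth a _) (h.smooth_christoffel _ b c) hx,
    Finset.sum_add_distrib] at e1
  rw [eq_sub_of_add_eq' e1,
    flowDefect_mul (SmoothSlice.const _)
      ((((h.smooth a c).pdx b).add ((h.smooth a b).pdx c)).sub ((h.smooth b c).pdx a)) hx,
    flowDefect_sub (((h.smooth a c).pdx b).add ((h.smooth a b).pdx c)) ((h.smooth b c).pdx a) hx,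
    flowDefect_add ((h.smooth a c).pdx b) ((h.smooth a b).pdx c) hx,
    h.pd_variation hx, h.pd_variation hx, h.pd_variation hx, flowDefect_const]
  simp only [h.variation x hx, zero_mul, zero_add]

lemma pd_christoffel_variation (h : IsConformalVariation U G ξ ψ) (hx : x ∈ U) (c a d b : Fin 4) :
    flowDefect ξ (pdx c fun q => christoffel (member G q.1) a d b q.2) x
      = (∑ f, (-(pd c (jac ξ a f) x * christoffel (member G 0) f d b x
            + jac ξ a f x * pd c (christoffel (member G 0) f d b) x)
          + (pd c (jac ξ f d) x * christoffel (member G 0) a f b x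
            + jac ξ f d x * pd c (christoffel (member G 0) a f b) x)
          + (pd c (jac ξ f b) x * christoffel (member G 0) a d f x
            + jac ξ f b x * pd c (christoffel (member G 0) a d f) x))
          + pd c (pd d (jac ξ a b)) x)
        + (1 / 2) * ((if a = b then 1 else 0) * pd c (pd d ψ) x
          + (if a = d then 1 else 0) * pd c (pd b ψ) x
          - (pd c (fun y => G (0, y) d b) x * gradUp (member G 0) ψ a x
            + G (0, x) d b * pd c (gradUp (member G 0) ψ a) x))
        + ∑ f, jac ξ f c x * pd f (christoffel (member G 0) a d b) x := by
  have dJ := fun e a => h.diff_jac hx e a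
  have dΓ := fun a b c => h.diff_christoffel hx a b c
  have dg := fun a b => h.diff_metric hx a b
  have du := fun a => h.diff_gradUp hx a
  have dp := fun a => h.diff_pd_factor hx a
  have dJ' : DifferentiableAt ℝ (pd d (jac ξ a b)) x :=
    differentiableAt_of_contDiffOn h.isOpen (contDiffOn_pd h.isOpen (h.smooth_jac a b) d) hx
  have dδ : ∀ p : Prop, ∀ _ : Decidable p,
      DifferentiableAt ℝ (fun _ : Pt => if p then (1 : ℝ) else 0) x := fun p _ =>
    differentiableAt_const _
  have dn := fun f => (dJ a f).fun_neg
  have ds := fun f => (((dn f).fun_mul (dΓ f d b)).fun_add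
    ((dJ f d).fun_mul (dΓ a f b))).fun_add ((dJ f b).fun_mul (dΓ a d f))
  have dA := (DifferentiableAt.fun_sum (u := Finset.univ) fun f _ => ds f).fun_add dJ'
  have dB1 := ((dδ (a = b) inferInstance).fun_mul (dp d)).fun_add
    ((dδ (a = d) inferInstance).fun_mul (dp b))
  have dB2 := (dg d b).fun_mul (du a)
  have dB := dB1.fun_sub dB2
  have hneg : ∀ f, pd c (fun y => -jac ξ a f y) x = -pd c (jac ξ a f) x := fun f => by
    simp [pd, fderiv_fun_neg]
  rw [flowDefect_pdx h.isOpen h.smooth_field (h.smooth_christoffel a d b) hx,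
    pd_congr h.isOpen (fun y hy => h.christoffel_variation hy a d b) hx,
    pd_add dA ((differentiableAt_const _).fun_mul dB),
    pd_add (DifferentiableAt.fun_sum fun f _ => ds f) dJ',
    pd_sum _ ds, pd_mul (differentiableAt_const _) dB, pd_sub dB1 dB2,
    pd_add ((dδ (a = b) inferInstance).fun_mul (dp d)) ((dδ (a = d) inferInstance).fun_mul (dp b)),
    pd_mul (dδ (a = b) inferInstance) (dp d), pd_mul (dδ (a = d) inferInstance) (dp b),
    pd_mul (dg d b) (du a), pd_const, pd_const, pd_const]
  simp only [zero_mul, zero_add]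
  congr 3
  refine Finset.sum_congr rfl fun f _ => ?_
  rw [pd_add (((dn f).fun_mul (dΓ f d b)).fun_add ((dJ f d).fun_mul (dΓ a f b)))
      ((dJ f b).fun_mul (dΓ a d f)),
    pd_add ((dn f).fun_mul (dΓ f d b)) ((dJ f d).fun_mul (dΓ a f b)),
    pd_mul (dn f) (dΓ f d b), pd_mul (dJ f d) (dΓ a f b), pd_mul (dJ f b) (dΓ a d f), hneg]
  ring

lemma lower_hessUp (h : IsConformalVariation U G ξ ψ) (hx : x ∈ U) (c a : Fin 4) :
    ∑ e, G (0, x) a e * hessUp (member G 0) ψ c e x = hess (member G 0) ψ c a x := by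
  have dg := fun a b => h.diff_metric hx a b
  have du := fun a => h.diff_gradUp hx a
  have e1 := pd_congr h.isOpen (fun y hy => h.lower_gradUp hy a) hx c
  rw [pd_sum _ (fun e => (dg a e).fun_mul (du e))] at e1
  simp only [pd_mul (dg a _) (du _), h.pd_metric (t := 0) hx] at e1
  have e2 := fun e => h.lower_gradUp hx e
  simp only [hess, hessUp, Fin.sum_univ_four, ← e1, ← e2] at *
  ring

/-- The variation of the curvature tensor. -/
lemma riemannUp_variation (h : IsConformalVariation U G ξ ψ) (hx : x ∈ U) (a b c d : Fin 4) :
    flowDefect ξ (fun q => riemannUp (member G q.1) a b c d q.2) x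
      = ∑ f, (-jac ξ a f x * riemannUp (member G 0) f b c d x
          + jac ξ f b x * riemannUp (member G 0) a f c d x
          + jac ξ f c x * riemannUp (member G 0) a b f d x
          + jac ξ f d x * riemannUp (member G 0) a b c f x)
        + (1 / 2) * ((if a = d then 1 else 0) * hess (member G 0) ψ c b x
          - (if a = c then 1 else 0) * hess (member G 0) ψ d b x
          - G (0, x) d b * hessUp (member G 0) ψ c a x
          + G (0, x) c b * hessUp (member G 0) ψ d a x) := by
  have sΓ := h.smooth_christoffel
  have alg1 := curvature_drag_algebra (Γ := fun a b c => christoffel (member G 0) a b c x)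
    (J' := fun e b c => pd b (jac ξ e c) x)
    (dΓ := fun c a d b => pd c (christoffel (member G 0) a d b) x)
    (J'' := fun a c d b => pd c (pd d (jac ξ a b)) x) (J := fun e a => jac ξ e a x)
    (fun e b c => h.jac_comm hx e b c)
    (fun a c d b => pd_comm h.isOpen (h.smooth_jac a b) hx c d) a b c d
    (fun _ _ _ => rfl) (fun _ _ _ _ => rfl)
    (R := fun a b c d => riemannUp (member G 0) a b c d x) (fun _ _ _ _ => rfl)
  have alg2 := curvature_conformal_algebra (g := fun a b => G (0, x) a b)
    (dg := fun c a b => pd c (fun y => G (0, y) a b) x)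
    (Γ := fun a b c => christoffel (member G 0) a b c x)
    (dψ := fun a => pd a ψ x) (u := fun a => gradUp (member G 0) ψ a x)
    (ddψ := fun c a => pd c (pd a ψ) x) (du := fun c a => pd c (gradUp (member G 0) ψ a) x)
    (fun a b c => h.christoffel_symm hx a b c)
    (fun b c => pd_comm h.isOpen h.smooth_factor hx b c)
    (fun a b c => h.pd_metric hx a b c) a b c d
    (fun _ _ _ => rfl) (fun _ _ _ _ => rfl)
    (P := fun c b => hess (member G 0) ψ c b x) (Q := fun c a => hessUp (member G 0) ψ c a x)
    (fun _ _ => rfl) (fun _ _ => rfl)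
  rw [← alg1, ← alg2]
  have e1 : flowDefect ξ (fun q => riemannUp (member G q.1) a b c d q.2) x
      = flowDefect ξ (pdx c fun q => christoffel (member G q.1) a d b q.2) x
        - flowDefect ξ (pdx d fun q => christoffel (member G q.1) a c b q.2) x
        + ∑ e, ((flowDefect ξ (fun q => christoffel (member G q.1) a c e q.2) x
              * christoffel (member G 0) e d b x + christoffel (member G 0) a c e x
              * flowDefect ξ (fun q => christoffel (member G q.1) e d b q.2) x)
            - (flowDefect ξ (fun q => christoffel (member G q.1) a d e q.2) x
              * christoffel (member G 0) e c b x + christoffel (member G 0) a d e x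
              * flowDefect ξ (fun q => christoffel (member G q.1) e c b q.2) x)) := by
    have m := fun e => ((sΓ a c e).mul (sΓ e d b)).sub ((sΓ a d e).mul (sΓ e c b))
    have := flowDefect_add (ξ := ξ) (((sΓ a d b).pdx c).sub ((sΓ a c b).pdx d))
      (SmoothSlice.sum (s := Finset.univ) m) hx
    rw [flowDefect_sub ((sΓ a d b).pdx c) ((sΓ a c b).pdx d) hx, flowDefect_sum m hx] at this
    refine this.trans ?_
    congr 1
    refine Finset.sum_congr rfl fun e _ => ?_
    rw [flowDefect_sub ((sΓ a c e).mul (sΓ e d b)) ((sΓ a d e).mul (sΓ e c b)) hx,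
      flowDefect_mul (sΓ a c e) (sΓ e d b) hx, flowDefect_mul (sΓ a d e) (sΓ e c b) hx]
  rw [e1, h.pd_christoffel_variation hx, h.pd_christoffel_variation hx]
  simp only [h.christoffel_variation hx, Fin.sum_univ_four]
  ring

end IsConformalVariation

end Variation

/-! ### Variation of the Weyl tensor -/

section WeylVariation

variable {U : Set Pt} {G : ℝ × Pt → Matrix (Fin 4) (Fin 4) ℝ} {ξ : Pt → Fin 4 → ℝ} {ψ : Pt → ℝ}
  {x : Pt}

namespace IsConformalVariation

lemma riemann_variation (h : IsConformalVariation U G ξ ψ) (hx : x ∈ U) (a b c d : Fin 4) :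
    flowDefect ξ (fun q => riemann (member G q.1) a b c d q.2) x
      = ψ x * riemann (member G 0) a b c d x
        + ∑ f, (jac ξ f a x * riemann (member G 0) f b c d x
          + jac ξ f b x * riemann (member G 0) a f c d x
          + jac ξ f c x * riemann (member G 0) a b f d x
          + jac ξ f d x * riemann (member G 0) a b c f x)
        + (1 / 2) * (G (0, x) a d * hess (member G 0) ψ c b x
          - G (0, x) a c * hess (member G 0) ψ d b x
          - G (0, x) d b * hess (member G 0) ψ c a x
          + G (0, x) c b * hess (member G 0) ψ d a x) := by
  have e1 := flowDefect_sum (ξ := ξ) (s := Finset.univ)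
    (fun e => (h.smooth a e).mul (h.smooth_riemannUp e b c d)) hx
  refine (show flowDefect ξ (fun q => riemann (member G q.1) a b c d q.2) x = _ from e1).trans ?_
  have hδ : ∀ (p : ℝ) (c : Fin 4),
      ∑ e, G (0, x) a e * ((if e = c then 1 else 0) * p) = G (0, x) a c * p := fun p c => by simp
  have d1 := hδ (hess (member G 0) ψ c b x) d
  have d2 := hδ (hess (member G 0) ψ d b x) c
  have q1 := h.lower_hessUp hx c a
  have q2 := h.lower_hessUp hx d a
  simp only [flowDefect_mul (h.smooth a _) (h.smooth_riemannUp _ b c d) hx, h.variation x hx,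
    h.riemannUp_variation hx, riemann, Fin.sum_univ_four] at *
  linear_combination (1 / 2) * (d1 - d2) - (1 / 2) * G (0, x) d b * q1
    + (1 / 2) * G (0, x) c b * q2

lemma ricci_variation (h : IsConformalVariation U G ξ ψ) (hx : x ∈ U) (b d : Fin 4) :
    flowDefect ξ (fun q => ricci (member G q.1) b d q.2) x
      = ∑ f, (jac ξ f b x * ricci (member G 0) f d x + jac ξ f d x * ricci (member G 0) b f x)
        - hess (member G 0) ψ d b x
        - (1 / 2) * G (0, x) d b * ∑ a, hessUp (member G 0) ψ a a x := by
  have e1 := flowDefect_sum (ξ := ξ) (s := Finset.univ) (fun a => h.smooth_riemannUp a b a d) hx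
  refine (show flowDefect ξ (fun q => ricci (member G q.1) b d q.2) x = _ from e1).trans ?_
  have d1 : ∑ a, (if a = d then 1 else 0) * hess (member G 0) ψ a b x
      = hess (member G 0) ψ d b x := by simp
  have q1 := h.lower_hessUp hx d b
  have s := fun a => h.symm 0 x hx a b
  simp only [h.riemannUp_variation hx, ricci, Fin.sum_univ_four, if_true, s 0, s 1, s 2, s 3] at *
  linear_combination (1 / 2) * d1 + (1 / 2) * q1

lemma gInv_variation (h : IsConformalVariation U G ξ ψ) (hx : x ∈ U) (a b : Fin 4) :
    flowDefect ξ (fun q => gInv (member G q.1) q.2 a b) x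
      = -ψ x * gInv (member G 0) x a b
        - ∑ f, (jac ξ a f x * gInv (member G 0) x f b
          + jac ξ b f x * gInv (member G 0) x a f) := by
  refine h.lower_injective (t := 0) hx
    (v := fun b => flowDefect ξ (fun q => gInv (member G q.1) q.2 a b) x)
    (w := fun b => -ψ x * gInv (member G 0) x a b
        - ∑ f, (jac ξ a f x * gInv (member G 0) x f b
          + jac ξ b f x * gInv (member G 0) x a f)) (fun b => ?_) b
  have e1 : flowDefect ξ (fun q => ∑ e, gInv (member G q.1) q.2 a e * G q e b) x
      = flowDefect ξ (fun _ => if a = b then (1 : ℝ) else 0) x :=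
    flowDefect_congr ((h.eventually_mem hx).mono fun q hq =>
      h.gInv_mul (t := q.1) (x := q.2) hq a b)
  rw [flowDefect_sum (fun e => (h.smooth_gInv a e).mul (h.smooth e b)) hx, flowDefect_const] at e1
  simp only [flowDefect_mul (h.smooth_gInv a _) (h.smooth _ b) hx, h.variation x hx] at e1
  have s := fun c => h.symm 0 x hx c b
  have d1 : ∑ f, jac ξ f b x * (if a = f then 1 else 0) = jac ξ a b x := by simp
  have d2 : ∑ f, jac ξ a f x * (if f = b then 1 else 0) = jac ξ a b x := by simp
  simp only [← h.gInv_mul (t := 0) hx] at d1 d2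
  simp only [Fin.sum_univ_four, s 0, s 1, s 2, s 3] at *
  linear_combination e1 - d1 + d2

lemma gradient_trace (h : IsConformalVariation U G ξ ψ) (hx : x ∈ U) :
    ∑ b, ∑ d, gInv (member G 0) x b d * hess (member G 0) ψ d b x
      = ∑ a, hessUp (member G 0) ψ a a x := by
  rw [Finset.sum_comm]
  refine Finset.sum_congr rfl fun d _ => ?_
  rw [← h.raise_lower (t := 0) hx (fun e => hessUp (member G 0) ψ d e x) d]
  exact Finset.sum_congr rfl fun e _ => by rw [h.lower_hessUp hx, h.gInv_symm hx]

lemma gInv_contract_metric (h : IsConformalVariation U G ξ ψ) (hx : x ∈ U) :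
    ∑ b, ∑ d, gInv (member G 0) x b d * G (0, x) d b = 4 := by
  simp [h.gInv_mul hx]

lemma scalarCurv_variation (h : IsConformalVariation U G ξ ψ) (hx : x ∈ U) :
    flowDefect ξ (fun q => scalarCurv (member G q.1) q.2) x
      = -ψ x * scalarCurv (member G 0) x - 3 * ∑ a, hessUp (member G 0) ψ a a x := by
  have m := fun a b => (h.smooth_gInv a b).mul (h.smooth_ricci a b)
  have e1 := flowDefect_sum (ξ := ξ) (s := Finset.univ)
    (fun a => SmoothSlice.sum (s := Finset.univ) (m a)) hx
  refine (show flowDefect ξ (fun q => scalarCurv (member G q.1) q.2) x = _ from e1).trans ?_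
  have t1 := h.gradient_trace hx
  have t2 := h.gInv_contract_metric hx
  simp only [fun a => flowDefect_sum (ξ := ξ) (s := Finset.univ) (m a) hx,
    fun a b => flowDefect_mul (ξ := ξ) (h.smooth_gInv a b) (h.smooth_ricci a b) hx,
    h.gInv_variation hx, h.ricci_variation hx]
  simp only [scalarCurv, Fin.sum_univ_four] at *
  linear_combination -t1 - (1 / 2) * (hessUp (member G 0) ψ 0 0 x + hessUp (member G 0) ψ 1 1 x
    + hessUp (member G 0) ψ 2 2 x + hessUp (member G 0) ψ 3 3 x) * t2

/-- The Weyl tensor `C_{abcd}` is multiplied by the same factor as the metric: the second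
derivatives of the conformal factor cancel. -/
lemma weyl_variation (h : IsConformalVariation U G ξ ψ) (hx : x ∈ U) (a b c d : Fin 4) :
    flowDefect ξ (fun q => weyl (member G q.1) a b c d q.2) x
      = ψ x * weyl (member G 0) a b c d x
        + ∑ f, (jac ξ f a x * weyl (member G 0) f b c d x
          + jac ξ f b x * weyl (member G 0) a f c d x
          + jac ξ f c x * weyl (member G 0) a b f d x
          + jac ξ f d x * weyl (member G 0) a b c f x) := by
  have g := h.smooth
  have r := h.smooth_ricci
  have k := h.smooth_scalarCurv
  have m1 := (g a c).mul (r b d)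
  have m2 := (g a d).mul (r b c)
  have m3 := (g b c).mul (r a d)
  have m4 := (g b d).mul (r a c)
  have n1 := (g a c).mul (g b d)
  have n2 := (g a d).mul (g b c)
  have c2 : SmoothSlice U (fun _ => (1 / 2 : ℝ)) := SmoothSlice.const _
  have c6 : SmoothSlice U (fun _ => (1 / 6 : ℝ)) := SmoothSlice.const _
  have e1 := flowDefect_add (ξ := ξ) ((h.smooth_riemann a b c d).sub
    (c2.mul (((m1.sub m2).sub m3).add m4))) ((c6.mul k).mul (n1.sub n2)) hx
  refine (show flowDefect ξ (fun q => weyl (member G q.1) a b c d q.2) x = _ from e1).trans ?_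
  rw [flowDefect_sub (h.smooth_riemann a b c d) (c2.mul (((m1.sub m2).sub m3).add m4)) hx,
    flowDefect_mul c2 (((m1.sub m2).sub m3).add m4) hx, flowDefect_add ((m1.sub m2).sub m3) m4 hx,
    flowDefect_sub (m1.sub m2) m3 hx, flowDefect_sub m1 m2 hx,
    flowDefect_mul (g a c) (r b d) hx, flowDefect_mul (g a d) (r b c) hx,
    flowDefect_mul (g b c) (r a d) hx, flowDefect_mul (g b d) (r a c) hx,
    flowDefect_mul (c6.mul k) (n1.sub n2) hx, flowDefect_mul c6 k hx, flowDefect_sub n1 n2 hx,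
    flowDefect_mul (g a c) (g b d) hx, flowDefect_mul (g a d) (g b c) hx, flowDefect_const,
    flowDefect_const]
  have s := fun a b => h.symm 0 x hx a b
  simp only [h.riemann_variation hx, h.ricci_variation hx, h.scalarCurv_variation hx,
    h.variation x hx, weyl, member, Fin.sum_univ_four]
  rw [s d b, s c b, s d a, s c a]
  ring

end IsConformalVariation

end WeylVariation

/-! ### Variation of contractions with vector fields -/

section Contractions

variable {U : Set Pt} {G : ℝ × Pt → Matrix (Fin 4) (Fin 4) ℝ} {ξ : Pt → Fin 4 → ℝ} {ψ : Pt → ℝ}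
  {x : Pt}

/-- The components of `∂_t v - £_ξ v` at `t = 0`, for a family `v (t, x)` of complex vector
fields. -/
def dragVec (ξ : Pt → Fin 4 → ℝ) (v : ℝ × Pt → Fin 4 → ℂ) (x : Pt) (a : Fin 4) : ℂ :=
  flowDefect ξ (fun q => v q a) x + ∑ f, (jac ξ a f x : ℂ) * v (0, x) f

/-- Contraction of one covariant index. Here `R` stands for the terms in the variation of the
tensor `S` that come from its other indices. -/
lemma flowDefect_contract {S : Fin 4 → ℝ × Pt → ℂ} {R : Fin 4 → ℂ} {v : ℝ × Pt → Fin 4 → ℂ}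
    (hS : ∀ a, SmoothSlice U (S a)) (hv : ∀ a, SmoothSlice U (fun q => v q a)) (hx : x ∈ U)
    (h : ∀ a, flowDefect ξ (S a) x = R a + ∑ f, (jac ξ f a x : ℂ) * S f (0, x)) :
    flowDefect ξ (fun q => ∑ a, S a q * v q a) x
      = ∑ a, R a * v (0, x) a + ∑ a, S a (0, x) * dragVec ξ v x a := by
  rw [flowDefect_sum (fun a => (hS a).mul (hv a)) hx]
  simp only [flowDefect_mul (hS _) (hv _) hx, h, dragVec, Fin.sum_univ_four]
  ring

lemma SmoothSlice.dirDeriv {u : ℝ × Pt → Fin 4 → ℂ}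
    {η : ℝ × Pt → ℂ} (hu : ∀ a, SmoothSlice U (fun q => u q a)) (hη : SmoothSlice U η) :
    SmoothSlice U (fun q => NewmanPenrose.dirDeriv (fun y => u (q.1, y)) (fun y => η (q.1, y)) q.2) :=
  SmoothSlice.sum fun i => (hu i).mul (hη.pdx i)

lemma gDot_eq_contract (g : MetricField) (x : Pt) (v w : Fin 4 → ℂ) :
    gDot g x v w = ∑ a, (∑ b, (g x a b : ℂ) * w b) * v a := by
  simp only [gDot, Finset.sum_mul]
  exact Finset.sum_congr rfl fun a _ => Finset.sum_congr rfl fun b _ => by ring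

lemma ricciC_eq_contract (g : MetricField) (x : Pt) (v w : Fin 4 → ℂ) :
    ricciC g x v w = ∑ a, (∑ b, (ricci g a b x : ℂ) * w b) * v a := by
  simp only [ricciC, Finset.sum_mul]
  exact Finset.sum_congr rfl fun a _ => Finset.sum_congr rfl fun b _ => by ring

lemma weylC_eq_contract (g : MetricField) (x : Pt) (v w y z : Fin 4 → ℂ) :
    weylC g x v w y z
      = ∑ a, (∑ b, (∑ c, (∑ d, (weyl g a b c d x : ℂ) * z d) * y c) * w b) * v a := by
  simp only [weylC, Finset.sum_mul]
  exact Finset.sum_congr rfl fun a _ => Finset.sum_congr rfl fun b _ =>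
    Finset.sum_congr rfl fun c _ => Finset.sum_congr rfl fun d _ => by ring

/-- Contraction of a two-index tensor `S` with two vector fields; `L` is the variation of `S` in
the sense of `∂_t - £_ξ`. -/
lemma flowDefect_contract_two {S : Fin 4 → Fin 4 → ℝ × Pt → ℝ} {L : Fin 4 → Fin 4 → ℝ}
    {v w : ℝ × Pt → Fin 4 → ℂ} (hS : ∀ a b, SmoothSlice U (S a b))
    (hv : ∀ a, SmoothSlice U (fun q => v q a)) (hw : ∀ a, SmoothSlice U (fun q => w q a))
    (hx : x ∈ U)
    (h : ∀ a b, flowDefect ξ (S a b) x = L a b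
      + ∑ f, (jac ξ f a x * S f b (0, x) + jac ξ f b x * S a f (0, x))) :
    flowDefect ξ (fun q => ∑ a, (∑ b, (S a b q : ℂ) * w q b) * v q a) x
      = ∑ a, (∑ b, (L a b : ℂ) * w (0, x) b) * v (0, x) a
        + ∑ a, (∑ b, (S a b (0, x) : ℂ) * w (0, x) b) * dragVec ξ v x a
        + ∑ a, (∑ b, (S a b (0, x) : ℂ) * dragVec ξ w x b) * v (0, x) a := by
  have h1 := fun a => flowDefect_contract (S := fun b q => (S a b q : ℂ)) (v := w)
    (R := fun b => L a b + ∑ f, (jac ξ f a x : ℂ) * S f b (0, x))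
    (fun b => (hS a b).ofReal) hw hx (fun b => by
      rw [flowDefect_ofReal (hS a b) hx, h, Finset.sum_add_distrib]; push_cast; ring)
  rw [flowDefect_contract (fun a => SmoothSlice.sum fun b => (hS a b).ofReal.mul (hw b)) hv hx
    (R := fun a => ∑ b, (L a b : ℂ) * w (0, x) b
      + ∑ b, (S a b (0, x) : ℂ) * dragVec ξ w x b)
    (fun a => by rw [h1]; simp only [Fin.sum_univ_four]; ring)]
  simp only [Fin.sum_univ_four]
  ring

namespace IsConformalVariation

lemma gDot_variation (h : IsConformalVariation U G ξ ψ) {v w : ℝ × Pt → Fin 4 → ℂ}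
    (hv : ∀ a, SmoothSlice U (fun q => v q a)) (hw : ∀ a, SmoothSlice U (fun q => w q a))
    (hx : x ∈ U) :
    flowDefect ξ (fun q => gDot (member G q.1) q.2 (v q) (w q)) x
      = ψ x * gDot (member G 0) x (v (0, x)) (w (0, x))
        + gDot (member G 0) x (dragVec ξ v x) (w (0, x))
        + gDot (member G 0) x (v (0, x)) (dragVec ξ w x) := by
  simp only [gDot_eq_contract]
  rw [flowDefect_contract_two (S := fun a b q => G q a b) (L := fun a b => ψ x * G (0, x) a b)
    h.smooth hv hw hx (h.variation x hx)]
  simp only [Fin.sum_univ_four, member]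
  push_cast
  ring

lemma weylC_variation (h : IsConformalVariation U G ξ ψ) {v w y z : ℝ × Pt → Fin 4 → ℂ}
    (hv : ∀ a, SmoothSlice U (fun q => v q a)) (hw : ∀ a, SmoothSlice U (fun q => w q a))
    (hy : ∀ a, SmoothSlice U (fun q => y q a)) (hz : ∀ a, SmoothSlice U (fun q => z q a))
    (hx : x ∈ U) :
    flowDefect ξ (fun q => weylC (member G q.1) q.2 (v q) (w q) (y q) (z q)) x
      = ψ x * weylC (member G 0) x (v (0, x)) (w (0, x)) (y (0, x)) (z (0, x))
        + weylC (member G 0) x (dragVec ξ v x) (w (0, x)) (y (0, x)) (z (0, x))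
        + weylC (member G 0) x (v (0, x)) (dragVec ξ w x) (y (0, x)) (z (0, x))
        + weylC (member G 0) x (v (0, x)) (w (0, x)) (dragVec ξ y x) (z (0, x))
        + weylC (member G 0) x (v (0, x)) (w (0, x)) (y (0, x)) (dragVec ξ z x) := by
  have h4 := fun a b c d => (h.smooth_weyl a b c d).ofReal
  have h3 := fun a b c => SmoothSlice.sum (s := Finset.univ) fun d => (h4 a b c d).mul (hz d)
  have h2 := fun a b => SmoothSlice.sum (s := Finset.univ) fun c => (h3 a b c).mul (hy c)
  have h1 := fun a => SmoothSlice.sum (s := Finset.univ) fun b => (h2 a b).mul (hw b)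
  set C : Fin 4 → Fin 4 → Fin 4 → Fin 4 → ℂ := fun a b c d => (weyl (member G 0) a b c d x : ℂ)
    with hC
  have e3 := fun a b c => flowDefect_contract (v := z) (h4 a b c) hz hx
    (R := fun d => ψ x * C a b c d + ∑ f, ((jac ξ f a x : ℂ) * C f b c d
      + (jac ξ f b x : ℂ) * C a f c d + (jac ξ f c x : ℂ) * C a b f d))
    (fun d => by
      rw [flowDefect_ofReal (h.smooth_weyl a b c d) hx, h.weyl_variation hx, hC]
      simp only [Fin.sum_univ_four]; push_cast; ring)
  set C3 : Fin 4 → Fin 4 → Fin 4 → ℂ := fun a b c => ∑ d, C a b c d * z (0, x) d with hC3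
  set D3 : Fin 4 → Fin 4 → Fin 4 → ℂ := fun a b c => ∑ d, C a b c d * dragVec ξ z x d with hD3
  have e2 := fun a b => flowDefect_contract (v := y) (h3 a b) hy hx
    (R := fun c => ψ x * C3 a b c + D3 a b c + ∑ f, ((jac ξ f a x : ℂ) * C3 f b c
      + (jac ξ f b x : ℂ) * C3 a f c))
    (fun c => by
      rw [e3]; simp only [hC3, hD3, hC, Fin.sum_univ_four]; ring)
  set C2 : Fin 4 → Fin 4 → ℂ := fun a b => ∑ c, C3 a b c * y (0, x) c with hC2
  set D2 : Fin 4 → Fin 4 → ℂ := fun a b => ∑ c, D3 a b c * y (0, x) c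
    + ∑ c, C3 a b c * dragVec ξ y x c with hD2
  have e1 := fun a => flowDefect_contract (v := w) (h2 a) hw hx
    (R := fun b => ψ x * C2 a b + D2 a b + ∑ f, (jac ξ f a x : ℂ) * C2 f b)
    (fun b => by
      rw [e2]; simp only [hC2, hD2]
      change _ = _ + ∑ f, (jac ξ f b x : ℂ) * ∑ c, C3 a f c * y (0, x) c
      change _ + ∑ c, C3 a b c * _ = _
      simp only [Fin.sum_univ_four]; ring)
  set C1 : Fin 4 → ℂ := fun a => ∑ b, C2 a b * w (0, x) b with hC1
  have e0 := flowDefect_contract (v := v) h1 hv hx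
    (R := fun a => ψ x * C1 a + ∑ b, D2 a b * w (0, x) b + ∑ b, C2 a b * dragVec ξ w x b)
    (fun a => by
      rw [e1]; simp only [hC1]
      change _ = _ + ∑ f, (jac ξ f a x : ℂ) * ∑ b, C2 f b * w (0, x) b
      change _ + ∑ b, C2 a b * _ = _
      simp only [Fin.sum_univ_four]; ring)
  simp only [weylC_eq_contract]
  refine e0.trans ?_
  change _ + ∑ a, C1 a * _ = ψ x * ∑ a, C1 a * _ + ∑ a, C1 a * _
    + ∑ a, (∑ b, C2 a b * _) * _ + ∑ a, (∑ b, (∑ c, C3 a b c * _) * _) * _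
    + ∑ a, (∑ b, (∑ c, D3 a b c * _) * _) * _
  simp only [hD2, Fin.sum_univ_four]
  ring

lemma ricciC_variation (h : IsConformalVariation U G ξ fun _ => 0) {v w : ℝ × Pt → Fin 4 → ℂ}
    (hv : ∀ a, SmoothSlice U (fun q => v q a)) (hw : ∀ a, SmoothSlice U (fun q => w q a))
    (dv : ∀ y ∈ U, dragVec ξ v y = 0) (dw : ∀ y ∈ U, dragVec ξ w y = 0) (hx : x ∈ U) :
    flowDefect ξ (fun q => ricciC (member G q.1) q.2 (v q) (w q)) x = 0 := by
  simp only [ricciC_eq_contract]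
  rw [flowDefect_contract_two (S := fun a b q => ricci (member G q.1) a b q.2)
    (L := fun _ _ => 0)
    h.smooth_ricci hv hw hx (fun a b => by
      rw [h.ricci_variation hx]; simp [hess_zero, hessUp_zero]), dv x hx, dw x hx]
  simp

lemma scalarCurv_invariant (h : IsConformalVariation U G ξ fun _ => 0) (hx : x ∈ U) :
    flowDefect ξ (fun q => scalarCurv (member G q.1) q.2) x = 0 := by
  simp [h.scalarCurv_variation hx, hessUp_zero]

/-- Vanishing of `∂_t v - £_ξ v` commutes with taking directional derivatives. -/
lemma dirDeriv_variation (h : IsConformalVariation U G ξ ψ) {u : ℝ × Pt → Fin 4 → ℂ}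
    {η : ℝ × Pt → ℂ} (hu : ∀ a, SmoothSlice U (fun q => u q a)) (hη : SmoothSlice U η)
    (du : ∀ y ∈ U, dragVec ξ u y = 0) (hx : x ∈ U) :
    flowDefect ξ (fun q => dirDeriv (fun y => u (q.1, y)) (fun y => η (q.1, y)) q.2) x
      = ∑ i, u (0, x) i * pd i (flowDefect ξ η) x := by
  have e1 := flowDefect_sum (ξ := ξ) (s := Finset.univ) (fun i => (hu i).mul (hη.pdx i)) hx
  refine (show flowDefect ξ _ x = _ from e1).trans ?_
  have e2 : ∀ i, flowDefect ξ (fun q => u q i) x = -∑ f, (jac ξ i f x : ℂ) * u (0, x) f :=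
    fun i => eq_neg_of_add_eq_zero_left (congrFun (du x hx) i)
  simp only [flowDefect_mul (hu _) (hη.pdx _) hx, e2,
    flowDefect_pdx h.isOpen h.smooth_field hη hx, Fin.sum_univ_four, Complex.real_smul, jac]
  ring

lemma smooth_covDeriv (h : IsConformalVariation U G ξ ψ) {u v : ℝ × Pt → Fin 4 → ℂ}
    (hu : ∀ a, SmoothSlice U (fun q => u q a)) (hv : ∀ a, SmoothSlice U (fun q => v q a))
    (a : Fin 4) :
    SmoothSlice U (fun q => covDeriv (member G q.1) (fun y => u (q.1, y)) (fun y => v (q.1, y))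
      q.2 a) :=
  (SmoothSlice.dirDeriv hu (hv a)).add (SmoothSlice.sum fun b => SmoothSlice.sum fun c =>
    ((h.smooth_christoffel a b c).ofReal.mul (hu b)).mul (hv c))

/-- If `u` and `v` are dragged along `ξ`, so is `∇_u v`; the second derivatives of `ξ` that come from
`v` cancel against those in the variation of the connection. -/
lemma covDeriv_variation (h : IsConformalVariation U G ξ fun _ => 0) {u v : ℝ × Pt → Fin 4 → ℂ}
    (hu : ∀ a, SmoothSlice U (fun q => u q a)) (hv : ∀ a, SmoothSlice U (fun q => v q a))
    (du : ∀ y ∈ U, dragVec ξ u y = 0) (dv : ∀ y ∈ U, dragVec ξ v y = 0) (hx : x ∈ U) :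
    dragVec ξ (fun q => covDeriv (member G q.1) (fun y => u (q.1, y)) (fun y => v (q.1, y)) q.2) x
      = 0 := by
  funext a
  have m := fun b c => ((h.smooth_christoffel a b c).ofReal.mul (hu b)).mul (hv c)
  have e1 := flowDefect_add (ξ := ξ) (SmoothSlice.dirDeriv hu (hv a))
    (SmoothSlice.sum (s := Finset.univ) fun b => SmoothSlice.sum (s := Finset.univ) (m b)) hx
  have ev : ∀ y ∈ U, ∀ i, flowDefect ξ (fun q => v q i) y
      = -∑ f, (jac ξ i f y : ℂ) * v (0, y) f :=
    fun y hy i => eq_neg_of_add_eq_zero_left (congrFun (dv y hy) i)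
  have eu : ∀ i, flowDefect ξ (fun q => u q i) x = -∑ f, (jac ξ i f x : ℂ) * u (0, x) f :=
    fun i => eq_neg_of_add_eq_zero_left (congrFun (du x hx) i)
  have dJ : ∀ f, DifferentiableAt ℝ (fun y => (jac ξ a f y : ℂ)) x := fun f =>
    Complex.ofRealCLM.differentiableAt.comp x (h.diff_jac hx a f)
  have dV : ∀ f, DifferentiableAt ℝ (fun y => v (0, y) f) x := fun f =>
    differentiableAt_of_contDiffOn h.isOpen (hv f).restrict hx
  have e2 : ∀ i, pd i (flowDefect ξ (fun q => v q a)) x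
      = -∑ f, ((pd i (jac ξ a f) x : ℝ) * v (0, x) f
        + (jac ξ a f x : ℂ) * pd i (fun y => v (0, y) f) x) := fun i => by
    have hneg : ∀ k : Pt → ℂ, pd i (fun y => -k y) x = -pd i k x := fun k => by
      simp [pd, fderiv_fun_neg]
    rw [pd_congr h.isOpen (fun y hy => ev y hy a) hx, hneg,
      pd_sum _ (fun f => (dJ f).fun_mul (dV f))]
    simp only [pd_mul (dJ _) (dV _), pd_ofReal (h.diff_jac hx a _)]
  rw [h.dirDeriv_variation hu (hv a) du hx,
    flowDefect_sum (fun b => SmoothSlice.sum (s := Finset.univ) (m b)) hx] at e1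
  simp only [fun b => flowDefect_sum (ξ := ξ) (s := Finset.univ) (m b) hx,
    fun b c => flowDefect_mul (ξ := ξ) ((h.smooth_christoffel a b c).ofReal.mul (hu b)) (hv c) hx,
    fun b c => flowDefect_mul (ξ := ξ) ((h.smooth_christoffel a b c).ofReal) (hu b) hx,
    fun b c => flowDefect_ofReal (ξ := ξ) (h.smooth_christoffel a b c) hx,
    h.christoffel_variation hx, ev x hx, eu, e2, gradUp, pd_const] at e1
  unfold dragVec
  refine (congrArg (· + _) (show flowDefect ξ _ x = _ from e1)).trans ?_
  simp only [covDeriv, dirDeriv, Fin.sum_univ_four]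
  push_cast
  simp
  ring

end IsConformalVariation

end Contractions

/-! ### Invariance of the combinations of the NP scalars -/

section Combinations

/-- A family of metrics and tetrads which, to first order at `t = 0`, is obtained by dragging along
`ξ`: `∂_t g = £_ξ g`, and `∂_t e = £_ξ e` for the tetrad vectors. -/
structure IsDragged (U : Set Pt) (G : ℝ × Pt → Matrix (Fin 4) (Fin 4) ℝ) (S : ℝ → Tetrad)
    (ξ : Pt → Fin 4 → ℝ) : Prop extends IsConformalVariation U G ξ (fun _ => 0) where
  smooth_vec : ∀ k i, SmoothSlice U (fun q => (S q.1).vec k q.2 i)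
  drag_vec : ∀ k, ∀ x ∈ U, dragVec ξ (fun q => (S q.1).vec k q.2) x = 0

variable {U : Set Pt} {G : ℝ × Pt → Matrix (Fin 4) (Fin 4) ℝ} {S : ℝ → Tetrad}
  {ξ : Pt → Fin 4 → ℝ} {x : Pt}

/-- The family `f` is smooth at `t = 0`, where its variation is the derivative along `ξ`. -/
def IsInvariant (U : Set Pt) (ξ : Pt → Fin 4 → ℝ) (f : ℝ × Pt → ℂ) : Prop :=
  SmoothSlice U f ∧ ∀ x ∈ U, flowDefect ξ f x = 0

lemma IsInvariant.neg {f : ℝ × Pt → ℂ} (hf : IsInvariant U ξ f) :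
    IsInvariant U ξ (fun q => -f q) :=
  ⟨hf.1.neg, fun x hx => by rw [flowDefect_neg, hf.2 x hx, neg_zero]⟩

lemma IsInvariant.add {f g : ℝ × Pt → ℂ} (hf : IsInvariant U ξ f) (hg : IsInvariant U ξ g) :
    IsInvariant U ξ (fun q => f q + g q) :=
  ⟨hf.1.add hg.1, fun x hx => by
    rw [flowDefect_add hf.1 hg.1 hx, hf.2 x hx, hg.2 x hx, add_zero]⟩

lemma IsInvariant.sub {f g : ℝ × Pt → ℂ} (hf : IsInvariant U ξ f) (hg : IsInvariant U ξ g) :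
    IsInvariant U ξ (fun q => f q - g q) :=
  ⟨hf.1.sub hg.1, fun x hx => by
    rw [flowDefect_sub hf.1 hg.1 hx, hf.2 x hx, hg.2 x hx, sub_zero]⟩

lemma IsInvariant.const_mul {f : ℝ × Pt → ℂ} (c : ℂ) (hf : IsInvariant U ξ f) :
    IsInvariant U ξ (fun q => c * f q) :=
  ⟨(SmoothSlice.const c).mul hf.1, fun x hx => by
    rw [flowDefect_mul (SmoothSlice.const c) hf.1 hx, hf.2 x hx, flowDefect_const]; simp⟩

lemma IsInvariant.comp {k : ℕ} {f : Fin k → ℝ × Pt → ℂ} (hf : ∀ j, IsInvariant U ξ (f j))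
    {F : (Fin k → ℂ) → ℂ} {O : Set (Fin k → ℂ)} (hO : IsOpen O) (hF : ContDiffOn ℝ ∞ F O)
    (hmem : ∀ x ∈ U, (fun j => f j (0, x)) ∈ O) :
    IsInvariant U ξ (fun q => F (fun j => f j q)) := by
  have hd : ∀ x ∈ U, ContDiffAt ℝ ∞ F (fun j => f j (0, x)) := fun x hx =>
    hF.contDiffAt (hO.mem_nhds (hmem x hx))
  have ht : SmoothSlice U (fun q => fun j => f j q) := fun x hx =>
    contDiffAt_pi.2 fun j => (hf j).1 x hx
  refine ⟨fun x hx => (hd x hx).comp (0, x) (ht x hx), fun x hx => ?_⟩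
  have h1 : HasFDerivAt (fun q : ℝ × Pt => F (fun j => f j q)) _ ((0 : ℝ), x) :=
    HasFDerivAt.comp (g := F) (f := fun q j => f j q) ((0 : ℝ), x)
    ((hd x hx).differentiableAt (by simp)).hasFDerivAt (ht.differentiableAt hx).hasFDerivAt
  have h2 : fderiv ℝ (fun q : ℝ × Pt => fun j => f j q) (0, x) (1, -ξ x) = 0 := by
    funext j
    have := fderiv_apply (ht.differentiableAt hx) j
    have h3 := (hf j).2 x hx
    rw [flowDefect, this] at h3
    exact h3
  simp [flowDefect, h1.fderiv, h2]

namespace IsDragged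

lemma isInvariant_rot (h : IsDragged U G S ξ) (a b c : Leg) :
    IsInvariant U ξ (fun q => rot (member G q.1) (S q.1) a b c q.2) := by
  have sm := h.toIsConformalVariation.smooth_covDeriv (h.smooth_vec c) (h.smooth_vec b)
  constructor
  · have hc : SmoothSlice U (fun q => ∑ i, ∑ j, (G q i j : ℂ) * (S q.1).vec a q.2 i
        * covDeriv (member G q.1) ((S q.1).vec c) ((S q.1).vec b) q.2 j) :=
      SmoothSlice.sum fun i => SmoothSlice.sum fun j =>
        ((h.smooth i j).ofReal.mul (h.smooth_vec a i)).mul (sm j)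
    exact hc
  · intro x hx
    have := h.gDot_variation (h.smooth_vec a) sm hx
    refine (show flowDefect ξ _ x = _ from this).trans ?_
    rw [h.covDeriv_variation (h.smooth_vec c) (h.smooth_vec b) (h.drag_vec c) (h.drag_vec b) hx,
      h.drag_vec a x hx]
    simp [gDot]

lemma isInvariant_weylC (h : IsDragged U G S ξ) (a b c d : Leg) :
    IsInvariant U ξ (fun q => weylC (member G q.1) q.2 ((S q.1).vec a q.2) ((S q.1).vec b q.2)
      ((S q.1).vec c q.2) ((S q.1).vec d q.2)) := by
  refine ⟨?_, fun x hx => ?_⟩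
  · exact SmoothSlice.sum fun i => SmoothSlice.sum fun j => SmoothSlice.sum fun k =>
      SmoothSlice.sum fun l => (((((h.smooth_weyl i j k l).ofReal).mul (h.smooth_vec a i)).mul
        (h.smooth_vec b j)).mul (h.smooth_vec c k)).mul (h.smooth_vec d l)
  · have := h.weylC_variation (h.smooth_vec a) (h.smooth_vec b) (h.smooth_vec c) (h.smooth_vec d) hx
    rw [this, h.drag_vec a x hx, h.drag_vec b x hx, h.drag_vec c x hx, h.drag_vec d x hx]
    simp [weylC]

lemma isInvariant_ricciC (h : IsDragged U G S ξ) (a b : Leg) :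
    IsInvariant U ξ (fun q => ricciC (member G q.1) q.2 ((S q.1).vec a q.2)
      ((S q.1).vec b q.2)) := by
  refine ⟨?_, fun x hx => ?_⟩
  · exact SmoothSlice.sum fun i => SmoothSlice.sum fun j =>
      (((h.smooth_ricci i j).ofReal).mul (h.smooth_vec a i)).mul (h.smooth_vec b j)
  · exact h.ricciC_variation (h.smooth_vec a) (h.smooth_vec b) (h.drag_vec a) (h.drag_vec b) hx

lemma isInvariant_bigLambda (h : IsDragged U G S ξ) :
    IsInvariant U ξ (fun q => bigLambda (member G q.1) q.2) := by
  have s := (SmoothSlice.const (U := U) (-(1 / 24 : ℝ))).mul h.smooth_scalarCurv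
  refine ⟨s.ofReal, fun x hx => ?_⟩
  refine (show flowDefect ξ _ x = _ from flowDefect_ofReal s hx).trans ?_
  rw [flowDefect_mul (SmoothSlice.const _) h.smooth_scalarCurv hx, h.scalarCurv_invariant hx,
    flowDefect_const]
  simp

lemma isInvariant_spinCoeff (h : IsDragged U G S ξ) (s : SpinCoeff) :
    IsInvariant U ξ (fun q => spinCoeff (member G q.1) (S q.1) s q.2) := by
  have r := h.isInvariant_rot
  cases s
  · exact r _ _ _
  · exact r _ _ _
  · exact r _ _ _
  · exact r _ _ _
  · exact (r _ _ _).neg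
  · exact (r _ _ _).neg
  · exact (r _ _ _).neg
  · exact (r _ _ _).neg
  all_goals exact ((r _ _ _).sub (r _ _ _)).const_mul _

lemma isInvariant_psi (h : IsDragged U G S ξ) (k : Fin 5) :
    IsInvariant U ξ (fun q => psi (member G q.1) (S q.1) k q.2) := by
  fin_cases k <;> exact (h.isInvariant_weylC _ _ _ _).neg

lemma isInvariant_phi (h : IsDragged U G S ξ) (i j : Fin 3) :
    IsInvariant U ξ (fun q => phi (member G q.1) (S q.1) i j q.2) := by
  have r := h.isInvariant_ricciC
  fin_cases i <;> fin_cases j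
  pick_goal 5
  · exact ((r .l .n).add (r .m .mbar)).const_mul (1 / 4)
  all_goals exact (r _ _).const_mul _

/-- Every combination of the NP scalars is natural: if metric and tetrad are dragged along `ξ`, so
is the combination. -/
lemma isInvariant_eval (h : IsDragged U G S ξ) (e : NPComb)
    (he : e.DefinedOn (member G 0) (S 0) U) :
    IsInvariant U ξ (fun q => e.eval (member G q.1) (S q.1) q.2) := by
  induction e with
  | spin s => exact h.isInvariant_spinCoeff s
  | psi k => exact h.isInvariant_psi k
  | phi i j => exact h.isInvariant_phi i j
  | bigLambda => exact h.isInvariant_bigLambda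
  | fn F e ih =>
    obtain ⟨he, O, hO, hF, hmem⟩ := he
    exact IsInvariant.comp (fun j => ih j (he j)) hO hF hmem
  | deriv a e ih =>
    have hi := ih he
    refine ⟨SmoothSlice.dirDeriv (h.smooth_vec a) hi.1, fun x hx => ?_⟩
    refine (show flowDefect ξ _ x = _ from
      h.dirDeriv_variation (h.smooth_vec a) hi.1 (h.drag_vec a) hx).trans ?_
    have : ∀ i, pd i (flowDefect ξ fun q => e.eval (member G q.1) (S q.1) q.2) x = 0 := fun i => by
      rw [pd_congr h.isOpen hi.2 hx i, pd_const]
    simp [this]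

end IsDragged

lemma NPComb.DefinedOn.mono {g : MetricField} {T : Tetrad} {V W : Set Pt} (hVW : V ⊆ W)
    {e : NPComb} (he : e.DefinedOn g T W) : e.DefinedOn g T V := by
  induction e with
  | spin s => trivial
  | psi k => trivial
  | phi i j => trivial
  | bigLambda => trivial
  | fn F e ih =>
    obtain ⟨he, O, hO, hF, hmem⟩ := he
    exact ⟨fun j => ih j (he j), O, hO, hF, fun x hx => hmem x (hVW hx)⟩
  | deriv a e ih => exact ih he

/-- Being well defined is an open condition on the parameter of the family. -/
lemma IsDragged.eventually_definedOn (h : IsDragged U G S ξ) (e : NPComb)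
    (he : e.DefinedOn (member G 0) (S 0) U) (hx : x ∈ U) :
    ∃ V, IsOpen V ∧ x ∈ V ∧ V ⊆ U ∧
      ∀ᶠ t in 𝓝 (0 : ℝ), e.DefinedOn (member G t) (S t) V := by
  induction e with
  | spin s => exact ⟨U, h.isOpen, hx, subset_rfl, .of_forall fun _ => trivial⟩
  | psi k => exact ⟨U, h.isOpen, hx, subset_rfl, .of_forall fun _ => trivial⟩
  | phi i j => exact ⟨U, h.isOpen, hx, subset_rfl, .of_forall fun _ => trivial⟩
  | bigLambda => exact ⟨U, h.isOpen, hx, subset_rfl, .of_forall fun _ => trivial⟩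
  | fn F e ih =>
    obtain ⟨he, O, hO, hF, hmem⟩ := he
    choose V hVo hxV hVU hV using fun j => ih j (he j)
    have hc : ContinuousAt (fun q : ℝ × Pt => fun j => (e j).eval (member G q.1) (S q.1) q.2)
        (0, x) := continuousAt_pi.2 fun j => ((h.isInvariant_eval (e j) (he j)).1 x hx).continuousAt
    have hO' := hc.preimage_mem_nhds (hO.mem_nhds (hmem x hx))
    obtain ⟨A, hA, B, hB, hAB⟩ := mem_nhds_prod_iff.1 hO'
    obtain ⟨B', hB'B, hB'o, hxB'⟩ := mem_nhds_iff.1 hB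
    refine ⟨U ∩ B' ∩ ⋂ j, V j, (h.isOpen.inter hB'o).inter (isOpen_iInter_of_finite hVo),
      ⟨⟨hx, hxB'⟩, Set.mem_iInter.2 hxV⟩, fun y hy => hy.1.1, ?_⟩
    filter_upwards [hA, Filter.eventually_all.2 hV] with t ht htV
    refine ⟨fun j => (htV j).mono fun y hy => Set.mem_iInter.1 hy.2 j, O, hO, hF, fun y hy => ?_⟩
    exact hAB (Set.mk_mem_prod ht (hB'B hy.1.2))
  | deriv a e ih => exact ih he

end Combinations

/-! ### Commutator equations and conformal rescalings -/

section Commutator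

variable {U : Set Pt} {g : MetricField} {ξ : Pt → Fin 4 → ℝ} {φ : Pt → ℝ} {T : Tetrad} {x : Pt}

lemma IsLorentzMetricOn.det_ne_zero (hg : IsLorentzMetricOn g U) (hx : x ∈ U) :
    (g x).det ≠ 0 := by
  obtain ⟨P, -, h⟩ := hg.signature x hx
  intro h0
  have := congrArg Matrix.det h
  rw [Matrix.det_mul, Matrix.det_mul, h0, Matrix.det_diagonal] at this
  simp [Fin.prod_univ_four] at this

/-- A metric, regarded as a family that does not depend on the parameter. -/
abbrev constFamily (g : MetricField) : ℝ × Pt → Matrix (Fin 4) (Fin 4) ℝ := fun q => g q.2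

lemma IsLorentzMetricOn.isMetricFamily (hU : IsOpen U) (hg : IsLorentzMetricOn g U) :
    IsMetricFamily U (constFamily g) where
  isOpen := hU
  smooth a b := SmoothSlice.of_static hU (hg.smooth a b)
  symm _ y hy a b := hg.symm y hy a b
  det _ _ hy := hg.det_ne_zero hy

/-- The constant family varies by the negative of the Lie derivative. -/
lemma IsConformalKilling.isConformalVariation (hU : IsOpen U) (hg : IsLorentzMetricOn g U)
    (hξ : ContDiffOn ℝ ∞ ξ U) (hφ : ContDiffOn ℝ ∞ φ U) (hk : IsConformalKilling U g ξ φ) :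
    IsConformalVariation U (constFamily g) ξ (fun x => -φ x) where
  toIsMetricFamily := hg.isMetricFamily hU
  smooth_field := hξ
  smooth_factor := hφ.neg
  variation x hx a b := by
    have := hk x hx a b
    have e := flowDefect_static (ξ := ξ) (differentiableAt_of_contDiffOn hU (hg.smooth a b) hx)
    refine (show flowDefect ξ _ x = _ from e).trans ?_
    simp only [lieMetric, jac, constFamily, Fin.sum_univ_four, smul_eq_mul] at this ⊢
    linear_combination -this

lemma Tetrad.IsNullOn.smooth_vec (hT : T.IsNullOn g U) (k : Leg) (i : Fin 4) :
    ContDiffOn ℝ ∞ (fun x => T.vec k x i) U := by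
  have hl := contDiffOn_pi.1 hT.smooth_l i
  have hn := contDiffOn_pi.1 hT.smooth_n i
  have hm := contDiffOn_pi.1 hT.smooth_m i
  cases k
  · exact Complex.ofRealCLM.contDiff.comp_contDiffOn hl
  · exact Complex.ofRealCLM.contDiff.comp_contDiffOn hn
  · exact hm
  · exact Complex.conjCLE.contDiff.comp_contDiffOn hm

lemma pd_coord (i j : Fin 4) (x : Pt) : pd j (coord i) x = if i = j then 1 else 0 := by
  have h : DifferentiableAt ℝ (fun y : Pt => y i) x := by fun_prop
  have h2 : pd j (fun y : Pt => y i) x = if i = j then (1 : ℝ) else 0 := by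
    have h3 : HasFDerivAt (fun y : Pt => y i) _ x :=
      (ContinuousLinearMap.proj (R := ℝ) (φ := fun _ : Fin 4 => ℝ) i).hasFDerivAt
    simp [pd, h3.fderiv, Pi.single_apply]
  have := pd_ofReal h j
  rw [h2] at this
  refine (show pd j (coord i) x = _ from this).trans ?_
  split_ifs <;> simp

lemma dirDeriv_coord (v : Pt → Fin 4 → ℂ) (i : Fin 4) : dirDeriv v (coord i) = fun x => v x i := by
  funext x
  simp [dirDeriv, pd_coord]

/-- The commutator equations for the coordinates say `£_ξ e = -½ φ e` for all tetrad vectors. -/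
lemma npLieCommutator_coord_iff (hU : IsOpen U) (hT : T.IsNullOn g U) (hξ : ContDiffOn ℝ ∞ ξ U) :
    (∀ i, NPLieCommutator U T ξ φ (coord i)) ↔
      ∀ k, ∀ x ∈ U, dragVec ξ (fun q => T.vec k q.2) x = fun i => (φ x : ℂ) / 2 * T.vec k x i := by
  have key : ∀ i k, ∀ x ∈ U, T.D k (lieScalar ξ (coord i)) x - lieScalar ξ (T.D k (coord i)) x
      = dragVec ξ (fun q => T.vec k q.2) x i := fun i k x hx => by
    have h1 : lieScalar ξ (coord i) = fun y => (ξ y i : ℂ) := dirDeriv_coord _ i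
    have h2 : T.D k (coord i) = fun y => T.vec k y i := dirDeriv_coord _ i
    have dξ : DifferentiableAt ℝ (fun y => ξ y i) x :=
      differentiableAt_of_contDiffOn hU (contDiffOn_pi.1 hξ i) hx
    have e := flowDefect_static (ξ := ξ)
      (differentiableAt_of_contDiffOn hU (hT.smooth_vec k i) hx)
    rw [h1, h2, dragVec, e]
    simp only [Tetrad.D, lieScalar, dirDeriv, pd_ofReal dξ, jac, Fin.sum_univ_four,
      Complex.real_smul]
    ring
  constructor
  · intro h k x hx
    funext i
    rw [← key i k x hx, h i x hx k]
    exact congrArg _ (congrFun (dirDeriv_coord _ i) x)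
  · intro h i x hx k
    rw [key i k x hx, h k x hx]
    exact congrArg _ (congrFun (dirDeriv_coord _ i) x).symm

lemma smoothSlice_exp (hU : IsOpen U) (hφ : ContDiffOn ℝ ∞ φ U) (c : ℝ) :
    SmoothSlice U (fun q : ℝ × Pt => Real.exp (q.1 * φ q.2 * c)) := fun x hx =>
  Real.contDiff_exp.contDiffAt.comp ((0 : ℝ), x)
    ((contDiffAt_fst.mul (SmoothSlice.of_static hU hφ x hx)).mul contDiffAt_const)

lemma flowDefect_exp (hU : IsOpen U) (hφ : ContDiffOn ℝ ∞ φ U) (c : ℝ) (hx : x ∈ U) :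
    flowDefect ξ (fun q : ℝ × Pt => Real.exp (q.1 * φ q.2 * c)) x = c * φ x := by
  rw [flowDefect_eq_deriv_sub (smoothSlice_exp hU hφ c) hx]
  have h1 : HasDerivAt (fun t : ℝ => Real.exp (t * φ x * c)) (Real.exp (0 * φ x * c)
      * (1 * φ x * c)) 0 := (((hasDerivAt_id (0 : ℝ)).mul_const (φ x)).mul_const c).exp
  refine (congrArg₂ (· - ·) h1.deriv rfl).trans ?_
  simp [pd_const, mul_comm]

/-- The conformal factors `exp (t φ / 2)`. -/
def expFactor (φ : Pt → ℝ) (t : ℝ) (x : Pt) : ℝ := Real.exp (t * φ x * (1 / 2))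

lemma expFactor_sq (t : ℝ) (x : Pt) : expFactor φ t x ^ 2 = Real.exp (t * φ x * 1) := by
  rw [expFactor, ← Real.exp_nat_mul]; congr 1; push_cast; ring

lemma expFactor_inv (t : ℝ) (x : Pt) : (expFactor φ t x)⁻¹ = Real.exp (t * φ x * (-1 / 2)) := by
  rw [expFactor, ← Real.exp_neg]; congr 1; ring

lemma Tetrad.vec_rescale (Ω : Pt → ℝ) (T : Tetrad) (k : Leg) (x : Pt) (i : Fin 4) :
    (T.rescale Ω).vec k x i = (((Ω x)⁻¹ : ℝ) : ℂ) * T.vec k x i := by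
  cases k <;> simp [Tetrad.vec, Tetrad.rescale]

/-- The family of conformal rescalings by `exp (t φ / 2)`. To first order, this is the family
obtained by dragging metric and tetrad along the conformal Killing vector. -/
lemma isDragged_rescale (hU : IsOpen U) (hg : IsLorentzMetricOn g U) (hT : T.IsNullOn g U)
    (hξ : ContDiffOn ℝ ∞ ξ U) (hφ : ContDiffOn ℝ ∞ φ U) (hk : IsConformalKilling U g ξ φ)
    (hd : ∀ k, ∀ x ∈ U, dragVec ξ (fun q => T.vec k q.2) x = fun i => (φ x : ℂ) / 2 * T.vec k x i) :
    IsDragged U (fun q => rescaleMetric (expFactor φ q.1) g q.2)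
      (fun t => T.rescale (expFactor φ t)) ξ := by
  have v0 := hk.isConformalVariation hU hg hξ hφ
  have hG : ∀ a b, (fun q : ℝ × Pt => rescaleMetric (expFactor φ q.1) g q.2 a b)
      = fun q => Real.exp (q.1 * φ q.2 * 1) * constFamily g q a b := fun a b => by
    funext q
    change (expFactor φ q.1 q.2 ^ 2 • g q.2) a b = _
    rw [Matrix.smul_apply, smul_eq_mul, expFactor_sq]
  have hS : ∀ k i, (fun q : ℝ × Pt => (T.rescale (expFactor φ q.1)).vec k q.2 i)
      = fun q => ((Real.exp (q.1 * φ q.2 * (-1 / 2)) : ℝ) : ℂ) * T.vec k q.2 i := fun k i => by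
    funext q; rw [Tetrad.vec_rescale, expFactor_inv]
  have s1 := smoothSlice_exp hU hφ 1
  have s2 := (smoothSlice_exp hU hφ (-1 / 2)).ofReal
  have sv := fun k i => SmoothSlice.of_static hU (hT.smooth_vec k i)
  refine
    { isOpen := hU
      smooth := fun a b => ?_
      symm := fun t x hx a b => ?_
      det := fun t x hx => ?_
      smooth_field := hξ
      smooth_factor := contDiffOn_const
      variation := fun x hx a b => ?_
      smooth_vec := fun k i => ?_
      drag_vec := fun k x hx => ?_ }
  · rw [hG]; exact s1.mul (v0.smooth a b)
  · simp [rescaleMetric, hg.symm x hx a b]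
  · simp only [rescaleMetric, Matrix.det_smul]
    exact mul_ne_zero (pow_ne_zero _ (pow_ne_zero _ (Real.exp_ne_zero _))) (hg.det_ne_zero hx)
  · rw [hG, flowDefect_mul s1 (v0.smooth a b) hx, flowDefect_exp hU hφ 1 hx, v0.variation x hx]
    have hz : ∀ a b, rescaleMetric (expFactor φ (0 : ℝ)) g x a b = g x a b := fun a b => by
      simp [rescaleMetric, expFactor]
    simp only [hz, constFamily, zero_mul, Real.exp_zero]
    ring
  · rw [hS]; exact s2.mul (sv k i)
  · funext i
    have h0 := congrFun (hd k x hx) i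
    have hz : (T.rescale (expFactor φ (0 : ℝ))).vec k x = T.vec k x := by
      funext i; simp [Tetrad.vec_rescale, expFactor]
    simp only [dragVec] at h0 ⊢
    rw [hS, flowDefect_mul s2 (sv k i) hx, flowDefect_ofReal (smoothSlice_exp hU hφ _) hx,
      flowDefect_exp hU hφ _ hx]
    simp only [hz, Pi.zero_apply, zero_mul, Real.exp_zero]
    push_cast
    linear_combination h0

lemma lieScalar_eq (ξ : Pt → Fin 4 → ℝ) (η : Pt → ℂ) (x : Pt) :
    lieScalar ξ η x = ∑ j, ξ x j • pd j η x := by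
  simp [lieScalar, dirDeriv]

/-- Combinations with a weight are Lie recurrent: their variation under the rescalings
`exp (t φ / 2)` is prescribed by the weight, and it is also their derivative along `ξ`. -/
lemma isLieRecurrent_of_hasWeight (hU : IsOpen U) (hg : IsLorentzMetricOn g U)
    (hT : T.IsNullOn g U) (hξ : ContDiffOn ℝ ∞ ξ U) (hφ : ContDiffOn ℝ ∞ φ U)
    (hk : IsConformalKilling U g ξ φ)
    (hd : ∀ k, ∀ x ∈ U, dragVec ξ (fun q => T.vec k q.2) x = fun i => (φ x : ℂ) / 2 * T.vec k x i)
    {admissible : (Pt → ℝ) → Set Pt → Prop} {e : NPComb} {w : ℝ} (he : e.DefinedOn g T U)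
    (hadm : ∀ t V, V ⊆ U → admissible (expFactor φ t) V)
    (hw : HasWeight admissible U g T e w) :
    IsLieRecurrent U ξ φ w (e.eval g T) := by
  intro x hx
  have h := isDragged_rescale hU hg hT hξ hφ hk hd
  have hg0 : member (fun q : ℝ × Pt => rescaleMetric (expFactor φ q.1) g q.2) 0 = g := by
    funext y; simp [member, rescaleMetric, expFactor]
  have hT0 : T.rescale (expFactor φ 0) = T := by
    cases T; simp [Tetrad.rescale, expFactor]
  have he0 : e.DefinedOn (member (fun q : ℝ × Pt => rescaleMetric (expFactor φ q.1) g q.2) 0)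
      (T.rescale (expFactor φ 0)) U := by rwa [hg0, hT0]
  obtain ⟨hs, hi⟩ := h.isInvariant_eval e he0
  have hi := hi x hx
  rw [flowDefect_eq_deriv_sub hs hx] at hi
  obtain ⟨V, hV, hxV, hVU, hdef⟩ := h.eventually_definedOn e he0 hx
  have hev : (fun t : ℝ => e.eval (rescaleMetric (expFactor φ t) g) (T.rescale (expFactor φ t)) x)
      =ᶠ[𝓝 0] fun t => ((Real.exp (t * φ x * (1 / 2) * w) : ℝ) : ℂ) * e.eval g T x := by
    filter_upwards [hdef] with t ht
    have hsm : ContDiffOn ℝ ∞ (expFactor φ t) V :=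
      Real.contDiff_exp.comp_contDiffOn
        ((contDiffOn_const.mul (hφ.mono hVU)).mul contDiffOn_const)
    rw [hw V hV hVU (expFactor φ t) hsm (fun _ _ => Real.exp_pos _) (hadm t V hVU) ht x hxV,
      expFactor, Real.exp_mul (t * φ x * (1 / 2)) w]
  have hder : deriv (fun t : ℝ => ((Real.exp (t * φ x * (1 / 2) * w) : ℝ) : ℂ) * e.eval g T x) 0
      = (w : ℂ) * ((φ x : ℂ) / 2) * e.eval g T x := by
    have h1 : HasDerivAt (fun t : ℝ => Real.exp (t * φ x * (1 / 2) * w))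
        (Real.exp (0 * φ x * (1 / 2) * w) * (1 * φ x * (1 / 2) * w)) 0 :=
      ((((hasDerivAt_id (0 : ℝ)).mul_const (φ x)).mul_const (1 / 2)).mul_const w).exp
    rw [(h1.ofReal_comp.mul_const (e.eval g T x)).deriv]
    simp only [zero_mul, Real.exp_zero]
    push_cast
    ring
  have hsum : (fun y => e.eval (rescaleMetric (expFactor φ (0 : ℝ)) g)
      (T.rescale (expFactor φ 0)) y) = e.eval g T := by
    have : rescaleMetric (expFactor φ (0 : ℝ)) g = g := hg0
    rw [this, hT0]
  have e1 : deriv (fun t : ℝ => e.eval (rescaleMetric (expFactor φ t) g)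
      (T.rescale (expFactor φ t)) x) 0 = _ := hev.deriv_eq.trans hder
  rw [lieScalar_eq, ← e1, ← hsum]
  exact (sub_eq_zero.1 hi).symm

end Commutator

/-! ### Algebra of null tetrads and of the Weyl tensor at a point -/

section PointAlgebra

variable {U : Set Pt} {g : MetricField} {x : Pt}

lemma gDot_comm (hg : IsLorentzMetricOn g U) (hx : x ∈ U) (v w : Fin 4 → ℂ) :
    gDot g x v w = gDot g x w v := by
  unfold gDot
  rw [Finset.sum_comm]
  exact Finset.sum_congr rfl fun a _ => Finset.sum_congr rfl fun b _ => by
    rw [hg.symm x hx b a]; ring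

lemma gDot_conj (v w : Fin 4 → ℂ) :
    gDot g x (fun i => (starRingEnd ℂ) (v i)) (fun i => (starRingEnd ℂ) (w i))
      = (starRingEnd ℂ) (gDot g x v w) := by
  simp [gDot]

/-- The vectors `l, n, m, k` have the inner products of a normalized null tetrad. -/
structure IsNullBasis (g : MetricField) (x : Pt) (l n m k : Fin 4 → ℂ) : Prop where
  comm : ∀ v w, gDot g x v w = gDot g x w v
  ll : gDot g x l l = 0
  nn : gDot g x n n = 0
  mm : gDot g x m m = 0
  kk : gDot g x k k = 0
  ln : gDot g x l n = 1
  m_k : gDot g x m k = -1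
  lm : gDot g x l m = 0
  lk : gDot g x l k = 0
  nm : gDot g x n m = 0
  nk : gDot g x n k = 0

lemma Tetrad.IsNullOn.isNullBasis {T : Tetrad} (hg : IsLorentzMetricOn g U) (hT : T.IsNullOn g U)
    (hx : x ∈ U) :
    IsNullBasis g x (T.vec .l x) (T.vec .n x) (T.vec .m x) (T.vec .mbar x) := by
  have hl : (fun i => (starRingEnd ℂ) (T.vec .l x i)) = T.vec .l x := by
    funext i; simp [Tetrad.vec]
  have hn : (fun i => (starRingEnd ℂ) (T.vec .n x i)) = T.vec .n x := by
    funext i; simp [Tetrad.vec]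
  have hm : (fun i => (starRingEnd ℂ) (T.vec .m x i)) = T.vec .mbar x := rfl
  refine ⟨gDot_comm hg hx, hT.ll x hx, hT.nn x hx, hT.mm x hx, ?_, hT.ln x hx, hT.m_mbar x hx,
    hT.lm x hx, ?_, hT.nm x hx, ?_⟩
  · rw [← hm, gDot_conj, hT.mm x hx, map_zero]
  · have := gDot_conj (g := g) (x := x) (T.vec .l x) (T.vec .m x)
    rwa [hl, hm, hT.lm x hx, map_zero] at this
  · have := gDot_conj (g := g) (x := x) (T.vec .n x) (T.vec .m x)
    rwa [hn, hm, hT.nm x hx, map_zero] at this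

/-- The Gram matrix of a normalized null tetrad. -/
def nullGram : Matrix (Fin 4) (Fin 4) ℂ := !![0, 1, 0, 0; 1, 0, 0, 0; 0, 0, 0, -1; 0, 0, -1, 0]

lemma nullGram_mul_self : nullGram * nullGram = 1 := by
  ext i j
  fin_cases i <;> fin_cases j <;> simp [nullGram, Matrix.mul_apply, Fin.sum_univ_four]

namespace IsNullBasis

variable {l n m k : Fin 4 → ℂ}

/-- The inverse metric is `l n + n l - m k - k m`, in matrix form. -/
lemma frame_inverse (h : IsNullBasis g x l n m k) :
    ((Matrix.of ![l, n, m, k]).transpose * nullGram * Matrix.of ![l, n, m, k])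
      * (g x).map Complex.ofReal = 1 := by
  have h1 : Matrix.of ![l, n, m, k] * (g x).map Complex.ofReal
      * (Matrix.of ![l, n, m, k]).transpose = nullGram := by
    have key : ∀ i j, (Matrix.of ![l, n, m, k] * (g x).map Complex.ofReal
        * (Matrix.of ![l, n, m, k]).transpose) i j
        = gDot g x ((![l, n, m, k] : Fin 4 → Fin 4 → ℂ) i)
          ((![l, n, m, k] : Fin 4 → Fin 4 → ℂ) j) := fun i j => by
      simp only [Matrix.mul_apply, gDot, Finset.sum_mul, Matrix.transpose_apply, Matrix.map_apply,
        Matrix.of_apply]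
      rw [Finset.sum_comm]
      exact Finset.sum_congr rfl fun a _ => Finset.sum_congr rfl fun b _ => by ring
    ext i j
    rw [key]
    fin_cases i <;> fin_cases j <;>
      simp [nullGram, h.ll, h.nn, h.mm, h.kk, h.ln, h.m_k, h.lm, h.lk, h.nm, h.nk, h.comm n l,
        h.comm k m, h.comm m l, h.comm k l, h.comm m n, h.comm k n]
  have h2 : (nullGram * Matrix.of ![l, n, m, k] * (g x).map Complex.ofReal)
      * (Matrix.of ![l, n, m, k]).transpose = 1 := by
    rw [Matrix.mul_assoc nullGram, Matrix.mul_assoc nullGram, h1, nullGram_mul_self]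
  rw [mul_eq_one_comm] at h2
  simpa only [Matrix.mul_assoc] using h2

lemma expansion (h : IsNullBasis g x l n m k) (v : Fin 4 → ℂ) :
    v = gDot g x v n • l + gDot g x v l • n + (-gDot g x v k) • m + (-gDot g x v m) • k := by
  have h1 := congrArg (fun M : Matrix (Fin 4) (Fin 4) ℂ => M.mulVec v) h.frame_inverse
  simp only [Matrix.one_mulVec] at h1
  have h2 : ∀ w, gDot g x v w = ∑ a, w a * ((g x).map Complex.ofReal).mulVec v a := fun w => by
    rw [h.comm, gDot]
    simp only [Matrix.mulVec, dotProduct, Finset.mul_sum, Matrix.map_apply]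
    exact Finset.sum_congr rfl fun a _ => Finset.sum_congr rfl fun b _ => by ring
  funext i
  conv_lhs => rw [← h1]
  simp only [h2, ← Matrix.mulVec_mulVec]
  simp only [Matrix.mulVec, dotProduct, Fin.sum_univ_four, nullGram]
  simp
  ring

lemma gInv_eq (h : IsNullBasis g x l n m k) (hd : (g x).det ≠ 0) (a c : Fin 4) :
    (gInv g x a c : ℂ) = l a * n c + n a * l c - m a * k c - k a * m c := by
  have h1 : (g x).map Complex.ofReal * ((g x)⁻¹).map Complex.ofReal = 1 := by
    have := congrArg (fun M : Matrix (Fin 4) (Fin 4) ℝ => M.map Complex.ofRealHom)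
      (Matrix.mul_nonsing_inv (g x) hd.isUnit)
    simp only [Matrix.map_mul] at this
    refine this.trans ?_
    exact Matrix.map_one _ (map_zero _) (map_one _)
  have h2 : ((g x)⁻¹).map Complex.ofReal
      = (Matrix.of ![l, n, m, k]).transpose * nullGram * Matrix.of ![l, n, m, k] := by
    rw [← Matrix.mul_one (_ * nullGram * _), ← h1, ← Matrix.mul_assoc, h.frame_inverse,
      Matrix.one_mul]
  have h3 := congrFun (congrFun h2 a) c
  refine (show (gInv g x a c : ℂ) = _ from h3).trans ?_
  simp [Matrix.mul_apply, Fin.sum_univ_four, nullGram]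
  ring

end IsNullBasis

/-- Linearity and symmetries of the complexified Weyl tensor at a point, with its trace expressed
through a null basis. -/
structure IsWeylForm (C : (Fin 4 → ℂ) → (Fin 4 → ℂ) → (Fin 4 → ℂ) → (Fin 4 → ℂ) → ℂ)
    (l n m k : Fin 4 → ℂ) : Prop where
  lin : ∀ (p q r s : ℂ) (w y z : Fin 4 → ℂ), C (p • l + q • n + r • m + s • k) w y z
    = p * C l w y z + q * C n w y z + r * C m w y z + s * C k w y z
  anti_left : ∀ v w y z, C v w y z = -C w v y z
  anti_right : ∀ v w y z, C v w y z = -C v w z y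
  bianchi : ∀ v w y z, C v w y z + C v y z w + C v z w y = 0
  trace : ∀ w z, C l w n z + C n w l z - C m w k z - C k w m z = 0

lemma sum_rotate {f : Fin 4 → Fin 4 → Fin 4 → ℂ} :
    ∑ b, ∑ c, ∑ d, f b c d = ∑ b, ∑ c, ∑ d, f c d b := by
  conv_rhs => rw [Finset.sum_comm]
  exact Finset.sum_congr rfl fun b _ => Finset.sum_comm

lemma sum_pair_comm {f : Fin 4 → Fin 4 → Fin 4 → Fin 4 → ℂ} :
    ∑ a, ∑ c, ∑ b, ∑ d, f a c b d = ∑ b, ∑ d, ∑ a, ∑ c, f a c b d := by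
  calc ∑ a, ∑ c, ∑ b, ∑ d, f a c b d = ∑ a, ∑ b, ∑ c, ∑ d, f a c b d :=
        Finset.sum_congr rfl fun a _ => Finset.sum_comm
    _ = ∑ b, ∑ a, ∑ c, ∑ d, f a c b d := Finset.sum_comm
    _ = ∑ b, ∑ a, ∑ d, ∑ c, f a c b d :=
        Finset.sum_congr rfl fun b _ => Finset.sum_congr rfl fun a _ => Finset.sum_comm
    _ = ∑ b, ∑ d, ∑ a, ∑ c, f a c b d := Finset.sum_congr rfl fun b _ => Finset.sum_comm

lemma isWeylForm_weylC (hU : IsOpen U) (hg : IsLorentzMetricOn g U) (hx : x ∈ U)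
    {l n m k : Fin 4 → ℂ} (h : IsNullBasis g x l n m k) : IsWeylForm (weylC g x) l n m k := by
  have hG := hg.isMetricFamily hU
  refine ⟨fun p q r s w y z => ?_, fun v w y z => ?_, fun v w y z => ?_, fun v w y z => ?_,
    fun w z => ?_⟩
  · simp only [weylC, Finset.mul_sum, ← Finset.sum_add_distrib]
    refine Finset.sum_congr rfl fun a _ => Finset.sum_congr rfl fun b _ =>
      Finset.sum_congr rfl fun c _ => Finset.sum_congr rfl fun d _ => ?_
    simp only [Pi.add_apply, Pi.smul_apply, smul_eq_mul]
    ring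
  · unfold weylC
    rw [Finset.sum_comm]
    simp only [← Finset.sum_neg_distrib]
    refine Finset.sum_congr rfl fun a _ => Finset.sum_congr rfl fun b _ =>
      Finset.sum_congr rfl fun c _ => Finset.sum_congr rfl fun d _ => ?_
    have := hG.weyl_antisymm_left hx b a c d
    rw [show weyl g b a c d x = -weyl g a b c d x from this]
    push_cast; ring
  · unfold weylC
    simp only [← Finset.sum_neg_distrib]
    refine Finset.sum_congr rfl fun a _ => Finset.sum_congr rfl fun b _ => ?_
    rw [Finset.sum_comm]
    refine Finset.sum_congr rfl fun c _ => Finset.sum_congr rfl fun d _ => ?_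
    rw [weyl_antisymm_right g a b d c]
    push_cast; ring
  · have e1 : weylC g x v y z w = ∑ a, ∑ b, ∑ c, ∑ d,
        (weyl g a c d b x : ℂ) * v a * w b * y c * z d := by
      refine Finset.sum_congr rfl fun a _ => sum_rotate.trans ?_
      exact Finset.sum_congr rfl fun b _ => Finset.sum_congr rfl fun c _ =>
        Finset.sum_congr rfl fun d _ => by ring
    have e2 : weylC g x v z w y = ∑ a, ∑ b, ∑ c, ∑ d,
        (weyl g a d b c x : ℂ) * v a * w b * y c * z d := by
      refine Finset.sum_congr rfl fun a _ => (sum_rotate.trans sum_rotate).trans ?_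
      exact Finset.sum_congr rfl fun b _ => Finset.sum_congr rfl fun c _ =>
        Finset.sum_congr rfl fun d _ => by ring
    rw [e1, e2, weylC]
    simp only [← Finset.sum_add_distrib]
    refine Finset.sum_eq_zero fun a _ => Finset.sum_eq_zero fun b _ => Finset.sum_eq_zero
      fun c _ => Finset.sum_eq_zero fun d _ => ?_
    have := congrArg Complex.ofReal (hG.weyl_bianchi hx a b c d)
    push_cast at this
    linear_combination (v a * w b * y c * z d) * this
  · have e0 : ∀ v y : Fin 4 → ℂ, weylC g x v w y z
        = ∑ a, ∑ c, v a * y c * ∑ b, ∑ d, (weyl g a b c d x : ℂ) * w b * z d := fun v y => by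
      refine Finset.sum_congr rfl fun a _ => ?_
      rw [Finset.sum_comm]
      refine Finset.sum_congr rfl fun c _ => ?_
      simp only [Finset.mul_sum]
      exact Finset.sum_congr rfl fun b _ => Finset.sum_congr rfl fun d _ => by ring
    have e1 : weylC g x l w n z + weylC g x n w l z - weylC g x m w k z - weylC g x k w m z
        = ∑ a, ∑ c, (gInv g x a c : ℂ) * ∑ b, ∑ d, (weyl g a b c d x : ℂ) * w b * z d := by
      simp only [e0, ← Finset.sum_add_distrib, ← Finset.sum_sub_distrib,
        h.gInv_eq (hg.det_ne_zero hx)]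
      exact Finset.sum_congr rfl fun a _ => Finset.sum_congr rfl fun c _ => by ring
    rw [e1]
    have e2 : ∀ b d, ∑ a, ∑ c, (gInv g x a c : ℂ) * (weyl g a b c d x : ℂ) = 0 := fun b d => by
      have := congrArg Complex.ofReal (hG.weyl_trace hx b d)
      push_cast at this
      exact this
    have e3 : ∀ a c, (gInv g x a c : ℂ) * ∑ b, ∑ d, (weyl g a b c d x : ℂ) * w b * z d
        = ∑ b, ∑ d, w b * z d * ((gInv g x a c : ℂ) * (weyl g a b c d x : ℂ)) := fun a c => by
      simp only [Finset.mul_sum]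
      exact Finset.sum_congr rfl fun b _ => Finset.sum_congr rfl fun d _ => by ring
    simp only [e3]
    calc ∑ a, ∑ c, ∑ b, ∑ d, w b * z d * ((gInv g x a c : ℂ) * (weyl g a b c d x : ℂ))
        = ∑ b, ∑ d, w b * z d * ∑ a, ∑ c, (gInv g x a c : ℂ) * (weyl g a b c d x : ℂ) := by
          simp only [Finset.mul_sum]
          rw [sum_pair_comm]
      _ = 0 := by simp [e2]

end PointAlgebra

/-! ### Infinitesimal rigidity of the tetrad -/

section Rigidity

namespace IsWeylForm

variable {C : (Fin 4 → ℂ) → (Fin 4 → ℂ) → (Fin 4 → ℂ) → (Fin 4 → ℂ) → ℂ} {l n m k : Fin 4 → ℂ}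

lemma pair (h : IsWeylForm C l n m k) (v w y z : Fin 4 → ℂ) : C v w y z = C y z v w := by
  have L := h.anti_left
  have R := h.anti_right
  have Z := h.bianchi
  linear_combination (1 / 2) * (Z v w y z - Z w y z v - Z y z v w + Z z v w y
    + L v w y z - L y z v w - R v y z w + L v y w z - L v z w y + L w y z v - R z w y v
    + L z w v y)

lemma lin_two (h : IsWeylForm C l n m k) (p q r s : ℂ) (v y z : Fin 4 → ℂ) :
    C v (p • l + q • n + r • m + s • k) y z
      = p * C v l y z + q * C v n y z + r * C v m y z + s * C v k y z := by
  rw [h.anti_left, h.lin, h.anti_left v l, h.anti_left v n, h.anti_left v m, h.anti_left v k]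
  ring

lemma lin_three (h : IsWeylForm C l n m k) (p q r s : ℂ) (v w z : Fin 4 → ℂ) :
    C v w (p • l + q • n + r • m + s • k) z
      = p * C v w l z + q * C v w n z + r * C v w m z + s * C v w k z := by
  rw [h.pair, h.lin, h.pair v w l, h.pair v w n, h.pair v w m, h.pair v w k]

lemma lin_four (h : IsWeylForm C l n m k) (p q r s : ℂ) (v w y : Fin 4 → ℂ) :
    C v w y (p • l + q • n + r • m + s • k)
      = p * C v w y l + q * C v w y n + r * C v w y m + s * C v w y k := by
  rw [h.pair, h.lin_two, h.pair v w y l, h.pair v w y n, h.pair v w y m, h.pair v w y k]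

lemma self_left (h : IsWeylForm C l n m k) (v y z : Fin 4 → ℂ) : C v v y z = 0 := by
  linear_combination (1 / 2) * h.anti_left v v y z

lemma self_right (h : IsWeylForm C l n m k) (v w y : Fin 4 → ℂ) : C v w y y = 0 := by
  linear_combination (1 / 2) * h.anti_right v w y y

/-- `C(l, n, k, m)` in terms of the two components `C(l, m, k, n)` and `C(l, k, m, n)`; for a null
tetrad these are `-Ψ₂` and its conjugate. -/
lemma component_lnkm (h : IsWeylForm C l n m k) : C l n k m = -C l k m n + C l m k n := by
  linear_combination h.bianchi l n k m - h.anti_right l m n k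

lemma component_lnln (h : IsWeylForm C l n m k) : C l n l n = C l m k n + C l k m n := by
  linear_combination h.anti_right l n n l - h.trace n l + h.self_left n l l - h.pair m n k l
    - h.anti_left k l m n - h.pair k n m l - h.anti_left m l k n

/-- If the infinitesimal motion of the tetrad fixes `Ψ₁ = 0`, it contains no null rotation about
`n`. -/
lemma rotation_about_n (h : IsWeylForm C l n m k) {dl dn dm : Fin 4 → ℂ}
    {a a₁ b b₁ b₂ p p' c c' : ℂ}
    (hl : dl = a • l + (0 : ℂ) • n + (-p') • m + (-p) • k)
    (hn : dn = (0 : ℂ) • l + a₁ • n + (-c') • m + (-c) • k)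
    (hm : dm = b₁ • l + (-p) • n + b • m + b₂ • k) (hb : b₂ = 0)
    (h0 : C l m l m = 0) (h1 : C l n l m = 0) (h2 : C l m k n ≠ 0)
    (hd : C dl n l m + C l dn l m + C l n dl m + C l n l dm = 0) : p = 0 := by
  have e1 : C m n l m = 0 := by
    linear_combination h.anti_left m n l m - (1 / 2) * h.trace m m - (1 / 2) * h.self_left m k m
      - (1 / 2) * h.self_right k m m + (1 / 2) * h.pair l m n m
  have e2 : C k n l m = C l m k n := h.pair _ _ _ _
  have e3 : C l k l m = 0 := by
    linear_combination h.anti_right l k m l - h.anti_left k l m l - (1 / 2) * h.trace l l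
      + (1 / 2) * h.self_left l n l + (1 / 2) * h.self_right n l l - (1 / 2) * h.pair m l k l
  have e4 := h.component_lnkm
  have e5 := h.component_lnln
  rw [hl, hn, hm, hb] at hd
  simp only [h.lin, h.lin_two, h.lin_three, h.lin_four, e1, e2, e3, e4, e5, h0, h1, h.self_left,
    h.self_right] at hd
  have h3 : p * C l m k n = 0 := by linear_combination (-1 / 3) * hd
  exact (mul_eq_zero.1 h3).resolve_right h2

/-- If the infinitesimal motion of the tetrad fixes `Ψ₃ = 0` and contains no null rotation about
`n`, it contains no null rotation about `l` either. -/
lemma rotation_about_l (h : IsWeylForm C l n m k) {dl dn dk : Fin 4 → ℂ}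
    {a a₁ b₃ c c' : ℂ}
    (hl : dl = a • l + (0 : ℂ) • n + (0 : ℂ) • m + (0 : ℂ) • k)
    (hn : dn = (0 : ℂ) • l + a₁ • n + (-c') • m + (-c) • k)
    (hk : dk = (-c') • l + (0 : ℂ) • n + (0 : ℂ) • m + b₃ • k)
    (h2 : C l m k n ≠ 0) (h3 : C l n k n = 0)
    (hd : C dl n k n + C l dn k n + C l n dk n + C l n k dn = 0) : c' = 0 := by
  have e3 : C l k k n = 0 := by
    linear_combination h.anti_right l k n k - (1 / 2) * h.trace k k - (1 / 2) * h.self_right m k k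
      - (1 / 2) * h.self_left k m k + (1 / 2) * h.pair n k l k
  have e4 := h.component_lnkm
  have e5 := h.component_lnln
  rw [hl, hn, hk] at hd
  simp only [h.lin, h.lin_two, h.lin_three, h.lin_four, e3, e4, e5, h3, h.self_right] at hd
  have h4 : c' * C l m k n = 0 := by linear_combination (-1 / 3) * hd
  exact (mul_eq_zero.1 h4).resolve_right h2

end IsWeylForm
section Field

variable {U : Set Pt} {g : MetricField} {ξ : Pt → Fin 4 → ℝ} {φ : Pt → ℝ} {T : Tetrad} {x : Pt}

lemma dragVec_conj {v : ℝ × Pt → Fin 4 → ℂ} (hv : ∀ a, SmoothSlice U (fun q => v q a))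
    (hx : x ∈ U) :
    dragVec ξ (fun q i => (starRingEnd ℂ) (v q i)) x
      = fun i => (starRingEnd ℂ) (dragVec ξ v x i) := by
  funext i
  have h1 : HasFDerivAt (fun q : ℝ × Pt => (starRingEnd ℂ) (v q i)) _ ((0 : ℝ), x) :=
    HasFDerivAt.comp ((0 : ℝ), x) (Complex.conjCLE.toContinuousLinearMap.hasFDerivAt)
      ((hv i).differentiableAt hx).hasFDerivAt
  simp [dragVec, flowDefect, h1.fderiv]

/-- The part of the rigidity argument that does not depend on the scaling of the tetrad: along a
conformal Killing vector, a tetrad with `Ψ₀ = Ψ₁ = Ψ₃ = 0 ≠ Ψ₂` changes only by its conformal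
rescaling and a spin-boost. Here `a` and `b` are the coefficients of `-£_ξ l`
and `-£_ξ m`. -/
lemma exists_spinBoost (hU : IsOpen U) (hg : IsLorentzMetricOn g U) (hT : T.IsNullOn g U)
    (hξ : ContDiffOn ℝ ∞ ξ U) (hφ : ContDiffOn ℝ ∞ φ U) (hk : IsConformalKilling U g ξ φ)
    (h0 : ∀ x ∈ U, psi g T 0 x = 0) (h1 : ∀ x ∈ U, psi g T 1 x = 0)
    (h2 : ∀ x ∈ U, psi g T 2 x ≠ 0) (h3 : ∀ x ∈ U, psi g T 3 x = 0) (hx : x ∈ U) :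
    ∃ a b : ℂ, (starRingEnd ℂ) a = a ∧ (starRingEnd ℂ) b = φ x - b ∧
      dragVec ξ (fun q => T.vec .l q.2) x = a • T.vec .l x ∧
      dragVec ξ (fun q => T.vec .n q.2) x = (φ x - a) • T.vec .n x ∧
      dragVec ξ (fun q => T.vec .m q.2) x = b • T.vec .m x ∧
      dragVec ξ (fun q => T.vec .mbar q.2) x = (φ x - b) • T.vec .mbar x := by
  have v0 := hk.isConformalVariation hU hg hξ hφ
  have sv := fun j i => SmoothSlice.of_static hU (hT.smooth_vec j i)
  have hB := hT.isNullBasis hg hx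
  have hW := isWeylForm_weylC hU hg hx hB
  have hbasis : ∀ i j : Leg, ∀ c : ℂ, (∀ y ∈ U, gDot g y (T.vec i y) (T.vec j y) = c) →
      gDot g x (dragVec ξ (fun q => T.vec i q.2) x) (T.vec j x)
        + gDot g x (T.vec i x) (dragVec ξ (fun q => T.vec j q.2) x) = φ x * c := fun i j c hc => by
    have e1 := v0.gDot_variation (sv i) (sv j) hx
    have e2 : flowDefect ξ (fun q => gDot (member (constFamily g) q.1) q.2 (T.vec i q.2)
        (T.vec j q.2)) x = 0 := by
      rw [flowDefect_congr (g := fun _ => c) ((v0.eventually_mem hx).mono fun q hq => hc q.2 hq),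
        flowDefect_const]
    rw [e2] at e1
    have e3 := hc x hx
    push_cast at e1
    change 0 = -(φ x : ℂ) * gDot g x (T.vec i x) (T.vec j x)
      + gDot g x (dragVec ξ (fun q => T.vec i q.2) x) (T.vec j x)
      + gDot g x (T.vec i x) (dragVec ξ (fun q => T.vec j q.2) x) at e1
    rw [e3] at e1
    linear_combination -e1
  have hweyl : ∀ i j p q : Leg, (∀ y ∈ U, weylC g y (T.vec i y) (T.vec j y) (T.vec p y)
      (T.vec q y) = 0) →
      weylC g x (dragVec ξ (fun q => T.vec i q.2) x) (T.vec j x) (T.vec p x) (T.vec q x)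
      + weylC g x (T.vec i x) (dragVec ξ (fun q => T.vec j q.2) x) (T.vec p x) (T.vec q x)
      + weylC g x (T.vec i x) (T.vec j x) (dragVec ξ (fun q => T.vec p q.2) x) (T.vec q x)
      + weylC g x (T.vec i x) (T.vec j x) (T.vec p x) (dragVec ξ (fun r => T.vec q r.2) x)
      = 0 := fun i j p q hc => by
    have e1 := v0.weylC_variation (sv i) (sv j) (sv p) (sv q) hx
    have e2 : flowDefect ξ (fun r => weylC (member (constFamily g) r.1) r.2 (T.vec i r.2)
        (T.vec j r.2) (T.vec p r.2) (T.vec q r.2)) x = 0 := by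
      rw [flowDefect_congr (g := fun _ => 0) ((v0.eventually_mem hx).mono fun q hq => hc q.2 hq),
        flowDefect_const]
    have e3 : weylC (member (constFamily g) 0) x (T.vec i x) (T.vec j x) (T.vec p x) (T.vec q x)
      = 0 := hc x hx
    rw [e2, e3, mul_zero, zero_add] at e1
    exact e1.symm
  have rn : (fun i => (starRingEnd ℂ) (T.vec .n x i)) = T.vec .n x := by
    funext i; simp [Tetrad.vec]
  have rm : (fun i => (starRingEnd ℂ) (T.vec .m x i)) = T.vec .mbar x := rfl
  have cl : (fun i => (starRingEnd ℂ) (dragVec ξ (fun q => T.vec .l q.2) x i))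
      = dragVec ξ (fun q => T.vec .l q.2) x := by
    rw [← dragVec_conj (sv .l) hx]; congr 1; funext q i; simp [Tetrad.vec]
  have cn : (fun i => (starRingEnd ℂ) (dragVec ξ (fun q => T.vec .n q.2) x i))
      = dragVec ξ (fun q => T.vec .n q.2) x := by
    rw [← dragVec_conj (sv .n) hx]; congr 1; funext q i; simp [Tetrad.vec]
  have cm : (fun i => (starRingEnd ℂ) (dragVec ξ (fun q => T.vec .m q.2) x i))
      = dragVec ξ (fun q => T.vec .mbar q.2) x := (dragVec_conj (sv .m) hx).symm
  have bas := fun y hy => hT.isNullBasis hg (x := y) hy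
  have b_ll := hbasis .l .l 0 fun y hy => (bas y hy).ll
  have b_nn := hbasis .n .n 0 fun y hy => (bas y hy).nn
  have b_mm := hbasis .m .m 0 fun y hy => (bas y hy).mm
  have b_kk := hbasis .mbar .mbar 0 fun y hy => (bas y hy).kk
  have b_ln := hbasis .l .n 1 fun y hy => (bas y hy).ln
  have b_mk := hbasis .m .mbar (-1) fun y hy => (bas y hy).m_k
  have b_lm := hbasis .l .m 0 fun y hy => (bas y hy).lm
  have b_lk := hbasis .l .mbar 0 fun y hy => (bas y hy).lk
  have b_nm := hbasis .n .m 0 fun y hy => (bas y hy).nm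
  have b_nk := hbasis .n .mbar 0 fun y hy => (bas y hy).nk
  have w1 := hweyl .l .n .l .m fun y hy => neg_eq_zero.1 (h1 y hy)
  have w3 := hweyl .l .n .mbar .n fun y hy => neg_eq_zero.1 (h3 y hy)
  have p0 : weylC g x (T.vec .l x) (T.vec .m x) (T.vec .l x) (T.vec .m x) = 0 :=
    neg_eq_zero.1 (h0 x hx)
  have p1 : weylC g x (T.vec .l x) (T.vec .n x) (T.vec .l x) (T.vec .m x) = 0 :=
    neg_eq_zero.1 (h1 x hx)
  have p2 : weylC g x (T.vec .l x) (T.vec .m x) (T.vec .mbar x) (T.vec .n x) ≠ 0 :=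
    neg_ne_zero.1 (h2 x hx)
  have p3 : weylC g x (T.vec .l x) (T.vec .n x) (T.vec .mbar x) (T.vec .n x) = 0 :=
    neg_eq_zero.1 (h3 x hx)
  have conj_lm := gDot_conj (g := g) (x := x) (dragVec ξ (fun q => T.vec .l q.2) x) (T.vec .m x)
  have conj_ln := gDot_conj (g := g) (x := x) (dragVec ξ (fun q => T.vec .l q.2) x) (T.vec .n x)
  have conj_nm := gDot_conj (g := g) (x := x) (dragVec ξ (fun q => T.vec .n q.2) x) (T.vec .m x)
  have conj_mk := gDot_conj (g := g) (x := x) (dragVec ξ (fun q => T.vec .m q.2) x) (T.vec .mbar x)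
  have rk : (fun i => (starRingEnd ℂ) (T.vec .mbar x i)) = T.vec .m x := by
    funext i; simp [Tetrad.vec]
  rw [cl, rm] at conj_lm
  rw [cl, rn] at conj_ln
  rw [cn, rm] at conj_nm
  rw [cm, rk] at conj_mk
  generalize dragVec ξ (fun q => T.vec .l q.2) x = dl at *
  generalize dragVec ξ (fun q => T.vec .n q.2) x = dn at *
  generalize dragVec ξ (fun q => T.vec .m q.2) x = dm at *
  generalize dragVec ξ (fun q => T.vec .mbar q.2) x = dk at *
  have x_l := hB.expansion dl
  have x_n := hB.expansion dn
  have x_m := hB.expansion dm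
  have x_k := hB.expansion dk
  generalize T.vec .l x = l at *
  generalize T.vec .n x = n at *
  generalize T.vec .m x = m at *
  generalize T.vec .mbar x = k at *
  have e_ll : gDot g x dl l = 0 := by linear_combination (1 / 2) * b_ll + (1 / 2) * hB.comm dl l
  have e_nn : gDot g x dn n = 0 := by linear_combination (1 / 2) * b_nn + (1 / 2) * hB.comm dn n
  have e_mm : gDot g x dm m = 0 := by linear_combination (1 / 2) * b_mm + (1 / 2) * hB.comm dm m
  have e_kk : gDot g x dk k = 0 := by linear_combination (1 / 2) * b_kk + (1 / 2) * hB.comm dk k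
  have e_nl : gDot g x dn l = φ x - gDot g x dl n := by
    linear_combination b_ln + hB.comm dn l
  have e_km : gDot g x dk m = -φ x - gDot g x dm k := by
    linear_combination b_mk + hB.comm dk m
  have e_ml : gDot g x dm l = -gDot g x dl m := by linear_combination b_lm + hB.comm dm l
  have e_kl : gDot g x dk l = -gDot g x dl k := by linear_combination b_lk + hB.comm dk l
  have e_mn : gDot g x dm n = -gDot g x dn m := by linear_combination b_nm + hB.comm dm n
  have e_kn : gDot g x dk n = -gDot g x dn k := by linear_combination b_nk + hB.comm dk n
  rw [e_ll] at x_l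
  rw [e_nn, e_nl] at x_n
  rw [e_mm, e_ml, e_mn] at x_m
  rw [e_kk, e_kl, e_kn, e_km] at x_k
  have q1 : gDot g x dl m = 0 :=
    hW.rotation_about_n x_l x_n x_m neg_zero p0 p1 p2 w1
  -- `l` is real, so the `m` and `k` components of `dl` are conjugate.
  have q2 : gDot g x dl k = 0 := by rw [conj_lm, q1, map_zero]
  rw [q1, q2] at x_l
  rw [q1] at x_m
  rw [q2] at x_k
  simp only [neg_zero] at x_l x_m x_k
  have q3 : gDot g x dn k = 0 := hW.rotation_about_l x_l x_n x_k p2 p3 w3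
  have q4 : gDot g x dn m = 0 := by
    have := conj_nm
    rw [q3] at this
    exact (map_eq_zero _).1 this.symm
  rw [q3, q4] at x_n
  rw [q4] at x_m
  rw [q3] at x_k
  refine ⟨gDot g x dl n, -gDot g x dm k, conj_ln.symm, ?_, ?_, ?_, ?_, ?_⟩
  · rw [map_neg, ← conj_mk, e_km]; ring
  · simpa using x_l
  · simpa using x_n
  · simpa using x_m
  · rw [x_k]
    simp only [neg_zero, zero_smul, zero_add]
    congr 1; ring

lemma weylC_smul (a b c d : ℂ) (v w y z : Fin 4 → ℂ) :
    weylC g x (a • v) (b • w) (c • y) (d • z) = a * b * c * d * weylC g x v w y z := by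
  simp only [weylC, Finset.mul_sum, Pi.smul_apply, smul_eq_mul]
  exact Finset.sum_congr rfl fun i _ => Finset.sum_congr rfl fun j _ =>
    Finset.sum_congr rfl fun p _ => Finset.sum_congr rfl fun q _ => by ring

/-- Rigidity: if moreover `Ψ₄ ≠ 0` scales along `ξ` in the same way as `Ψ₂`, no spin-boost is
left. -/
lemma dragVec_eq (hU : IsOpen U) (hg : IsLorentzMetricOn g U) (hT : T.IsNullOn g U)
    (hξ : ContDiffOn ℝ ∞ ξ U) (hφ : ContDiffOn ℝ ∞ φ U) (hk : IsConformalKilling U g ξ φ)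
    (h0 : ∀ x ∈ U, psi g T 0 x = 0) (h1 : ∀ x ∈ U, psi g T 1 x = 0)
    (h2 : ∀ x ∈ U, psi g T 2 x ≠ 0) (h3 : ∀ x ∈ U, psi g T 3 x = 0)
    (h4 : ∀ x ∈ U, psi g T 4 x ≠ 0)
    (h24 : ∀ x ∈ U, flowDefect ξ (fun q => psi g T 2 q.2) x = φ x * psi g T 2 x →
      flowDefect ξ (fun q => psi g T 4 q.2) x = φ x * psi g T 4 x)
    (i : Leg) (hx : x ∈ U) :
    dragVec ξ (fun q => T.vec i q.2) x = fun j => (φ x : ℂ) / 2 * T.vec i x j := by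
  obtain ⟨a, b, ha, hb, dl, dn, dm, dk⟩ := exists_spinBoost hU hg hT hξ hφ hk h0 h1 h2 h3 hx
  have v0 := hk.isConformalVariation hU hg hξ hφ
  have sv := fun j i => SmoothSlice.of_static hU (hT.smooth_vec j i)
  have s1 := fun (a : ℂ) (v w y z : Fin 4 → ℂ) => weylC_smul (g := g) (x := x) a 1 1 1 v w y z
  have s2 := fun (a : ℂ) (v w y z : Fin 4 → ℂ) => weylC_smul (g := g) (x := x) 1 a 1 1 v w y z
  have s3 := fun (a : ℂ) (v w y z : Fin 4 → ℂ) => weylC_smul (g := g) (x := x) 1 1 a 1 v w y z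
  have s4 := fun (a : ℂ) (v w y z : Fin 4 → ℂ) => weylC_smul (g := g) (x := x) 1 1 1 a v w y z
  simp only [one_smul, one_mul, mul_one] at s1 s2 s3 s4
  have e2 : flowDefect ξ (fun q => psi g T 2 q.2) x = φ x * psi g T 2 x := by
    have e := v0.weylC_variation (sv .l) (sv .m) (sv .mbar) (sv .n) hx
    rw [dl, dn, dm, dk] at e
    change flowDefect ξ (fun q => weylC g q.2 (T.vec .l q.2) (T.vec .m q.2) (T.vec .mbar q.2)
      (T.vec .n q.2)) x = ((-φ x : ℝ) : ℂ) * weylC g x _ _ _ _ + weylC g x _ _ _ _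
      + weylC g x _ _ _ _ + weylC g x _ _ _ _ + weylC g x _ _ _ _ at e
    rw [s1, s2, s3, s4] at e
    refine (show flowDefect ξ (fun q => psi g T 2 q.2) x = _ from flowDefect_neg).trans ?_
    rw [e]
    simp only [psi]
    push_cast
    ring
  have e4 := h24 x hx e2
  have e4' : flowDefect ξ (fun q => psi g T 4 q.2) x
      = (3 * φ x - 2 * a - 2 * b) * psi g T 4 x := by
    have e := v0.weylC_variation (sv .n) (sv .mbar) (sv .n) (sv .mbar) hx
    rw [dn, dk] at e
    change flowDefect ξ (fun q => weylC g q.2 (T.vec .n q.2) (T.vec .mbar q.2) (T.vec .n q.2)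
      (T.vec .mbar q.2)) x = ((-φ x : ℝ) : ℂ) * weylC g x _ _ _ _ + weylC g x _ _ _ _
      + weylC g x _ _ _ _ + weylC g x _ _ _ _ + weylC g x _ _ _ _ at e
    rw [s1, s2, s3, s4] at e
    refine (show flowDefect ξ (fun q => psi g T 4 q.2) x = _ from flowDefect_neg).trans ?_
    rw [e]
    simp only [psi]
    push_cast
    ring
  have e5 : a + b = φ x := by
    have := mul_right_cancel₀ (h4 x hx) (e4.symm.trans e4')
    linear_combination (1 / 2) * this
  -- `a` is real and `b - φ / 2` is imaginary, so conjugation separates them.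
  have e6 : a + (φ x - b) = φ x := by
    have := congrArg (starRingEnd ℂ) e5
    rwa [map_add, ha, hb, Complex.conj_ofReal] at this
  have ea : a = φ x / 2 := by linear_combination (1 / 2) * e5 + (1 / 2) * e6
  have eb : b = φ x / 2 := by linear_combination (1 / 2) * e5 - (1 / 2) * e6
  have ec : (φ x : ℂ) - φ x / 2 = φ x / 2 := by ring
  rw [ea, ec] at dn
  rw [eb, ec] at dk
  cases i
  · rw [dl, ea]; rfl
  · rw [dn]; rfl
  · rw [dm, eb]; rfl
  · rw [dk]; rfl

end Field

end Rigidity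

/-! ### The converse: a metric is determined by its tetrad -/

section Converse

variable {U : Set Pt} {g : MetricField} {ξ : Pt → Fin 4 → ℝ} {φ : Pt → ℝ} {T : Tetrad} {x : Pt}

lemma gDot_combination_left (p q r s : ℂ) (l n m k w : Fin 4 → ℂ) :
    gDot g x (p • l + q • n + r • m + s • k) w
      = p * gDot g x l w + q * gDot g x n w + r * gDot g x m w + s * gDot g x k w := by
  simp only [gDot, Finset.mul_sum, ← Finset.sum_add_distrib]
  refine Finset.sum_congr rfl fun a _ => Finset.sum_congr rfl fun b _ => ?_
  simp only [Pi.add_apply, Pi.smul_apply, smul_eq_mul]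
  ring

lemma gDot_combination_right (p q r s : ℂ) (l n m k w : Fin 4 → ℂ) :
    gDot g x w (p • l + q • n + r • m + s • k)
      = p * gDot g x w l + q * gDot g x w n + r * gDot g x w m + s * gDot g x w k := by
  simp only [gDot, Finset.mul_sum, ← Finset.sum_add_distrib]
  refine Finset.sum_congr rfl fun a _ => Finset.sum_congr rfl fun b _ => ?_
  simp only [Pi.add_apply, Pi.smul_apply, smul_eq_mul]
  ring

/-- A two-index tensor whose tetrad components vanish is zero. -/
lemma tensor_eq_zero_of_tetrad (hg : IsLorentzMetricOn g U) (hT : T.IsNullOn g U) (hx : x ∈ U)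
    {W : MetricField} (hW : ∀ i j, gDot W x (T.vec i x) (T.vec j x) = 0) (a b : Fin 4) :
    W x a b = 0 := by
  have hB := hT.isNullBasis hg hx
  have h1 : ∀ v w : Fin 4 → ℂ, gDot W x v w = 0 := fun v w => by
    rw [hB.expansion v, hB.expansion w]
    simp only [gDot_combination_left, gDot_combination_right, hW]
    simp
  have := h1 (Pi.single a 1) (Pi.single b 1)
  simpa [gDot, Pi.single_apply] using this

/-- If the Lie derivative along `ξ` multiplies all tetrad vectors by `-φ / 2`, then it multiplies
the metric by `φ`, because the tetrad components of the metric are constant. -/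
lemma isConformalKilling_of_dragVec (hU : IsOpen U) (hg : IsLorentzMetricOn g U)
    (hT : T.IsNullOn g U)
    (hd : ∀ k, ∀ x ∈ U, dragVec ξ (fun q => T.vec k q.2) x = fun i => (φ x : ℂ) / 2 * T.vec k x i) :
    IsConformalKilling U g ξ φ := by
  intro x hx a b
  have sv := fun j i => SmoothSlice.of_static hU (hT.smooth_vec j i)
  refine sub_eq_zero.1 (tensor_eq_zero_of_tetrad hg hT hx
    (W := fun x => Matrix.of fun a b => lieMetric ξ g x a b - φ x * g x a b) (fun i j => ?_) a b)
  have e1 := flowDefect_contract_two (ξ := ξ) (S := fun a b q => g q.2 a b)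
    (L := fun a b => -lieMetric ξ g x a b)
    (fun a b => SmoothSlice.of_static hU (hg.smooth a b)) (sv i) (sv j) hx (fun a b => by
      have e := flowDefect_static (ξ := ξ) (differentiableAt_of_contDiffOn hU (hg.smooth a b) hx)
      refine (show flowDefect ξ _ x = _ from e).trans ?_
      simp only [lieMetric, jac, Fin.sum_univ_four, smul_eq_mul]
      ring)
  have hconst : ∃ c : ℂ, ∀ y ∈ U, gDot g y (T.vec i y) (T.vec j y) = c := by
    have bas := fun y hy => hT.isNullBasis hg (x := y) hy
    cases i <;> cases j
    · exact ⟨_, fun y hy => (bas y hy).ll⟩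
    · exact ⟨_, fun y hy => (bas y hy).ln⟩
    · exact ⟨_, fun y hy => (bas y hy).lm⟩
    · exact ⟨_, fun y hy => (bas y hy).lk⟩
    · exact ⟨_, fun y hy => ((bas y hy).comm _ _).trans (bas y hy).ln⟩
    · exact ⟨_, fun y hy => (bas y hy).nn⟩
    · exact ⟨_, fun y hy => (bas y hy).nm⟩
    · exact ⟨_, fun y hy => (bas y hy).nk⟩
    · exact ⟨_, fun y hy => ((bas y hy).comm _ _).trans (bas y hy).lm⟩
    · exact ⟨_, fun y hy => ((bas y hy).comm _ _).trans (bas y hy).nm⟩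
    · exact ⟨_, fun y hy => (bas y hy).mm⟩
    · exact ⟨_, fun y hy => (bas y hy).m_k⟩
    · exact ⟨_, fun y hy => ((bas y hy).comm _ _).trans (bas y hy).lk⟩
    · exact ⟨_, fun y hy => ((bas y hy).comm _ _).trans (bas y hy).nk⟩
    · exact ⟨_, fun y hy => ((bas y hy).comm _ _).trans (bas y hy).m_k⟩
    · exact ⟨_, fun y hy => (bas y hy).kk⟩
  obtain ⟨c, hc⟩ := hconst
  have e2 : flowDefect ξ (fun q : ℝ × Pt =>
      ∑ a, (∑ b, (g q.2 a b : ℂ) * T.vec j q.2 b) * T.vec i q.2 a) x = 0 := by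
    rw [flowDefect_congr (g := fun _ => c) (((hg.isMetricFamily hU).eventually_mem hx).mono
      fun q hq => by rw [← gDot_eq_contract]; exact hc q.2 hq), flowDefect_const]
  rw [e2, hd i x hx, hd j x hx] at e1
  rw [gDot_eq_contract]
  simp only [Fin.sum_univ_four, Matrix.of_apply] at e1 ⊢
  push_cast at e1 ⊢
  linear_combination e1

lemma isConformalKilling_zero_iff : IsConformalKilling U g ξ (fun _ => 0) ↔ IsKilling U g ξ := by
  simp [IsConformalKilling, IsKilling]

end Converse

/-! ### The spin-boost gauge -/

section Gauge

variable {U : Set Pt} {g : MetricField} {T : Tetrad} {A α₀ : Pt → ℝ} {x : Pt}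

/-- The factors by which the spin-boost multiplies the tetrad vectors. -/
def gaugeCoeff (A α₀ : Pt → ℝ) : Leg → Pt → ℂ
  | .l => fun x => (A x : ℂ) ^ 2
  | .n => fun x => ((A x : ℂ) ^ 2)⁻¹
  | .m => fun x => Complex.exp (Complex.I * α₀ x)
  | .mbar => fun x => Complex.exp (-(Complex.I * α₀ x))

lemma Tetrad.vec_gauge (T : Tetrad) (A α₀ : Pt → ℝ) (k : Leg) (x : Pt) :
    (T.gauge A α₀).vec k x = gaugeCoeff A α₀ k x • T.vec k x := by
  funext i
  cases k
  · simp [Tetrad.vec, Tetrad.gauge, gaugeCoeff]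
  · simp [Tetrad.vec, Tetrad.gauge, gaugeCoeff]
  · simp [Tetrad.vec, Tetrad.gauge, gaugeCoeff]
  · simp [Tetrad.vec, Tetrad.gauge, gaugeCoeff, ← Complex.exp_conj]

lemma gDot_smul (c d : ℂ) (v w : Fin 4 → ℂ) :
    gDot g x (c • v) (d • w) = c * d * gDot g x v w := by
  simp only [gDot, Finset.mul_sum, Pi.smul_apply, smul_eq_mul]
  exact Finset.sum_congr rfl fun a _ => Finset.sum_congr rfl fun b _ => by ring

lemma gaugeFactor_sq (x : Pt) :
    gaugeFactor A α₀ x ^ 2 = (A x : ℂ) ^ 2 * Complex.exp (Complex.I * α₀ x) := by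
  rw [gaugeFactor, mul_pow, ← Complex.exp_nat_mul]
  congr 2; push_cast; ring

lemma gaugeFactor_mul_conj (x : Pt) :
    gaugeFactor A α₀ x * (starRingEnd ℂ) (gaugeFactor A α₀ x) = ((A x ^ 2 : ℝ) : ℂ) := by
  have : Complex.exp (Complex.I * α₀ x / 2) * Complex.exp (-(Complex.I * α₀ x / 2)) = 1 := by
    rw [← Complex.exp_add]; simp
  have hc : (starRingEnd ℂ) (gaugeFactor A α₀ x)
      = (A x : ℂ) * Complex.exp (-(Complex.I * α₀ x / 2)) := by
    have h2 : (starRingEnd ℂ) (2 : ℂ) = 2 := Complex.conj_ofNat 2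
    simp [gaugeFactor, ← Complex.exp_conj, neg_div, h2]
  rw [hc, gaugeFactor]
  push_cast
  linear_combination (A x : ℂ) ^ 2 * this

namespace IsTypeIIGauge

lemma factor_ne_zero (hA : IsTypeIIGauge U g T A α₀) (hcan : IsCanonicalTypeII U g T)
    (hx : x ∈ U) : gaugeFactor A α₀ x ≠ 0 := by
  intro h
  have := hA.fourth_root x hx
  rw [h, hcan.psi4 x hx] at this
  exact (one_div_ne_zero (hcan.psi2 x hx)) (by simpa using this.symm)

lemma boost_ne_zero (hA : IsTypeIIGauge U g T A α₀) (hcan : IsCanonicalTypeII U g T)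
    (hx : x ∈ U) : A x ≠ 0 := by
  intro h
  exact hA.factor_ne_zero hcan hx (by simp [gaugeFactor, h])

lemma smooth_boost (hA : IsTypeIIGauge U g T A α₀) : ContDiffOn ℝ ∞ (fun x => A x ^ 2) U := by
  have h1 : ContDiffOn ℝ ∞ (fun x => (gaugeFactor A α₀ x
      * (starRingEnd ℂ) (gaugeFactor A α₀ x)).re) U :=
    Complex.reCLM.contDiff.comp_contDiffOn
      (hA.smooth.mul (Complex.conjCLE.contDiff.comp_contDiffOn hA.smooth))
  refine h1.congr fun x _ => ?_
  rw [gaugeFactor_mul_conj, Complex.ofReal_re]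

/-- Only `A²` and `exp (i α₀)` are smooth: `A` and `α₀` may jump while `A exp (i α₀ / 2)` is
smooth. -/
lemma smooth_coeff (hA : IsTypeIIGauge U g T A α₀) (hcan : IsCanonicalTypeII U g T) :
    ContDiffOn ℝ ∞ (fun x => Complex.exp (Complex.I * α₀ x)) U := by
  have h1 : ContDiffOn ℝ ∞ (fun x => gaugeFactor A α₀ x ^ 2 * ((A x ^ 2 : ℝ) : ℂ)⁻¹) U :=
    (hA.smooth.pow 2).mul ((Complex.ofRealCLM.contDiff.comp_contDiffOn hA.smooth_boost).inv
      fun x hx => by simpa using hA.boost_ne_zero hcan hx)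
  refine h1.congr fun x hx => ?_
  have : (A x : ℂ) ≠ 0 := by simpa using hA.boost_ne_zero hcan hx
  rw [gaugeFactor_sq]
  push_cast
  field_simp

lemma isNullOn (hA : IsTypeIIGauge U g T A α₀) (hcan : IsCanonicalTypeII U g T)
    (hT : T.IsNullOn g U) : (T.gauge A α₀).IsNullOn g U := by
  have hne : ∀ x ∈ U, (A x : ℂ) ≠ 0 := fun x hx => by simpa using hA.boost_ne_zero hcan hx
  have hp := contDiffOn_pi.1 hT.smooth_l
  have hq := contDiffOn_pi.1 hT.smooth_n
  have hr := contDiffOn_pi.1 hT.smooth_m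
  refine ⟨contDiffOn_pi.2 fun i => hA.smooth_boost.mul (hp i),
    contDiffOn_pi.2 fun i => (hA.smooth_boost.inv fun x hx =>
      pow_ne_zero 2 (hA.boost_ne_zero hcan hx)).mul (hq i),
    contDiffOn_pi.2 fun i => (hA.smooth_coeff hcan).mul (hr i), ?_, ?_, ?_, ?_, ?_, ?_, ?_⟩
  · intro x hx; rw [Tetrad.vec_gauge, gDot_smul, hT.ll x hx, mul_zero]
  · intro x hx; rw [Tetrad.vec_gauge, gDot_smul, hT.nn x hx, mul_zero]
  · intro x hx; rw [Tetrad.vec_gauge, gDot_smul, hT.mm x hx, mul_zero]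
  · intro x hx
    rw [Tetrad.vec_gauge, Tetrad.vec_gauge, gDot_smul, hT.ln x hx]
    simp [gaugeCoeff, hne x hx]
  · intro x hx
    rw [Tetrad.vec_gauge, Tetrad.vec_gauge, gDot_smul, hT.m_mbar x hx]
    simp [gaugeCoeff, ← Complex.exp_add]
  · intro x hx; rw [Tetrad.vec_gauge, Tetrad.vec_gauge, gDot_smul, hT.lm x hx, mul_zero]
  · intro x hx; rw [Tetrad.vec_gauge, Tetrad.vec_gauge, gDot_smul, hT.nm x hx, mul_zero]

lemma psi_zero (hcan : IsCanonicalTypeII U g T) (hx : x ∈ U) : psi g (T.gauge A α₀) 0 x = 0 := by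
  have := hcan.psi0 x hx
  simp only [psi, Tetrad.vec_gauge, weylC_smul] at this ⊢
  rw [neg_eq_zero.1 this, mul_zero, neg_zero]

lemma psi_one (hcan : IsCanonicalTypeII U g T) (hx : x ∈ U) : psi g (T.gauge A α₀) 1 x = 0 := by
  have := hcan.psi1 x hx
  simp only [psi, Tetrad.vec_gauge, weylC_smul] at this ⊢
  rw [neg_eq_zero.1 this, mul_zero, neg_zero]

lemma psi_three (hcan : IsCanonicalTypeII U g T) (hx : x ∈ U) :
    psi g (T.gauge A α₀) 3 x = 0 := by
  have := hcan.psi3 x hx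
  simp only [psi, Tetrad.vec_gauge, weylC_smul] at this ⊢
  rw [neg_eq_zero.1 this, mul_zero, neg_zero]

lemma psi_two (hA : IsTypeIIGauge U g T A α₀) (hcan : IsCanonicalTypeII U g T) (hx : x ∈ U) :
    psi g (T.gauge A α₀) 2 x = psi g T 2 x := by
  have hne : (A x : ℂ) ≠ 0 := by simpa using hA.boost_ne_zero hcan hx
  have he : Complex.exp (Complex.I * α₀ x) * Complex.exp (-(Complex.I * α₀ x)) = 1 := by
    rw [← Complex.exp_add]; simp
  have hc : gaugeCoeff A α₀ .l x * gaugeCoeff A α₀ .m x * gaugeCoeff A α₀ .mbar x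
      * gaugeCoeff A α₀ .n x = 1 := by
    simp only [gaugeCoeff]
    rw [mul_assoc ((A x : ℂ) ^ 2), he, mul_one, mul_inv_cancel₀ (pow_ne_zero 2 hne)]
  simp only [psi, Tetrad.vec_gauge, weylC_smul, hc, one_mul]

lemma psi_four (hA : IsTypeIIGauge U g T A α₀) (hcan : IsCanonicalTypeII U g T) (hx : x ∈ U) :
    psi g (T.gauge A α₀) 4 x = psi g T 2 x := by
  have hne : (A x : ℂ) ≠ 0 := by simpa using hA.boost_ne_zero hcan hx
  have he : Complex.exp (Complex.I * α₀ x) * Complex.exp (-(Complex.I * α₀ x)) = 1 := by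
    rw [← Complex.exp_add]; simp
  have h4 := hA.fourth_root x hx
  have hc : gaugeCoeff A α₀ .n x * gaugeCoeff A α₀ .mbar x * gaugeCoeff A α₀ .n x
      * gaugeCoeff A α₀ .mbar x * gaugeFactor A α₀ x ^ 4 = 1 := by
    rw [show gaugeFactor A α₀ x ^ 4 = (gaugeFactor A α₀ x ^ 2) ^ 2 by ring, gaugeFactor_sq]
    simp only [gaugeCoeff]
    have hi : ((A x : ℂ) ^ 2)⁻¹ * (A x : ℂ) ^ 2 = 1 := inv_mul_cancel₀ (pow_ne_zero 2 hne)
    linear_combination (1 + Complex.exp (Complex.I * α₀ x) * Complex.exp (-(Complex.I * α₀ x)))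
      * (((A x : ℂ) ^ 2)⁻¹ * (A x : ℂ) ^ 2) ^ 2 * he
      + (1 + ((A x : ℂ) ^ 2)⁻¹ * (A x : ℂ) ^ 2) * hi
  have hp : psi g (T.gauge A α₀) 4 x = gaugeCoeff A α₀ .n x * gaugeCoeff A α₀ .mbar x
      * gaugeCoeff A α₀ .n x * gaugeCoeff A α₀ .mbar x * psi g T 4 x := by
    simp only [psi, Tetrad.vec_gauge, weylC_smul]
    ring
  rw [h4] at hc
  have h2 := hcan.psi2 x hx
  rw [hp]
  field_simp at hc
  linear_combination hc

end IsTypeIIGauge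

lemma contDiffOn_psi (hU : IsOpen U) (hg : IsLorentzMetricOn g U) (hT : T.IsNullOn g U)
    (k : Fin 5) : ContDiffOn ℝ ∞ (psi g T k) U := by
  have hG := hg.isMetricFamily hU
  have hw : ∀ a b c d, ContDiffOn ℝ ∞ (fun x => (weyl g a b c d x : ℂ)) U := fun a b c d =>
    (hG.smooth_weyl a b c d).ofReal.restrict
  have hC : ∀ i j p q : Leg, ContDiffOn ℝ ∞ (fun x => -weylC g x (T.vec i x) (T.vec j x)
      (T.vec p x) (T.vec q x)) U := fun i j p q =>
    (ContDiffOn.sum fun a _ => ContDiffOn.sum fun b _ => ContDiffOn.sum fun c _ =>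
      ContDiffOn.sum fun d _ => ((((hw a b c d).mul (hT.smooth_vec i a)).mul
        (hT.smooth_vec j b)).mul (hT.smooth_vec p c)).mul (hT.smooth_vec q d)).neg
  fin_cases k <;> exact hC _ _ _ _

/-- A smooth fourth root of the nowhere vanishing function `Ψ₄ / Ψ₂` near `p`, from the branch of
the logarithm around its value at `p`. -/
lemma exists_isTypeIIGauge (hU : IsOpen U) (hg : IsLorentzMetricOn g U) (hT : T.IsNullOn g U)
    (hcan : IsCanonicalTypeII U g T) {p : Pt} (hp : p ∈ U) :
    ∃ V : Set Pt, IsOpen V ∧ p ∈ V ∧ V ⊆ U ∧ ∃ A α₀ : Pt → ℝ, IsTypeIIGauge V g T A α₀ := by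
  set z : Pt → ℂ := fun x => psi g T 4 x / psi g T 2 x with hz
  have hz0 : ∀ x ∈ U, z x ≠ 0 := fun x hx => by
    simp only [hz, hcan.psi4 x hx]; exact one_div_ne_zero (hcan.psi2 x hx)
  have hs : ContDiffOn ℝ ∞ (fun x => z x / z p) U := by
    simp only [div_eq_mul_inv, hz]
    exact ((contDiffOn_psi hU hg hT 4).mul ((contDiffOn_psi hU hg hT 2).inv hcan.psi2)).mul
      contDiffOn_const
  set V := U ∩ (fun x => z x / z p) ⁻¹' Complex.slitPlane with hV
  have hVo : IsOpen V := hs.continuousOn.isOpen_inter_preimage hU Complex.isOpen_slitPlane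
  set L : Pt → ℂ := fun x => Complex.log (z x / z p) + Complex.log (z p) with hL
  have hLs : ContDiffOn ℝ ∞ L V := by
    refine ContDiffOn.add (fun x hx => ?_) contDiffOn_const
    exact (((Complex.contDiffAt_log (n := ∞) hx.2).restrict_scalars ℝ).comp x
      (hs.contDiffAt (hU.mem_nhds hx.1))).contDiffWithinAt
  have hgf : gaugeFactor (fun x => Real.exp ((L x).re / 4)) (fun x => (L x).im / 2)
      = fun x => Complex.exp (L x / 4) := by
    funext x
    rw [gaugeFactor, Complex.ofReal_exp, ← Complex.exp_add]
    congr 1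
    push_cast
    conv_rhs => rw [← Complex.re_add_im (L x)]
    ring
  refine ⟨V, hVo, ⟨hp, ?_⟩, Set.inter_subset_left, fun x => Real.exp ((L x).re / 4),
    fun x => (L x).im / 2, ?_, fun x hx => ?_⟩
  · simp [div_self (hz0 p hp)]
  · rw [hgf]
    have he : ContDiff ℝ ∞ Complex.exp := Complex.contDiff_exp
    exact he.comp_contDiffOn (hLs.div_const 4)
  · have e1 : Complex.exp (L x / 4) ^ 4 = Complex.exp (L x) := by
      rw [← Complex.exp_nat_mul]; congr 1; push_cast; ring
    rw [hgf]
    change Complex.exp (L x / 4) ^ 4 = z x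
    rw [e1, hL]
    simp only
    rw [Complex.exp_add, Complex.exp_log (div_ne_zero (hz0 x hx.1) (hz0 p hp)),
      Complex.exp_log (hz0 p hp), div_mul_cancel₀ _ (hz0 p hp)]

end Gauge

/-! ### Symmetries and the canonical tetrads -/

section Conclusion

variable {U : Set Pt} {g : MetricField} {ξ : Pt → Fin 4 → ℝ} {φ : Pt → ℝ} {T : Tetrad} {x : Pt}

/-- In the gauge `Ψ₄ = Ψ₂`, conformal Killing vectors rescale the tetrad. -/
lemma dragVec_gauge {A α₀ : Pt → ℝ} (hU : IsOpen U) (hg : IsLorentzMetricOn g U)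
    (hT : T.IsNullOn g U) (hcan : IsCanonicalTypeII U g T) (hA : IsTypeIIGauge U g T A α₀)
    (hξ : ContDiffOn ℝ ∞ ξ U) (hφ : ContDiffOn ℝ ∞ φ U) (hk : IsConformalKilling U g ξ φ) :
    ∀ k, ∀ x ∈ U, dragVec ξ (fun q => (T.gauge A α₀).vec k q.2) x
      = fun i => (φ x : ℂ) / 2 * (T.gauge A α₀).vec k x i := by
  have e : ∀ x ∈ U, psi g (T.gauge A α₀) 4 x = psi g (T.gauge A α₀) 2 x := fun x hx => by
    rw [hA.psi_four hcan hx, hA.psi_two hcan hx]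
  refine fun k x hx => dragVec_eq hU hg (hA.isNullOn hcan hT) hξ hφ hk
    (fun x hx => IsTypeIIGauge.psi_zero hcan hx) (fun x hx => IsTypeIIGauge.psi_one hcan hx)
    (fun x hx => by rw [hA.psi_two hcan hx]; exact hcan.psi2 x hx)
    (fun x hx => IsTypeIIGauge.psi_three hcan hx)
    (fun x hx => by rw [hA.psi_four hcan hx]; exact hcan.psi2 x hx) (fun x hx h => ?_) k hx
  rw [e x hx, ← h]
  exact flowDefect_congr (((hg.isMetricFamily hU).eventually_mem hx).mono fun q hq => e q.2 hq)

/-- Killing vectors preserve the tetrad with `Ψ₄ = 1`. -/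
lemma dragVec_canonical (hU : IsOpen U) (hg : IsLorentzMetricOn g U)
    (hT : T.IsNullOn g U) (hcan : IsCanonicalTypeII U g T)
    (hξ : ContDiffOn ℝ ∞ ξ U) (hk : IsConformalKilling U g ξ (fun _ => 0)) :
    ∀ k, ∀ x ∈ U, dragVec ξ (fun q => T.vec k q.2) x
      = fun i => (((fun _ => 0 : Pt → ℝ) x : ℝ) : ℂ) / 2 * T.vec k x i := by
  refine fun k x hx => dragVec_eq hU hg hT hξ contDiffOn_const hk hcan.psi0 hcan.psi1 hcan.psi2
    hcan.psi3 (fun x hx => by rw [hcan.psi4 x hx]; exact one_ne_zero) (fun x hx _ => ?_) k hx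
  rw [flowDefect_congr (g := fun _ => 1) (((hg.isMetricFamily hU).eventually_mem hx).mono
    fun q hq => hcan.psi4 q.2 hq), flowDefect_const]
  simp

/-- For a vanishing conformal factor the rescalings are trivial, so no weight is required. -/
lemma isLieDerived_of_dragVec (hU : IsOpen U) (hg : IsLorentzMetricOn g U)
    (hT : T.IsNullOn g U) (hξ : ContDiffOn ℝ ∞ ξ U)
    (hk : IsConformalKilling U g ξ (fun _ => 0))
    (hd : ∀ k, ∀ x ∈ U, dragVec ξ (fun q => T.vec k q.2) x
      = fun i => (((fun _ => 0 : Pt → ℝ) x : ℝ) : ℂ) / 2 * T.vec k x i)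
    {e : NPComb} (he : e.DefinedOn g T U) : IsLieDerived U ξ (e.eval g T) := by
  have h := isLieRecurrent_of_hasWeight (w := 0) (admissible := fun Ω _ => Ω = fun _ => 1) hU hg hT
    hξ contDiffOn_const hk hd he (fun t V _ => by funext x; simp [expFactor])
    (fun V _ _ Ω _ _ hΩ _ x _ => by
      have h1 : rescaleMetric (fun _ => 1) g = g := by funext y; simp [rescaleMetric]
      have h2 : T.rescale (fun _ => 1) = T := by cases T; simp [Tetrad.rescale]
      rw [hΩ, h1, h2]; simp)
  intro x hx
  simpa using h x hx

end Conclusion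

end NewmanPenrose

end

theorem theorem17
    (U : Set Pt) (hU : IsOpen U)
    (g : MetricField) (hg : IsLorentzMetricOn g U)
    (T : Tetrad) (hT : T.IsNullOn g U) (hcan : IsCanonicalTypeII U g T) :
    -- the gauge transformation is available near every point
    (∀ p ∈ U, ∃ V : Set Pt, IsOpen V ∧ p ∈ V ∧ V ⊆ U ∧ ∃ A α₀ : Pt → ℝ, IsTypeIIGauge V g T A α₀)
    ∧
    -- statements about any such transformed tetrad
    (∀ A α₀ : Pt → ℝ, IsTypeIIGauge U g T A α₀ →
      (T.gauge A α₀).IsNullOn g U ∧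
      (∀ x ∈ U, psi g (T.gauge A α₀) 4 x = psi g (T.gauge A α₀) 2 x) ∧
      -- the (C)KVs are the solutions of the hatted commutator equations for the coordinates
      (∀ (ξ : Pt → Fin 4 → ℝ) (φ : Pt → ℝ), ContDiffOn ℝ ∞ ξ U → ContDiffOn ℝ ∞ φ U →
        (IsConformalKilling U g ξ φ ↔
          ∀ i : Fin 4, NPLieCommutator U (T.gauge A α₀) ξ φ (coord i))) ∧
      -- (a) properly conformally weighted combinations, every (C)KV
      (∀ (ξ : Pt → Fin 4 → ℝ) (φ : Pt → ℝ), ContDiffOn ℝ ∞ ξ U → ContDiffOn ℝ ∞ φ U →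
        IsConformalKilling U g ξ φ →
        ∀ (e : NPComb) (w : ℝ), e.DefinedOn g (T.gauge A α₀) U →
          IsConformallyWeighted U g (T.gauge A α₀) e w →
          IsLieRecurrent U ξ φ w (e.eval g (T.gauge A α₀))) ∧
      -- (b) all combinations: every HV
      (∀ (ξ : Pt → Fin 4 → ℝ) (c : ℝ), ContDiffOn ℝ ∞ ξ U →
        IsConformalKilling U g ξ (fun _ => c) →
        ∀ (e : NPComb) (w : ℝ), e.DefinedOn g (T.gauge A α₀) U →
          IsHomotheticallyWeighted U g (T.gauge A α₀) e w →
          IsLieRecurrent U ξ (fun _ => c) w (e.eval g (T.gauge A α₀))) ∧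
      -- (b) all combinations: every KV
      (∀ ξ : Pt → Fin 4 → ℝ, ContDiffOn ℝ ∞ ξ U → IsKilling U g ξ →
        ∀ e : NPComb, e.DefinedOn g (T.gauge A α₀) U →
          IsLieDerived U ξ (e.eval g (T.gauge A α₀))))
    ∧
    -- KVs only: the original canonical tetrad
    ((∀ ξ : Pt → Fin 4 → ℝ, ContDiffOn ℝ ∞ ξ U →
        (IsKilling U g ξ ↔ ∀ i : Fin 4, NPLieCommutator U T ξ (fun _ => 0) (coord i))) ∧
      (∀ ξ : Pt → Fin 4 → ℝ, ContDiffOn ℝ ∞ ξ U → IsKilling U g ξ →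
        ∀ e : NPComb, e.DefinedOn g T U → IsLieDerived U ξ (e.eval g T))) := by
  refine ⟨fun p hp => exists_isTypeIIGauge hU hg hT hcan hp, fun A α₀ hA => ?_, fun ξ hξ => ?_,
    fun ξ hξ hk e he => ?_⟩
  · have hT' := hA.isNullOn hcan hT
    refine ⟨hT', fun x hx => by rw [hA.psi_four hcan hx, hA.psi_two hcan hx],
      fun ξ φ hξ hφ => ?_, fun ξ φ hξ hφ hk e w he hw => ?_, fun ξ c hξ hk e w he hw => ?_,
      fun ξ hξ hk e he => ?_⟩
    · rw [npLieCommutator_coord_iff hU hT' hξ]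
      exact ⟨dragVec_gauge hU hg hT hcan hA hξ hφ, isConformalKilling_of_dragVec hU hg hT'⟩
    · exact isLieRecurrent_of_hasWeight hU hg hT' hξ hφ hk
        (dragVec_gauge hU hg hT hcan hA hξ hφ hk) he (fun _ _ _ => trivial) hw
    · exact isLieRecurrent_of_hasWeight hU hg hT' hξ contDiffOn_const hk
        (dragVec_gauge hU hg hT hcan hA hξ contDiffOn_const hk) he
        (fun t V _ => ⟨Real.exp (t * c * (1 / 2)), fun _ _ => rfl⟩) hw
    · have hk' := isConformalKilling_zero_iff.2 hk
      exact isLieDerived_of_dragVec hU hg hT' hξ hk'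
        (dragVec_gauge hU hg hT hcan hA hξ contDiffOn_const hk') he
  · rw [npLieCommutator_coord_iff hU hT hξ, ← isConformalKilling_zero_iff]
    exact ⟨dragVec_canonical hU hg hT hcan hξ, isConformalKilling_of_dragVec hU hg hT⟩
  · have hk' := isConformalKilling_zero_iff.2 hk
    exact isLieDerived_of_dragVec hU hg hT hξ hk' (dragVec_canonical hU hg hT hcan hξ hk') he
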